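/- Let $S$ be the scattering matrix of a diagonal scattering theory with one particle species: a meromorphic function on $\mathbb C$ with $S(\theta)S(-\theta)=1$, $S(\theta)=S(i\pi-\theta)$ and $S(0)=-1$. Put $\varphi(\theta)=\frac{d}{d\theta}(-i\log S(\theta))=-iS'(\theta)/S(\theta)$. Let $(F_n)_{n\ge 0}$ be the form factors of a local operator: functions of $n$ complex rapidities whose only singularities, at points $(x_1,\dots,x_n)$ where no difference $x_i-x_j$ $(i\ne j)$ is a zero or pole of $S$, are at most simple kinematical poles at $x_i-x_j\in i\pi+2\pi i\mathbb Z$, and which satisfy, at regular points, the exchange axiom $$F_n(\dots,\theta_j,\theta_{j+1},\dots)=S(\theta_j-\theta_{j+1})F_n(\dots,\theta_{j+1},\theta_j,\dots)$$ and the kinematical pole axiom $$-i\operatorname*{Res}_{\theta=\theta'}F_{n+2}(\theta+i\pi,\theta',\theta_1,\dots,\theta_n)=\Big(1-\prod_{k=1}^n S(\theta'-\theta_k)\Big)F_n(\theta_1,\dots,\theta_n).$$ For pairwise distinct rapidities, the connected diagonal form factor $F_{2N,c}(\theta_1,\dots,\theta_N)$ is the finite piece of $F_{2N}(\theta_1+i\pi+\eta_1,\dots,\theta_N+i\pi+\eta_N,\theta_N,\dots,\theta_1)$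 as $\eta\to0$, that is, the constant term of its Laurent expansion in $\eta_1,\dots,\eta_N$ (which has at most a simple pole in each $\eta_i$). At coinciding rapidities, $F_{2N,c}$ is the limit of its values at pairwise distinct rapidities. Let $n,m\ge1$, $k\ge0$, and let $\theta_1,\dots,\theta_{k+2}\in\mathbb C$ be rapidities that are pairwise distinct modulo $i\pi$, such that no difference $\theta_i-\theta_j$ $(i\neq j)$ is a zero or pole of $S$ (for distinct real rapidities and $|S|=1$ on $\mathbb R$ both conditions are automatic). Write $\varphi_{ij}=\varphi(\theta_i-\theta_j)$ and assume $\varphi_{12}\neq0$. For a finite sequence $s=(s_1,\dots,s_l)$ of labels let $[s]_\varphi=\varphi_{s_1s_2}\varphi_{s_2s_3}\cdots\varphi_{s_{l-1}s_l}$ (equal to $1$ if $l=1$), and for a multiset $M=\{a_1,\dots,a_N\}$ of labels write $F_c(M)=F_{2N,c}(\theta_{a_1},\dots,\theta_{a_N})$. For a multiset $M$ let $S_{a,b}(M)$ be the set of distinct sequences that contain every member of $M$ exactly once (with multiplicity), start with $a$ and end with $b$; let $\tilde S_{1,2}(M)$ be the set of those $s\in S_{1,2}(M)$ in which the first number after the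 rightmost $1$ is $2$. Let $B=\{3,4,\dots,k+2\}$ and let $A=\{1^{(\times n)},2^{(\times m)},B\}$ be the multiset consisting of $n$ copies of $1$, $m$ copies of $2$, and $B$. Then the degenerate connected form factor $F_c(A)$ exists, i.e. the limit defining it exists, and $$F_c(A)=n!\,m!\sum_{B=B^+\cup B^-}\Big(\frac{F_c(1,2,B^+)}{\varphi_{12}}\sum_{s\in\tilde S_{1,2}(A\setminus B^+)}[s]_\varphi+F_c(1,B^+)\sum_{s\in S_{1,1}(A\setminus B^+)}[s]_\varphi+F_c(2,B^+)\sum_{s\in S_{2,2}(A\setminus B^+)}[s]_\varphi\Big),$$ where the sum runs over all partitions of $B$ into two disjoint, possibly empty, subsets $B^+,B^-$. -/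

import Mathlib

open Complex Filter Topology

noncomputable section

namespace DiagFF

/-- Two-particle scattering matrix of a diagonal theory with one particle species:
a meromorphic function (in normal form, so that the value `0` is taken exactly at the zeros
and at the poles) with `S(θ) S(-θ) = 1`, `S(θ) = S(iπ - θ)` and `S(0) = -1`. -/
structure IsScatteringMatrix (S : ℂ → ℂ) : Prop where
  meromorphic : MeromorphicNFOn S Set.univ
  unitarity : ∀ θ : ℂ, S (-θ) = (S θ)⁻¹
  crossing : ∀ θ : ℂ, S (Real.pi * I - θ) = S θ
  at_zero : S 0 = -1

/-- The derivative of the phase shift, `φ = d/dθ (-i log S) = -i S'/S`. -/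
def phi (S : ℂ → ℂ) (θ : ℂ) : ℂ := -I * logDeriv S θ

/-- All differences of the rapidities are regular points of `S`, neither zeros nor poles. -/
def Regular (S : ℂ → ℂ) {n : ℕ} (x : Fin n → ℂ) : Prop :=
  ∀ i j, i ≠ j → S (x i - x j) ≠ 0

/-- `∏_{i<j} cosh((x_i - x_j)/2)`. It has a simple zero along each hyperplane
`x_i - x_j = iπ (mod 2πi)`, `i ≠ j`, and no other zeros. -/
def kin {n : ℕ} (x : Fin n → ℂ) : ℂ :=
  ∏ i : Fin n, ∏ j ∈ Finset.Ioi i, Complex.cosh ((x i - x j) / 2)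

/-- Near `x` the only singularities of `f` are (at most) simple kinematical poles,
located at `x_i - x_j = iπ (mod 2πi)`. -/
def OnlyKinematicalPolesAt {n : ℕ} (f : (Fin n → ℂ) → ℂ) (x : Fin n → ℂ) : Prop :=
  ∃ G : (Fin n → ℂ) → ℂ, AnalyticAt ℂ G x ∧ ∀ᶠ y in 𝓝 x, kin y ≠ 0 → f y = G y / kin y

/-- `F n` is the elementary `n`-particle form factor of a local operator, in a theory with
scattering matrix `S`. Nothing is required of the value of `F n` at its poles. -/
structure IsFormFactor (S : ℂ → ℂ) (F : (n : ℕ) → (Fin n → ℂ) → ℂ) : Prop where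
  /-- The singularities are the kinematical poles and those inherited from `S`. -/
  analytic : ∀ (n : ℕ) (x : Fin n → ℂ), Regular S x → OnlyKinematicalPolesAt (F n) x
  /-- Exchange axiom. -/
  exchange : ∀ (n : ℕ) (x : Fin n → ℂ), Regular S x → kin x ≠ 0 →
    ∀ (j : ℕ) (hj : j + 1 < n),
      F n x = S (x ⟨j, by omega⟩ - x ⟨j + 1, hj⟩) *
        F n (x ∘ Equiv.swap ⟨j, by omega⟩ ⟨j + 1, hj⟩)
  /-- Kinematical pole axiom
  `-i Res_{θ=θ'} F_{n+2}(θ+iπ, θ', x_1, …, x_n) = (1 - ∏ S(θ'-x_k)) F_n(x_1, …, x_n)`;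
  the residue at the simple pole is the limit of `(θ-θ')F_{n+2}`. -/
  kinematical : ∀ (n : ℕ) (x : Fin n → ℂ) (θ' : ℂ), Regular S x → kin x ≠ 0 →
    (∀ k, S (θ' - x k) ≠ 0 ∧ Complex.sinh (θ' - x k) ≠ 0) →
      Tendsto
        (fun θ : ℂ => -I * ((θ - θ') *
          F (n + 2) (Fin.cons (θ + Real.pi * I) (Fin.cons θ' x))))
        (𝓝[≠] θ') (𝓝 ((1 - ∏ k, S (θ' - x k)) * F n x))

/-- The arguments `(θ_1+iπ+η_1, …, θ_N+iπ+η_N, θ_N, …, θ_1)`. -/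
def diagArgs {N : ℕ} (θ η : Fin N → ℂ) : Fin (N + N) → ℂ :=
  Fin.append (fun i => θ i + Real.pi * I + η i) (fun i => θ (Fin.rev i))

/-- `c` is the finite piece of `F_{2N}(θ_1+iπ+η_1, …, θ_N+iπ+η_N, θ_N, …, θ_1)` at `η → 0`:
the function equals `G(η)/(η_1⋯η_N)` with `G` analytic at `0`, and `c` is what remains when all
terms singular or with ratios of the `η`'s are discarded, i.e. the constant term of the
Laurent expansion. It is the coefficient of `η_1⋯η_N` in `G`, which is `∂_1⋯∂_N G (0)`. -/
def IsFinitePiece (F : (n : ℕ) → (Fin n → ℂ) → ℂ) {N : ℕ} (θ : Fin N → ℂ) (c : ℂ) : Prop :=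
  ∃ G : (Fin N → ℂ) → ℂ, AnalyticAt ℂ G 0 ∧
    (∀ᶠ η in 𝓝 (0 : Fin N → ℂ), (∀ i, η i ≠ 0) →
      F (N + N) (diagArgs θ η) = G η / ∏ i, η i) ∧
    c = iteratedFDeriv ℂ N G 0 (fun i => Pi.single i 1)

open Classical in
/-- The connected diagonal form factor `F_{2N,c}(θ_1, …, θ_N)` at pairwise distinct rapidities. -/
def connected (F : (n : ℕ) → (Fin n → ℂ) → ℂ) {N : ℕ} (θ : Fin N → ℂ) : ℂ :=
  if h : ∃ c, IsFinitePiece F θ c then h.choose else 0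

/-- `c` is the value of the connected diagonal form factor at a possibly degenerate point `θ`:
the limit of its values at pairwise distinct rapidities tending to `θ`. -/
def HasDegenerateValue (F : (n : ℕ) → (Fin n → ℂ) → ℂ) {N : ℕ} (θ : Fin N → ℂ) (c : ℂ) : Prop :=
  Tendsto (fun ϑ : Fin N → ℂ => connected F ϑ)
    (𝓝[{ϑ : Fin N → ℂ | Function.Injective ϑ}] θ) (𝓝 c)

/-- The rapidities `(θ_{l_1}, …, θ_{l_N})` of a list of labels. -/
def rapidities (θ : ℕ → ℂ) (l : List ℕ) : Fin l.length → ℂ := fun i => θ (l.get i)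

/-- `[s]_φ = φ_{s_1 s_2} φ_{s_2 s_3} ⋯ φ_{s_{n-1} s_n}`, with `φ_{jk} = φ(θ_j - θ_k)`. -/
def bracket (S : ℂ → ℂ) (θ : ℕ → ℂ) : List ℕ → ℂ
  | [] => 1
  | [_] => 1
  | a :: b :: s => phi S (θ a - θ b) * bracket S θ (b :: s)

/-- `S_{a,b}(A)`: the set of all sequences that contain every member of the multiset `A` exactly
once (with multiplicity), start with `a` and end with `b`. -/
def paths (a b : ℕ) (A : Multiset ℕ) : Finset (List ℕ) :=
  A.lists.toFinset.filter fun s => s.head? = some a ∧ s.getLast? = some b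

open Classical in
/-- `S̃_{1,2}(A)`: the sequences in `S_{1,2}(A)` in which the first number after the
rightmost `1` is `2`. -/
def paths' (A : Multiset ℕ) : Finset (List ℕ) :=
  (paths 1 2 A).filter fun s => ∃ u v : List ℕ, s = u ++ 1 :: 2 :: v ∧ 1 ∉ v

end DiagFF

end

/-!
Near a diagonal point `(θ₀, θ₀)` the form factor, as a function of independent rapidities `x` and
`t`, can be written as
`F_{2N}(x_1 + iπ, …, x_N + iπ, t_N, …, t_1) = H ∏ (x_i - x_j)(t_j - t_i) / ∏ (x_i - t_j)`
with `H = H(x, t)` analytic, where the products run over the `i < j`, respectively all `i, j`,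
with `θ₀_i = θ₀_j`: since `S(0) = -1`, the exchange axiom makes the function vanish where two of
the `x_i`, or two of the `t_i`, coincide. By the kinematical pole axiom `H`, restricted to `x_p =
t_p`, is the same function for the remaining pairs times a factor that vanishes on the diagonal,
with derivative proportional to `∑_k φ(t_p - t_k) η_k`. By induction on `N`, all derivatives of
`H` of order less than `N` vanish on the diagonal, and at distinct rapidities the connected form
factor is the coefficient of `η_1 ⋯ η_N` in the leading term of `η ↦ H(t + η, t)`. This
coefficient is analytic in `t`, also at coinciding rapidities, so the degenerate value exists.

As the lower derivatives of `H` vanish along the whole diagonal, the derivative of order `N` kills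
the directions `(v, v)`. Together with the exchange symmetry this shows that the leading term
depends only on the sums of the displacements `η_i` over coinciding rapidities: it is a polynomial
in these sums, and the coefficient of `η_1 ⋯ η_N` is `n! m!` times that of a monomial of this
polynomial. The kinematical axiom gives a recursion for the latter, in which a member of the
multiset is removed and weighted by a sum of `φ`'s. Solving it yields sums over sequences, which
are cut at the last `1` and at the last `2`; what remains of them contains `1` and `2` at most
once and contributes an ordinary connected form factor.
-/

namespace DiagFF

/-! ### Division of analytic functions by linear forms -/

section Division

variable {𝕜 E F : Type*} [NontriviallyNormedField 𝕜] [NormedAddCommGroup E] [NormedSpace 𝕜 E]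
  [NormedAddCommGroup F] [NormedSpace 𝕜 F]

/-- For a projection `π` along a vector `v`, the telescoping sum
`∑ k, p (y, …, y, v, π y, …, π y)` (`v` in position `k`) as a multilinear map in `y`. When
`y - π y = ℓ y • v`, it is the quotient of `p (y, …, y) - p (π y, …, π y)` by `ℓ y`. -/
noncomputable def diffQuotient {n : ℕ} (p : ContinuousMultilinearMap 𝕜 (fun _ : Fin (n + 1) => E) F)
    (π : E →L[𝕜] E) (v : E) : ContinuousMultilinearMap 𝕜 (fun _ : Fin n => E) F :=
  ∑ k : Fin (n + 1), (p.curryMid k v).compContinuousLinearMap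
    fun i => if i.castSucc < k then ContinuousLinearMap.id 𝕜 E else π

theorem smul_diffQuotient_apply {n : ℕ}
    (p : ContinuousMultilinearMap 𝕜 (fun _ : Fin (n + 1) => E) F)
    {ℓ : E →L[𝕜] 𝕜} {v : E} {π : E →L[𝕜] E} (hπ : ∀ y, y - π y = ℓ y • v) (y : E) :
    ℓ y • diffQuotient p π v (fun _ => y) = p (fun _ => y) - p (fun _ => π y) := by
  have htelescope := p.toMultilinearMap.map_piecewise_sub_map_piecewise
    (fun _ => y) (fun _ => π y) (fun _ => 0) Finset.univ
  simp only [Finset.piecewise_univ, Finset.mem_univ, if_true, hπ,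
    ContinuousMultilinearMap.coe_coe] at htelescope
  rw [htelescope, diffQuotient, sum_apply, Finset.smul_sum]
  refine Finset.sum_congr rfl fun k _ => ?_
  rw [ContinuousMultilinearMap.compContinuousLinearMap_apply,
    ContinuousMultilinearMap.curryMid_apply]
  set m : Fin (n + 1) → E := fun j => if j < k then y else π y with hm
  have hv : k.insertNth v (fun i => (if i.castSucc < k then ContinuousLinearMap.id 𝕜 E else π) y)
      = Function.update m k v := by
    rw [Fin.insertNth_eq_iff, Function.update_self]
    refine ⟨rfl, funext fun i => ?_⟩
    rw [Fin.removeNth, Function.update_of_ne (Fin.succAbove_ne k i), hm]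
    simp only [Fin.succAbove_lt_iff_castSucc_lt, apply_ite (fun g : E →L[𝕜] E => g y),
      ContinuousLinearMap.id_apply]
  have hy : (fun j => if j < k then y else if j = k then ℓ y • v else π y)
      = Function.update m k (ℓ y • v) := by
    ext j
    rcases eq_or_ne j k with rfl | hj
    · simp
    · simp [hm, hj]
  rw [hv, hy, p.map_update_smul]

theorem norm_diffQuotient_le {n : ℕ} (p : ContinuousMultilinearMap 𝕜 (fun _ : Fin (n + 1) => E) F)
    (π : E →L[𝕜] E) (v : E) :
    ‖diffQuotient p π v‖ ≤ (n + 1) * (‖p‖ * ‖v‖ * max 1 ‖π‖ ^ n) := by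
  have hterm (k : Fin (n + 1)) : ‖(p.curryMid k v).compContinuousLinearMap
      fun i => if i.castSucc < k then ContinuousLinearMap.id 𝕜 E else π‖
        ≤ ‖p‖ * ‖v‖ * max 1 ‖π‖ ^ n := by
    refine (ContinuousMultilinearMap.norm_compContinuousLinearMap_le _ _).trans ?_
    gcongr
    · exact ((p.curryMid k).le_opNorm v).trans_eq (by rw [p.norm_curryMid])
    · refine (Finset.prod_le_prod (g := fun _ => max 1 ‖π‖) (fun _ _ => norm_nonneg _)
        fun i _ => ?_).trans_eq (by simp)
      split_ifs
      · exact ContinuousLinearMap.norm_id_le.trans (le_max_left _ _)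
      · exact le_max_right _ _
  exact (norm_sum_le_of_le _ fun k _ => hterm k).trans_eq (by simp)

/-- The power series with terms `diffQuotient (p (n + 1)) π v`: where `y - π y = ℓ y • v`, it sums
to the quotient of `f y - f (π y)` by `ℓ y` if `p` sums to `f`. -/
noncomputable def diffQuotientSeries (p : FormalMultilinearSeries 𝕜 E F) (π : E →L[𝕜] E) (v : E) :
    FormalMultilinearSeries 𝕜 E F :=
  fun n => diffQuotient (p (n + 1)) π v

theorem diffQuotientSeries_radius_pos {p : FormalMultilinearSeries 𝕜 E F} (hp : 0 < p.radius)
    (π : E →L[𝕜] E) (v : E) : 0 < (diffQuotientSeries p π v).radius := by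
  obtain ⟨C, r, _, hr, hbound⟩ := p.le_mul_pow_of_radius_pos hp
  set c := max 1 ‖π‖
  have : 0 < c := one_pos.trans_le (le_max_left _ _)
  have hρ : 0 < (2 * r * c)⁻¹ := by positivity
  refine lt_of_lt_of_le (ENNReal.coe_pos.2 hρ) (FormalMultilinearSeries.le_radius_of_bound _
    (r := ⟨(2 * r * c)⁻¹, hρ.le⟩) (C * r * ‖v‖) fun n => ?_)
  have hn : (n : ℝ) + 1 ≤ 2 ^ n := by exact_mod_cast Nat.lt_two_pow_self
  calc ‖diffQuotient (p (n + 1)) π v‖ * (2 * r * c)⁻¹ ^ n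
      ≤ (2 ^ n * (C * r ^ (n + 1) * ‖v‖ * c ^ n)) * (2 * r * c)⁻¹ ^ n := by
        gcongr
        refine (norm_diffQuotient_le _ _ _).trans ?_
        gcongr
        exact hbound (n + 1)
    _ = C * r * ‖v‖ * ((2 * r * c) ^ n * (2 * r * c)⁻¹ ^ n) := by ring
    _ = C * r * ‖v‖ := by rw [← mul_pow, mul_inv_cancel₀ (by positivity), one_pow, mul_one]

theorem hasSum_smul_diffQuotientSeries {p : FormalMultilinearSeries 𝕜 E F} {ℓ : E →L[𝕜] 𝕜} {v : E}
    {π : E →L[𝕜] E} (hπ : ∀ y, y - π y = ℓ y • v) {y : E} {a b : F}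
    (ha : HasSum (fun n => p n fun _ => y) a) (hb : HasSum (fun n => p n fun _ => π y) b) :
    HasSum (fun n => ℓ y • diffQuotientSeries p π v n fun _ => y) (a - b) := by
  have hconst : (p 0 fun _ => y) = p 0 fun _ => π y := congrArg (p 0) (Subsingleton.elim _ _)
  have h := (hasSum_nat_add_iff' 1).2 (ha.sub hb)
  simp only [Finset.sum_range_one, hconst, sub_self, sub_zero] at h
  exact h.congr_fun fun n => smul_diffQuotient_apply (p (n + 1)) hπ y

theorem exists_analyticAt_sub_eq_smul [CompleteSpace F] {f : E → F} {x₀ : E}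
    (hf : AnalyticAt 𝕜 f x₀) {ℓ : E →L[𝕜] 𝕜} {v : E} {π : E →L[𝕜] E}
    (hπ : ∀ y, y - π y = ℓ y • v) :
    ∃ g : E → F, AnalyticAt 𝕜 g x₀ ∧ ∀ᶠ y in 𝓝 0, f (x₀ + y) - f (x₀ + π y) = ℓ y • g (x₀ + y) := by
  obtain ⟨p, hp⟩ := hf
  have hq := (diffQuotientSeries p π v).hasFPowerSeriesOnBall
    (diffQuotientSeries_radius_pos hp.radius_pos π v)
  have hπ0 : Tendsto π (𝓝 0) (𝓝 0) := by simpa using π.continuous.tendsto 0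
  refine ⟨fun x => (diffQuotientSeries p π v).sum (x - x₀),
    AnalyticAt.fun_comp (by simpa using hq.analyticAt) (by fun_prop), ?_⟩
  filter_upwards [hp.eventually_hasSum, hπ0.eventually hp.eventually_hasSum,
    hq.eventually_hasSum] with y hy hπy hqy
  simpa using (hasSum_smul_diffQuotientSeries hπ hy hπy).unique (hqy.const_smul (ℓ y))

theorem exists_analyticAt_eq_smul [CompleteSpace F] {f : E → F} {x₀ : E} (hf : AnalyticAt 𝕜 f x₀)
    {ℓ : E →L[𝕜] 𝕜} (hℓ : ℓ ≠ 0) (hx₀ : ℓ x₀ = 0) (hker : ∀ᶠ x in 𝓝 x₀, ℓ x = 0 → f x = 0) :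
    ∃ g : E → F, AnalyticAt 𝕜 g x₀ ∧ ∀ᶠ x in 𝓝 x₀, f x = ℓ x • g x := by
  obtain ⟨w, hw⟩ : ∃ w, ℓ w ≠ 0 := by
    by_contra! h
    exact hℓ (ContinuousLinearMap.ext h)
  set v := (ℓ w)⁻¹ • w
  have hv : ℓ v = 1 := by simp [v, hw]
  obtain ⟨g, hg, hfg⟩ := exists_analyticAt_sub_eq_smul hf
    (π := ContinuousLinearMap.id 𝕜 E - ℓ.smulRight v) (ℓ := ℓ) (v := v) (by simp)
  refine ⟨g, hg, ?_⟩
  have hproj : Tendsto (fun x => x₀ + (ContinuousLinearMap.id 𝕜 E - ℓ.smulRight v) (x - x₀))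
      (𝓝 x₀) (𝓝 x₀) := Continuous.tendsto' (by fun_prop) _ _ (by simp)
  have hsub : Tendsto (fun x => x - x₀) (𝓝 x₀) (𝓝 0) :=
    Continuous.tendsto' (by fun_prop) _ _ (sub_self x₀)
  filter_upwards [hproj.eventually hker, hsub.eventually hfg] with x hx hxg
  rw [hx (by simp [hv, hx₀]), sub_zero] at hxg
  simpa [hx₀] using hxg

theorem eventually_eq_zero_of_generic {Y ι : Type*} [TopologicalSpace Y] [T2Space Y] [Zero Y]
    (s : Finset ι) (L : ι → E →L[𝕜] 𝕜) {ℓ : E →L[𝕜] 𝕜} {d : E} (hd : ℓ d = 0)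
    (hL : ∀ i ∈ s, L i d ≠ 0) {f : E → Y} {x₀ : E} (hf : ∀ᶠ x in 𝓝 x₀, ContinuousAt f x)
    (h : ∀ᶠ x in 𝓝 x₀, ℓ x = 0 → (∀ i ∈ s, L i x ≠ 0) → f x = 0) :
    ∀ᶠ x in 𝓝 x₀, ℓ x = 0 → f x = 0 := by
  filter_upwards [hf, eventually_eventually_nhds.2 h] with x hx h hℓ
  have hline : Tendsto (fun z : 𝕜 => x + z • d) (𝓝[≠] 0) (𝓝 x) :=
    (Continuous.tendsto' (by fun_prop) _ _ (by simp)).mono_left nhdsWithin_le_nhds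
  have hgeneric : ∀ᶠ z in 𝓝[≠] (0 : 𝕜), ∀ i ∈ s, L i (x + z • d) ≠ 0 := by
    refine (Filter.eventually_all_finset s).2 fun i hi => ?_
    rcases eq_or_ne (L i x) 0 with h0 | h0
    · filter_upwards [self_mem_nhdsWithin] with z hz
      simpa [h0, hL i hi] using hz
    · exact (((L i).continuous.tendsto x).comp hline).eventually_ne h0
  have hzero : (fun z : 𝕜 => f (x + z • d)) =ᶠ[𝓝[≠] 0] fun _ => 0 := by
    filter_upwards [hline.eventually h, hgeneric] with z hz hz'
    exact hz (by simp [hℓ, hd]) hz'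
  exact tendsto_nhds_unique (hx.tendsto.comp hline) (tendsto_const_nhds.congr' hzero.symm)

theorem exists_analyticAt_eq_prod_smul [CompleteSpace F] {ι : Type*} (s : Finset ι)
    (L : ι → E →L[𝕜] 𝕜) {d : ι → E} (hd : ∀ i ∈ s, L i (d i) = 0)
    (hne : ∀ i ∈ s, ∀ j ∈ s, i ≠ j → L j (d i) ≠ 0) (hL : ∀ i ∈ s, L i ≠ 0) {x₀ : E}
    (hx₀ : ∀ i ∈ s, L i x₀ = 0) {f : E → F} (hf : AnalyticAt 𝕜 f x₀)
    (hker : ∀ i ∈ s, ∀ᶠ x in 𝓝 x₀, L i x = 0 → f x = 0) :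
    ∃ g : E → F, AnalyticAt 𝕜 g x₀ ∧ ∀ᶠ x in 𝓝 x₀, f x = (∏ i ∈ s, L i x) • g x := by
  classical
  induction s using Finset.induction_on with
  | empty => exact ⟨f, hf, by simp⟩
  | insert a s ha ih =>
    simp only [Finset.mem_insert, forall_eq_or_imp] at hd hne hL hx₀ hker
    obtain ⟨g, hg, hfg⟩ := ih hd.2 (fun i hi => (hne.2 i hi).2) hL.2 hx₀.2 hker.2
    have hga : ∀ᶠ x in 𝓝 x₀, L a x = 0 → g x = 0 := by
      refine eventually_eq_zero_of_generic s L hd.1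
        (fun i hi => hne.1.2 i hi (ne_of_mem_of_not_mem hi ha).symm)
        (hg.eventually_analyticAt.mono fun x hx => hx.continuousAt) ?_
      filter_upwards [hfg, hker.1] with x hx hxa hLa hLs
      exact (smul_eq_zero.1 (hx.symm.trans (hxa hLa))).resolve_left (Finset.prod_ne_zero_iff.2 hLs)
    obtain ⟨g', hg', hgg'⟩ := exists_analyticAt_eq_smul hg hL.1 hx₀.1 hga
    refine ⟨g', hg', ?_⟩
    filter_upwards [hfg, hgg'] with x hx hx'
    rw [Finset.prod_insert ha, hx, hx', smul_smul, mul_comm]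

end Division

/-! ### Iterated derivatives -/

section IteratedDerivatives

variable {𝕜 E E' F : Type*} [NontriviallyNormedField 𝕜]
  [NormedAddCommGroup E] [NormedSpace 𝕜 E] [NormedAddCommGroup E'] [NormedSpace 𝕜 E']
  [NormedAddCommGroup F] [NormedSpace 𝕜 F]

theorem exists_isOpen_contDiffOn {f : E → F} {n : ℕ} {x : E} (hf : ContDiffAt 𝕜 n f x) :
    ∃ u, IsOpen u ∧ x ∈ u ∧ ContDiffOn 𝕜 n f u := by
  simpa using hf.contDiffOn' le_rfl (by simp)

theorem iteratedFDeriv_comp_clm {f : E → F} {n : ℕ} (g : E' →L[𝕜] E) {x : E'}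
    (hf : ContDiffAt 𝕜 n f (g x)) :
    iteratedFDeriv 𝕜 n (fun y => f (g y)) x
      = (iteratedFDeriv 𝕜 n f (g x)).compContinuousLinearMap fun _ => g := by
  obtain ⟨u, hu, hxu, hfu⟩ := exists_isOpen_contDiffOn hf
  have hgu : IsOpen (g ⁻¹' u) := hu.preimage g.continuous
  have h := g.iteratedFDerivWithin_comp_right hfu hu.uniqueDiffOn hgu.uniqueDiffOn hxu le_rfl
  rwa [iteratedFDerivWithin_of_isOpen n hgu hxu, iteratedFDerivWithin_of_isOpen n hu hxu] at h

theorem iteratedFDeriv_comp_add_clm {f : E → F} {n : ℕ} (g : E' →L[𝕜] E) {a : E}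
    (hf : ContDiffAt 𝕜 n f a) (v : Fin n → E') :
    iteratedFDeriv 𝕜 n (fun y => f (a + g y)) 0 v
      = iteratedFDeriv 𝕜 n f a fun i => g (v i) := by
  have hfa : ContDiffAt 𝕜 n (fun y => f (a + y)) (g 0) := by
    refine ContDiffAt.comp _ ?_ (contDiffAt_const.add contDiffAt_id)
    simpa using hf
  rw [iteratedFDeriv_comp_clm g hfa, ContinuousMultilinearMap.compContinuousLinearMap_apply,
    iteratedFDeriv_comp_add_left, map_zero, add_zero]

theorem iteratedFDeriv_smul_eq_zero {f : E → 𝕜} {g : E → F} {x : E} {n a b : ℕ}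
    (hf : ContDiffAt 𝕜 n f x) (hg : ContDiffAt 𝕜 n g x)
    (hfa : ∀ i < a, iteratedFDeriv 𝕜 i f x = 0) (hgb : ∀ i < b, iteratedFDeriv 𝕜 i g x = 0)
    (hn : n < a + b) : iteratedFDeriv 𝕜 n (fun y => f y • g y) x = 0 := by
  obtain ⟨u, hu, hxu, hfu⟩ := exists_isOpen_contDiffOn hf
  obtain ⟨w, hw, hxw, hgw⟩ := exists_isOpen_contDiffOn hg
  have huw := hu.inter hw
  have hle := norm_iteratedFDerivWithin_smul_le (hfu.mono Set.inter_subset_left)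
    (hgw.mono Set.inter_subset_right) huw.uniqueDiffOn ⟨hxu, hxw⟩ le_rfl
  simp only [iteratedFDerivWithin_of_isOpen _ huw ⟨hxu, hxw⟩] at hle
  refine norm_le_zero_iff.1 (hle.trans (Finset.sum_nonpos fun i hi => ?_))
  obtain hi | hi : i < a ∨ n - i < b := by rw [Finset.mem_range] at hi; omega
  · simp [hfa i hi]
  · simp [hgb _ hi]

theorem iteratedFDeriv_succ_clm_smul (κ : E →L[𝕜] 𝕜) {g : E → F} {n : ℕ} {x : E}
    (hg : ContDiffAt 𝕜 (n + 1 : ℕ) g x) (v : Fin (n + 1) → E) :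
    iteratedFDeriv 𝕜 (n + 1) (fun y => κ y • g y) x v = κ x • iteratedFDeriv 𝕜 (n + 1) g x v
      + ∑ k, κ (v k) • iteratedFDeriv 𝕜 n g x (k.removeNth v) := by
  induction n generalizing x with
  | zero =>
    rw [iteratedFDeriv_one_apply, iteratedFDeriv_one_apply,
      fderiv_fun_smul κ.differentiableAt (hg.differentiableAt (by simp))]
    simp
  | succ n ih =>
    have hdiff {m : ℕ} (hm : m < n + 2) : DifferentiableAt 𝕜 (iteratedFDeriv 𝕜 m g) x :=
      hg.differentiableAt_iteratedFDeriv (by exact_mod_cast hm)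
    have hdiff_apply {m : ℕ} (hm : m < n + 2) (w : Fin m → E) :
        DifferentiableAt 𝕜 (fun y => iteratedFDeriv 𝕜 m g y w) x :=
      (hdiff hm).continuousMultilinear_apply_const w
    have hκg : DifferentiableAt 𝕜 (iteratedFDeriv 𝕜 (n + 1) fun y => κ y • g y) x :=
      (κ.contDiff.contDiffAt.smul hg).differentiableAt_iteratedFDeriv
        (by exact_mod_cast Nat.lt_succ_self _)
    have ih_near : (fun y => iteratedFDeriv 𝕜 (n + 1) (fun y => κ y • g y) y (Fin.tail v)) =ᶠ[𝓝 x]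
        fun y => κ y • iteratedFDeriv 𝕜 (n + 1) g y (Fin.tail v)
          + ∑ k, κ (Fin.tail v k) • iteratedFDeriv 𝕜 n g y (k.removeNth (Fin.tail v)) :=
      ((hg.of_le (by exact_mod_cast Nat.le_succ _)).eventually (by simp)).mono
        fun y hy => ih hy (Fin.tail v)
    have hremove (k : Fin (n + 1)) : iteratedFDeriv 𝕜 (n + 1) g x (k.succ.removeNth v)
        = fderiv 𝕜 (fun y => iteratedFDeriv 𝕜 n g y (k.removeNth (Fin.tail v))) x (v 0) := by
      have htail : Fin.tail (k.succ.removeNth v) = k.removeNth (Fin.tail v) := by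
        ext; simp [Fin.tail, Fin.removeNth]
      rw [(hdiff (by simp)).iteratedFDeriv_succ_apply_left', htail]
      simp [Fin.removeNth]
    have hrhs := (κ.hasFDerivAt.fun_smul (hdiff_apply (by simp) (Fin.tail v)).hasFDerivAt).fun_add
      (HasFDerivAt.fun_sum (u := Finset.univ) fun (k : Fin (n + 1)) _ =>
        ((hdiff_apply (by simp) (k.removeNth (Fin.tail v))).hasFDerivAt).fun_const_smul
          (κ (Fin.tail v k)))
    rw [hκg.iteratedFDeriv_succ_apply_left', ih_near.fderiv_eq, hrhs.fderiv,
      Fin.sum_univ_succ (n := n + 1),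
      (hdiff (Nat.lt_succ_self _)).iteratedFDeriv_succ_apply_left', Fin.removeNth_zero]
    simp [hremove, Fin.tail, add_assoc]

theorem iteratedFDeriv_smul_eq_smul {m : E → 𝕜} {g : E → F} {x : E} {n : ℕ}
    (hm : ContDiffAt 𝕜 n m x) (hg : ContDiffAt 𝕜 n g x)
    (hg₀ : ∀ i < n, iteratedFDeriv 𝕜 i g x = 0) :
    iteratedFDeriv 𝕜 n (fun y => m y • g y) x = m x • iteratedFDeriv 𝕜 n g x := by
  have hm' : ContDiffAt 𝕜 n (fun y => m y - m x) x := hm.sub contDiffAt_const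
  have hsplit : (fun y => m y • g y) = fun y => m x • g y + (m y - m x) • g y := by
    ext; rw [← add_smul, add_sub_cancel]
  have hrest : iteratedFDeriv 𝕜 n (fun y => (m y - m x) • g y) x = 0 := by
    refine iteratedFDeriv_smul_eq_zero (a := 1) (b := n) hm' hg (fun i hi => ?_) hg₀ (by omega)
    obtain rfl : i = 0 := by omega
    ext; simp
  rw [hsplit, fun_iteratedFDeriv_add_apply (hg.const_smul _) (hm'.fun_smul hg), hrest, add_zero,
    iteratedFDeriv_const_smul_apply' hg]

theorem iteratedFDeriv_succ_smul_apply {m : E → 𝕜} {g : E → F} {x : E} {n : ℕ}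
    (hm : ContDiffAt 𝕜 (n + 1 : ℕ) m x) (hg : ContDiffAt 𝕜 (n + 1 : ℕ) g x) (hmx : m x = 0)
    (hg₀ : ∀ i < n, iteratedFDeriv 𝕜 i g x = 0) (v : Fin (n + 1) → E) :
    iteratedFDeriv 𝕜 (n + 1) (fun y => m y • g y) x v
      = ∑ k, fderiv 𝕜 m x (v k) • iteratedFDeriv 𝕜 n g x (k.removeNth v) := by
  set κ := fderiv 𝕜 m x
  have hκ_smooth : ContDiffAt 𝕜 (n + 1 : ℕ) κ x := κ.contDiff.contDiffAt
  set r : E → 𝕜 := fun y => m y - κ (y - x) with hr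
  have hr_smooth : ContDiffAt 𝕜 (n + 1 : ℕ) r x :=
    hm.sub (κ.contDiff.contDiffAt.comp x (contDiffAt_id.sub contDiffAt_const))
  have hr₀ : ∀ i < 2, iteratedFDeriv 𝕜 i r x = 0 := by
    intro i hi
    interval_cases i
    · ext; simp [hr, hmx]
    · have hr' : HasFDerivAt r (κ - κ) x :=
        (hm.differentiableAt (by simp)).hasFDerivAt.fun_sub
          (κ.hasFDerivAt.comp x ((hasFDerivAt_id x).sub_const x))
      ext w
      rw [iteratedFDeriv_one_apply, hr'.fderiv, sub_self]
      rfl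
  have hsplit : (fun y => m y • g y)
      = fun y => κ y • g y + -κ x • g y + r y • g y := by
    ext
    rw [← add_smul, ← add_smul]
    congr 1
    simp only [hr, map_sub]
    ring
  have hκg : ContDiffAt 𝕜 (n + 1 : ℕ) (fun y => κ y • g y) x := hκ_smooth.smul hg
  have hxg : ContDiffAt 𝕜 (n + 1 : ℕ) (fun y => -κ x • g y) x := hg.const_smul _
  rw [hsplit, fun_iteratedFDeriv_add_apply (hκg.add hxg) (hr_smooth.fun_smul hg),
    fun_iteratedFDeriv_add_apply hκg hxg, iteratedFDeriv_const_smul_apply' hg,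
    iteratedFDeriv_smul_eq_zero hr_smooth hg hr₀ hg₀ (by omega), add_zero,
    add_apply, iteratedFDeriv_succ_clm_smul κ hg]
  simp

end IteratedDerivatives

theorem apply_eq_of_update_eq {ι β : Type*} [Finite ι] [DecidableEq ι] {α : ι → Type*}
    {D : (∀ i, α i) → β} {a b : ∀ i, α i}
    (h : ∀ v i, D (Function.update v i (a i)) = D (Function.update v i (b i))) : D a = D b := by
  cases nonempty_fintype ι
  have hpiecewise (s : Finset ι) : D a = D (s.piecewise b a) := by
    induction s using Finset.induction_on with
    | empty => rw [Finset.piecewise_empty]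
    | insert i s hi ih =>
      have hs : s.piecewise b a = Function.update (s.piecewise b a) i (a i) := by
        rw [eq_comm, Function.update_eq_self_iff, Finset.piecewise_eq_of_notMem _ _ _ hi]
      rw [ih, Finset.piecewise_insert, ← h, ← hs]
  rw [hpiecewise Finset.univ, Finset.piecewise_univ]

section Diagonal

variable {𝕜 E F ι : Type*}

section Multilinear

variable [CommRing 𝕜] [AddCommGroup E] [Module 𝕜 E] [AddCommGroup F] [Module 𝕜 F]
  {D : MultilinearMap 𝕜 (fun _ : ι => E × E) F}

theorem map_update_eq_of_sub_eq [DecidableEq ι] (hD : ∀ v j, (v j).1 = (v j).2 → D v = 0)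
    (v : ι → E × E) (j : ι) {a b : E × E} (hab : a.1 - a.2 = b.1 - b.2) :
    D (Function.update v j a) = D (Function.update v j b) := by
  rw [← sub_eq_zero, ← D.map_update_sub]
  refine hD _ j ?_
  rw [Function.update_self, Prod.fst_sub, Prod.snd_sub]
  exact sub_eq_sub_iff_sub_eq_sub.1 hab

theorem map_eq_map_sub [Finite ι] (hD : ∀ v j, (v j).1 = (v j).2 → D v = 0) (v : ι → E × E) :
    D v = D fun i => ((v i).1 - (v i).2, 0) := by
  classical
  exact apply_eq_of_update_eq fun w i => map_update_eq_of_sub_eq hD w i (sub_zero _).symm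

theorem map_update_fst_eq [DecidableEq ι] (hD : ∀ v j, (v j).1 = (v j).2 → D v = 0)
    {A : E →ₗ[𝕜] E} (hA : ∀ v, D v = D fun i => A.prodMap LinearMap.id (v i))
    (v : ι → E × E) (j : ι) (x : E) :
    D (Function.update v j (x, 0)) = D (Function.update v j (A x, 0)) := by
  have hA_update (a : E × E) : D (Function.update v j a)
      = D (Function.update (fun i => A.prodMap LinearMap.id (v i)) j
        (A.prodMap LinearMap.id a)) := by
    rw [hA]; congr 1
    exact Function.comp_update (A.prodMap LinearMap.id) v j a
  calc D (Function.update v j (x, 0))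
      = D (Function.update (fun i => A.prodMap LinearMap.id (v i)) j (A x, 0)) := by
        rw [hA_update]; simp
    _ = D (Function.update (fun i => A.prodMap LinearMap.id (v i)) j (0, -A x)) :=
        map_update_eq_of_sub_eq hD _ j (by simp)
    _ = D (Function.update v j (0, -A x)) := by rw [hA_update (0, -A x)]; simp
    _ = D (Function.update v j (A x, 0)) := map_update_eq_of_sub_eq hD _ j (by simp)

end Multilinear

variable [NontriviallyNormedField 𝕜] [NormedAddCommGroup E] [NormedSpace 𝕜 E]
  [NormedAddCommGroup F] [NormedSpace 𝕜 F] {f : E × E → F} {t₀ : E}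

theorem tendsto_diag (t₀ : E) : Tendsto (fun t : E => (t, t)) (𝓝 t₀) (𝓝 (t₀, t₀)) :=
  tendsto_id.prodMk_nhds tendsto_id

theorem iteratedFDeriv_succ_diag_eq_zero {k : ℕ} (hf : ContDiffAt 𝕜 ⊤ f (t₀, t₀))
    (hk : ∀ᶠ t in 𝓝 t₀, iteratedFDeriv 𝕜 k f (t, t) = 0) (v : Fin (k + 1) → E × E)
    (j : Fin (k + 1)) (hj : (v j).1 = (v j).2) :
    iteratedFDeriv 𝕜 (k + 1) f (t₀, t₀) v = 0 := by
  wlog hj₀ : j = 0 generalizing v j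
  · rw [← hf.iteratedFDeriv_comp_perm v (Equiv.swap 0 j)]
    exact this _ 0 (by simpa using hj) rfl
  subst hj₀
  have hdiag : HasFDerivAt (fun t => iteratedFDeriv 𝕜 k f (t, t))
      ((fderiv 𝕜 (iteratedFDeriv 𝕜 k f) (t₀, t₀)).comp
        ((ContinuousLinearMap.id 𝕜 E).prod (ContinuousLinearMap.id 𝕜 E))) t₀ :=
    HasFDerivAt.comp (f := fun t => (t, t)) t₀
      (hf.differentiableAt_iteratedFDeriv (by simp)).hasFDerivAt
      ((hasFDerivAt_id t₀).prodMk (hasFDerivAt_id t₀))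
  have hdiag_zero := hdiag.unique ((hasFDerivAt_const 0 t₀).congr_of_eventuallyEq hk)
  have hv : v 0 = ((v 0).1, (v 0).1) := Prod.ext rfl hj.symm
  rw [iteratedFDeriv_succ_apply_left, hv]
  exact DFunLike.congr_fun (DFunLike.congr_fun hdiag_zero (v 0).1) (Fin.tail v)

theorem eventually_iteratedFDeriv_diag_eq_zero {N : ℕ} (hf : ContDiffAt 𝕜 ⊤ f (t₀, t₀))
    (h : ∀ᶠ t in 𝓝 t₀, ∀ k < N, ∀ v : Fin k → E,
      iteratedFDeriv 𝕜 k f (t, t) (fun i => (v i, 0)) = 0) :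
    ∀ᶠ t in 𝓝 t₀, ∀ k < N, iteratedFDeriv 𝕜 k f (t, t) = 0 := by
  induction N with
  | zero => simp
  | succ N ih =>
    have ihN := ih (h.mono fun t ht k hk => ht k (by omega))
    filter_upwards [h, ihN, ihN.eventually_nhds,
      (tendsto_diag t₀).eventually (hf.eventually (by simp))] with t hfst hlt hnear hft k hk
    obtain hk | rfl := Nat.lt_succ_iff_lt_or_eq.1 hk
    · exact hlt k hk
    ext v
    cases k with
    | zero => rw [Subsingleton.elim v fun i => (i.elim0, 0), hfst 0 hk]; rfl
    | succ k =>
      have := map_eq_map_sub (D := (iteratedFDeriv 𝕜 (k + 1) f (t, t)).toMultilinearMap)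
        (iteratedFDeriv_succ_diag_eq_zero hft (hnear.mono fun s hs => hs k (by omega))) v
      exact this.trans (hfst _ hk _)

end Diagonal

/-! ### Exchange and residue axioms in terms of lists -/

namespace IsScatteringMatrix

variable {S : ℂ → ℂ} (hS : IsScatteringMatrix S)
include hS

theorem analyticAt {z : ℂ} (hz : S z ≠ 0) : AnalyticAt ℂ S z :=
  (meromorphicNFAt_iff_analyticAt_or.1 (hS.meromorphic (Set.mem_univ z))).resolve_right
    fun h => hz h.2.2

theorem sub_ne_zero_symm {a b : ℂ} (h : S (a - b) ≠ 0) : S (b - a) ≠ 0 := by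
  rw [← neg_sub, hS.unitarity]
  exact inv_ne_zero h

theorem add_pi (y : ℂ) : S (y + Real.pi * I) = (S y)⁻¹ := by
  rw [← hS.unitarity, ← hS.crossing (-y), sub_neg_eq_add, add_comm]

theorem sub_pi (y : ℂ) : S (y - Real.pi * I) = (S y)⁻¹ := by
  rw [← hS.crossing y, ← hS.unitarity, neg_sub]

end IsScatteringMatrix

/-- The form factor as a function of the list of its arguments. -/
noncomputable def listFF (F : (n : ℕ) → (Fin n → ℂ) → ℂ) (l : List ℂ) : ℂ := F l.length l.get

/-- The difference of two rapidities is neither a zero or pole of `S` nor a kinematical pole. -/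
def Generic (S : ℂ → ℂ) (a b : ℂ) : Prop := S (a - b) ≠ 0 ∧ cosh ((a - b) / 2) ≠ 0

theorem listFF_ofFn (F : (n : ℕ) → (Fin n → ℂ) → ℂ) {n : ℕ} (f : Fin n → ℂ) :
    listFF F (List.ofFn f) = F n f := by
  have h : (⟨(List.ofFn f).length, (List.ofFn f).get⟩ : Σ n, Fin n → ℂ) = ⟨n, f⟩ :=
    List.equivSigmaTuple.right_inv ⟨n, f⟩
  exact congrArg (fun s : Σ n, Fin n → ℂ => F s.1 s.2) h

theorem ofFn_get_comp_swap {α : Type*} (u v : List α) (a b : α)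
    {i j : Fin (u ++ a :: b :: v).length}
    (hi : (i : ℕ) = u.length) (hj : (j : ℕ) = u.length + 1) :
    List.ofFn ((u ++ a :: b :: v).get ∘ Equiv.swap i j) = u ++ b :: a :: v := by
  refine List.ext_getElem (by simp +arith) fun n _ _ => ?_
  simp only [List.getElem_ofFn, Function.comp_apply, List.get_eq_getElem, Equiv.swap_apply_def,
    Fin.ext_iff, hi, hj]
  grind

theorem kin_get_ne_zero {S : ℂ → ℂ} {l : List ℂ} (hl : l.Pairwise (Generic S)) :
    kin l.get ≠ 0 :=
  Finset.prod_ne_zero_iff.2 fun i _ => Finset.prod_ne_zero_iff.2 fun j hj =>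
    (List.pairwise_iff_get.1 hl i j (Finset.mem_Ioi.1 hj)).2

section

variable {S : ℂ → ℂ} (hS : IsScatteringMatrix S)
include hS

theorem Generic.symm {a b : ℂ} (h : Generic S a b) : Generic S b a := by
  refine ⟨hS.sub_ne_zero_symm h.1, ?_⟩
  rw [← neg_sub, neg_div, cosh_neg]
  exact h.2

theorem regular_get {l : List ℂ} (hl : l.Pairwise (Generic S)) : Regular S l.get := by
  intro i j hij
  rw [List.pairwise_iff_get] at hl
  obtain h | h := lt_or_gt_of_ne hij
  · exact (hl i j h).1
  · exact hS.sub_ne_zero_symm (hl j i h).1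

theorem pairwise_generic_perm {l l' : List ℂ} (hl : l.Pairwise (Generic S)) (h : l.Perm l') :
    l'.Pairwise (Generic S) :=
  h.pairwise hl fun hab => hab.symm hS

variable {F : (n : ℕ) → (Fin n → ℂ) → ℂ} (hF : IsFormFactor S F)
include hF

theorem listFF_exchange {u v : List ℂ} {a b : ℂ} (hl : (u ++ a :: b :: v).Pairwise (Generic S)) :
    listFF F (u ++ a :: b :: v) = S (a - b) * listFF F (u ++ b :: a :: v) := by
  have hj : u.length + 1 < (u ++ a :: b :: v).length := by simp
  rw [listFF, hF.exchange _ _ (regular_get hS hl) (kin_get_ne_zero hl) u.length hj,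
    ← listFF_ofFn F, ofFn_get_comp_swap u v a b rfl rfl]
  simp

theorem listFF_move (u v : List ℂ) (a : ℂ) (hl : (u ++ a :: v).Pairwise (Generic S)) :
    listFF F (u ++ a :: v) = (u.map fun y => S (y - a)).prod * listFF F (a :: (u ++ v)) := by
  induction u using List.reverseRecOn generalizing v with
  | nil => simp
  | append_singleton u b ih =>
    rw [← List.append_cons] at hl
    rw [← List.append_cons, listFF_exchange hS hF hl, ih _ (pairwise_generic_perm hS hl
      ((List.Perm.swap _ _ _).append_left u))]
    simp only [List.map_append, List.prod_append, List.map_cons, List.map_nil, List.prod_cons,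
      List.prod_nil, List.append_assoc, List.cons_append, List.nil_append]
    ring

theorem listFF_eq_zero_of_perm {l l' : List ℂ} (h : l.Perm l') (u : List ℂ)
    (hl : (u ++ l).Pairwise (Generic S)) (h₀ : listFF F (u ++ l') = 0) : listFF F (u ++ l) = 0 := by
  induction h generalizing u with
  | nil => exact h₀
  | cons a _ ih =>
    rw [List.append_cons] at hl h₀ ⊢
    exact ih _ hl h₀
  | swap a b l => rw [listFF_exchange hS hF hl, h₀, mul_zero]
  | trans h₁ _ ih₁ ih₂ =>
    exact ih₁ u hl (ih₂ u (pairwise_generic_perm hS hl (h₁.append_left u)) h₀)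

theorem listFF_eq_zero {l : List ℂ} (hl : l.Pairwise (Generic S)) (h : ¬ l.Nodup) :
    listFF F l = 0 := by
  obtain ⟨a, ha⟩ : ∃ a, [a, a].Sublist l := by
    simpa [List.nodup_iff_sublist] using h
  obtain ⟨r, hr⟩ := ha.exists_perm_append
  refine listFF_eq_zero_of_perm hS hF hr [] hl ?_
  have hself := listFF_exchange hS hF (u := []) (pairwise_generic_perm hS hl hr)
  rw [sub_self, hS.at_zero, neg_one_mul] at hself
  exact self_eq_neg.1 hself

theorem listFF_kinematical {l : List ℂ} {z : ℂ} (hl : l.Pairwise (Generic S))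
    (hz : ∀ y ∈ l, S (z - y) ≠ 0 ∧ sinh (z - y) ≠ 0) :
    Tendsto (fun w : ℂ => -I * ((w - z) * listFF F ((w + Real.pi * I) :: z :: l))) (𝓝[≠] z)
      (𝓝 ((1 - (l.map fun y => S (z - y)).prod) * listFF F l)) := by
  have h := hF.kinematical l.length l.get z (regular_get hS hl) (kin_get_ne_zero hl)
    fun k => hz _ (List.get_mem l k)
  rw [← Fin.prod_univ_fun_getElem]
  refine h.congr fun w => ?_
  rw [← listFF_ofFn F, List.ofFn_cons, List.ofFn_cons, List.ofFn_get]

end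

/-! ### The regular part of the diagonal form factor -/

/-- The arguments `(x_1 + iπ, …, x_N + iπ, t_N, …, t_1)` in terms of two independent sets of
rapidities `x` and `t`; these are the arguments `diagArgs θ η` for `x = θ + η`, `t = θ`. -/
noncomputable def pairArgs {N : ℕ} (x t : Fin N → ℂ) : Fin (N + N) → ℂ :=
  Fin.append (fun i => x i + Real.pi * I) (fun i => t (Fin.rev i))

/-- `F_{2N}(x_1 + iπ, …, x_N + iπ, t_N, …, t_1)`. -/
noncomputable def diagFF (F : (n : ℕ) → (Fin n → ℂ) → ℂ) {N : ℕ} (x t : Fin N → ℂ) : ℂ :=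
  F (N + N) (pairArgs x t)

theorem ofFn_comp_rev {α : Type*} {N : ℕ} (t : Fin N → α) :
    List.ofFn (fun i => t (Fin.rev i)) = (List.ofFn t).reverse := by
  refine List.ext_getElem (by simp) fun i _ _ => ?_
  simp only [List.getElem_ofFn, List.getElem_reverse, List.length_ofFn]
  congr 1
  simp only [Fin.ext_iff, Fin.val_rev]
  omega

theorem diagFF_eq_listFF (F : (n : ℕ) → (Fin n → ℂ) → ℂ) {N : ℕ} (x t : Fin N → ℂ) :
    diagFF F x t = listFF F (List.ofFn (fun i => x i + Real.pi * I) ++ (List.ofFn t).reverse) := by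
  rw [diagFF, pairArgs, ← listFF_ofFn F, List.ofFn_fin_append, ofFn_comp_rev]

/-- The differences of the rapidities `y` are neither zeros nor poles of `S`, and those that do not
vanish are not in `iπℤ`. -/
def Admissible (S : ℂ → ℂ) {ι : Type*} (y : ι → ℂ) : Prop :=
  ∀ a b, S (y a - y b) ≠ 0 ∧ (y a ≠ y b → sinh (y a - y b) ≠ 0)

theorem eventually_sinh_ne_zero : ∀ᶠ z in 𝓝 (0 : ℂ), z ≠ 0 → sinh z ≠ 0 :=
  eventually_nhdsWithin_iff.1 ((Complex.hasDerivAt_sinh 0).eventually_ne (by simp))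

theorem sinh_eq_two_mul_half (d : ℂ) : sinh d = 2 * sinh (d / 2) * cosh (d / 2) := by
  rw [← sinh_two_mul, mul_div_cancel₀ d two_ne_zero]

theorem cosh_half_ne_zero {d : ℂ} (h : d ≠ 0 → sinh d ≠ 0) : cosh (d / 2) ≠ 0 := by
  intro hc
  obtain rfl | hd := eq_or_ne d 0
  · simp at hc
  · exact h hd (by rw [sinh_eq_two_mul_half, hc, mul_zero])

theorem sinh_half_ne_zero {d : ℂ} (h : sinh d ≠ 0) : sinh (d / 2) ≠ 0 := fun hs =>
  h (by rw [sinh_eq_two_mul_half, hs, mul_zero, zero_mul])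

theorem cosh_half_add_pi (d : ℂ) : cosh ((d + Real.pi * I) / 2) = I * sinh (d / 2) := by
  rw [show (d + Real.pi * I) / 2 = d / 2 + (Real.pi / 2) * I by ring, cosh_add, cosh_mul_I,
    sinh_mul_I, Complex.cos_pi_div_two, Complex.sin_pi_div_two]
  ring

theorem Admissible.generic {S : ℂ → ℂ} {ι : Type*} {y : ι → ℂ} (h : Admissible S y) (a b : ι) :
    Generic S (y a) (y b) :=
  ⟨(h a b).1, cosh_half_ne_zero fun hd => (h a b).2 (sub_ne_zero.1 hd)⟩

theorem Admissible.sumElim_self {S : ℂ → ℂ} {ι : Type*} {y : ι → ℂ} (h : Admissible S y) :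
    Admissible S (Sum.elim y y) := by
  rintro (a | a) (b | b) <;> exact h a b

section

variable {S : ℂ → ℂ} (hS : IsScatteringMatrix S)
include hS

theorem Admissible.eventually {ι : Type*} [Finite ι] {y₀ : ι → ℂ} (h : Admissible S y₀) :
    ∀ᶠ y in 𝓝 y₀, Admissible S y := by
  simp only [Admissible, Filter.eventually_all]
  intro a b
  have hsub : Tendsto (fun y : ι → ℂ => y a - y b) (𝓝 y₀) (𝓝 (y₀ a - y₀ b)) :=
    Continuous.tendsto (by fun_prop) _
  refine ((hS.analyticAt (h a b).1).continuousAt.tendsto.comp hsub).eventually_ne (h a b).1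
    |>.and ?_
  by_cases hab : y₀ a = y₀ b
  · rw [hab, sub_self] at hsub
    exact (hsub.eventually eventually_sinh_ne_zero).mono fun y hy hne => hy (sub_ne_zero.2 hne)
  · exact (((Complex.continuous_sinh.tendsto _).comp hsub).eventually_ne ((h a b).2 hab)).mono
      fun y hy _ => hy

theorem Admissible.eventually_sumElim {N : ℕ} {x t : Fin N → ℂ}
    (h : Admissible S (Sum.elim x t : Fin N ⊕ Fin N → ℂ)) :
    ∀ᶠ p in 𝓝 (x, t), Admissible S (Sum.elim p.1 p.2 : Fin N ⊕ Fin N → ℂ) := by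
  have hcont : Continuous fun p : (Fin N → ℂ) × (Fin N → ℂ) =>
      (Sum.elim p.1 p.2 : Fin N ⊕ Fin N → ℂ) :=
    continuous_pi fun a => by cases a <;> simp only [Sum.elim_inl, Sum.elim_inr] <;> fun_prop
  exact (hcont.tendsto (x, t)).eventually (h.eventually hS)

theorem Admissible.generic_add_pi {ι : Type*} {y : ι → ℂ} (h : Admissible S y) {a b : ι}
    (hab : y a ≠ y b) : Generic S (y a + Real.pi * I) (y b) := by
  rw [Generic, add_sub_right_comm, hS.add_pi, cosh_half_add_pi]
  exact ⟨inv_ne_zero (h a b).1, mul_ne_zero I_ne_zero (sinh_half_ne_zero ((h a b).2 hab))⟩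

theorem pairwise_generic_diag {N : ℕ} {x t : Fin N → ℂ}
    (h : Admissible S (Sum.elim x t : Fin N ⊕ Fin N → ℂ)) (hxt : ∀ i j, x i ≠ t j) :
    (List.ofFn (fun i => x i + Real.pi * I) ++ (List.ofFn t).reverse).Pairwise (Generic S) := by
  rw [List.pairwise_append, List.pairwise_reverse, List.pairwise_ofFn, List.pairwise_ofFn]
  refine ⟨fun i j _ => ?_, fun i j _ => h.generic (.inr j) (.inr i), ?_⟩
  · simpa [Generic] using h.generic (.inl i) (.inl j)
  · simp only [List.mem_reverse, List.mem_ofFn]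
    rintro _ ⟨i, rfl⟩ _ ⟨j, rfl⟩
    exact h.generic_add_pi hS (a := .inl i) (b := .inr j) (hxt i j)

variable {F : (n : ℕ) → (Fin n → ℂ) → ℂ} (hF : IsFormFactor S F)
include hF

theorem diagFF_eq_zero {N : ℕ} {x t : Fin N → ℂ}
    (h : Admissible S (Sum.elim x t : Fin N ⊕ Fin N → ℂ)) (hxt : ∀ i j, x i ≠ t j)
    {i j : Fin N} (hij : i ≠ j) (he : x i = x j ∨ t i = t j) : diagFF F x t = 0 := by
  rw [diagFF_eq_listFF]
  refine listFF_eq_zero hS hF (pairwise_generic_diag hS h hxt) fun hn => ?_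
  rw [List.nodup_append, List.nodup_reverse, List.nodup_ofFn, List.nodup_ofFn] at hn
  obtain he | he := he
  · exact hij (hn.1 (congrArg (· + Real.pi * I) he))
  · exact hij (hn.2.1 he)

end

@[fun_prop]
theorem analyticAt_apply {𝕜 ι : Type*} [NontriviallyNormedField 𝕜] [Fintype ι] (i : ι)
    (x : ι → 𝕜) : AnalyticAt 𝕜 (fun y : ι → 𝕜 => y i) x :=
  (ContinuousLinearMap.proj (R := 𝕜) (φ := fun _ : ι => 𝕜) i).analyticAt x

@[fun_prop]
theorem analyticAt_pi {𝕜 E ι : Type*} [NontriviallyNormedField 𝕜] [NormedAddCommGroup E]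
    [NormedSpace 𝕜 E] [Fintype ι] {f : E → ι → 𝕜} {x : E}
    (hf : ∀ i, AnalyticAt 𝕜 (fun y => f y i) x) : AnalyticAt 𝕜 f x :=
  analyticAt_pi_iff.2 hf

section

attribute [local fun_prop] analyticAt_fst analyticAt_snd

@[fun_prop]
theorem analyticAt_kin {n : ℕ} (x : Fin n → ℂ) : AnalyticAt ℂ kin x :=
  Finset.analyticAt_fun_prod _ fun _ _ => Finset.analyticAt_fun_prod _ fun _ _ => by fun_prop

theorem prod_prod_eq_diag_mul {ι M : Type*} [Fintype ι] [LinearOrder ι] [CommMonoid M]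
    (f : ι → ι → M) :
    ∏ i, ∏ j, f i j = (∏ i, f i i) * ∏ i, ∏ j, if i < j then f i j * f j i else 1 := by
  have hsplit (i j : ι) : f i j = (if i = j then f i i else 1) *
      ((if i < j then f i j else 1) * if j < i then f i j else 1) := by
    obtain h | rfl | h := lt_trichotomy i j
    · simp [h, h.ne, h.not_gt]
    · simp
    · simp [h, h.ne', h.not_gt]
  calc ∏ i, ∏ j, f i j
      = (∏ i, ∏ j, if i = j then f i i else 1) * ((∏ i, ∏ j, if i < j then f i j else 1) *
          ∏ i, ∏ j, if j < i then f i j else 1) := by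
        simp only [← Finset.prod_mul_distrib, ← hsplit]
    _ = (∏ i, f i i) * ((∏ i, ∏ j, if i < j then f i j else 1) *
          ∏ i, ∏ j, if i < j then f j i else 1) := by
        rw [Finset.prod_comm (f := fun i j => if j < i then f i j else 1)]
        simp only [Finset.prod_ite_eq, Finset.mem_univ, if_true]
    _ = (∏ i, f i i) * ∏ i, ∏ j, if i < j then f i j * f j i else 1 := by
        simp only [← Finset.prod_mul_distrib, ite_mul_ite, mul_one]

theorem kin_eq_prod_ite {n : ℕ} (x : Fin n → ℂ) :
    kin x = ∏ i, ∏ j, if i < j then cosh ((x i - x j) / 2) else 1 := by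
  refine Finset.prod_congr rfl fun i _ => ?_
  rw [← Finset.prod_filter]
  congr 1
  ext j
  simp

theorem kin_append {M N : ℕ} (f : Fin M → ℂ) (g : Fin N → ℂ) :
    kin (Fin.append f g) = kin f * kin g * ∏ i, ∏ j, cosh ((f i - g j) / 2) := by
  have hlt (i : Fin M) (j : Fin N) : Fin.castAdd N i < Fin.natAdd M j := by
    simp only [Fin.lt_def, Fin.val_castAdd, Fin.val_natAdd]
    omega
  have hlt_castAdd (i j : Fin M) : Fin.castAdd N i < Fin.castAdd N j ↔ i < j := Iff.rfl
  simp only [kin_eq_prod_ite, Fin.prod_univ_add, Fin.append_left, Fin.append_right, hlt,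
    (hlt _ _).not_gt, hlt_castAdd, Fin.natAdd_lt_natAdd_iff, if_true, if_false,
    Finset.prod_mul_distrib, Finset.prod_const_one]
  ring

section

variable {N : ℕ}

/-- The cross ratio of the pairs `(x_i, t_i)` and `(x_j, t_j)`. -/
noncomputable def pairRatio (x t : Fin N → ℂ) (i j : Fin N) : ℂ :=
  (x i - x j) * (t j - t i) / ((x i - t j) * (x j - t i))

/-- The product of the cross ratios over all pairs of labels that coincide at `θ₀`. Divided by
`∏ (x_i - t_i)`, it is the product of the Cauchy determinants `det (1 / (x_i - t_j))` of the
groups of coinciding rapidities. -/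
noncomputable def pairProd (θ₀ x t : Fin N → ℂ) : ℂ :=
  ∏ i, ∏ j, if i < j ∧ θ₀ i = θ₀ j then pairRatio x t i j else 1

/-- The product of the differences `x_i - t_j` that vanish at the diagonal point `θ₀`. -/
noncomputable def crossProd (θ₀ x t : Fin N → ℂ) : ℂ :=
  ∏ i, ∏ j, if θ₀ i = θ₀ j then x i - t j else 1

/-- The product of the differences `x_i - x_j` and `t_j - t_i`, `i < j`, that vanish at the
diagonal point `θ₀`. -/
noncomputable def diffProd (θ₀ x t : Fin N → ℂ) : ℂ :=
  ∏ i, ∏ j, if i < j ∧ θ₀ i = θ₀ j then (x i - x j) * (t j - t i) else 1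

/-- The analytic function `H` is what remains of the form factor near the diagonal point `θ₀` after
the Cauchy determinants of the coinciding rapidities have been split off. -/
structure IsRegularPart (F : (n : ℕ) → (Fin n → ℂ) → ℂ) (θ₀ : Fin N → ℂ)
    (H : (Fin N → ℂ) × (Fin N → ℂ) → ℂ) : Prop where
  analytic : AnalyticAt ℂ H (θ₀, θ₀)
  eq : ∀ᶠ p in 𝓝 (θ₀, θ₀), (∀ i j, p.1 i ≠ p.2 j) →
    diagFF F p.1 p.2 * ∏ i, (p.1 i - p.2 i) = H p * pairProd θ₀ p.1 p.2

theorem crossProd_ne_zero (θ₀ : Fin N → ℂ) {x t : Fin N → ℂ} (hxt : ∀ i j, x i ≠ t j) :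
    crossProd θ₀ x t ≠ 0 := by
  refine Finset.prod_ne_zero_iff.2 fun i _ => Finset.prod_ne_zero_iff.2 fun j _ => ?_
  split_ifs
  exacts [sub_ne_zero.2 (hxt i j), one_ne_zero]

theorem crossProd_mul_pairProd (θ₀ : Fin N → ℂ) {x t : Fin N → ℂ} (hxt : ∀ i j, x i ≠ t j) :
    crossProd θ₀ x t * pairProd θ₀ x t = (∏ i, (x i - t i)) * diffProd θ₀ x t := by
  rw [crossProd, prod_prod_eq_diag_mul, mul_assoc, pairProd, diffProd]
  simp only [if_true]
  congr 1
  simp only [← Finset.prod_mul_distrib]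
  refine Finset.prod_congr rfl fun i _ => Finset.prod_congr rfl fun j _ => ?_
  by_cases hij : i < j
  · by_cases he : θ₀ i = θ₀ j
    · simp only [hij, he, if_true, and_self, pairRatio]
      exact mul_div_cancel₀ _ (mul_ne_zero (sub_ne_zero.2 (hxt i j)) (sub_ne_zero.2 (hxt j i)))
    · simp [he, Ne.symm he]
  · simp [hij]

/-- `sinh (w / 2) / w`, continued to `w = 0`. -/
noncomputable def sinhc : ℂ → ℂ := dslope (fun w => sinh (w / 2)) 0

theorem mul_sinhc (w : ℂ) : w * sinhc w = sinh (w / 2) := by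
  simpa [sinhc] using sub_smul_dslope (fun w : ℂ => sinh (w / 2)) 0 w

theorem analyticAt_sinhc_zero : AnalyticAt ℂ sinhc 0 := by
  have hsinh : AnalyticAt ℂ (fun w : ℂ => sinh (w / 2)) 0 := by fun_prop
  obtain ⟨p, hp⟩ := hsinh
  exact hp.has_fpower_series_dslope_fslope.analyticAt

theorem sinhc_zero : sinhc 0 = 1 / 2 := by
  have hsinh : HasDerivAt (fun w : ℂ => sinh (w / 2)) (cosh (0 / 2) * (1 / 2)) 0 :=
    ((hasDerivAt_id' (0 : ℂ)).div_const 2).csinh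
  rw [sinhc, dslope_same, hsinh.deriv]
  simp

/-- The factor of `kin (pairArgs x t)` that does not vanish near the diagonal point `θ₀`. -/
noncomputable def kinUnit (θ₀ x t : Fin N → ℂ) : ℂ :=
  kin (fun i => x i + Real.pi * I) * kin (fun i => t (Fin.rev i)) *
    ∏ i, ∏ j, if θ₀ i = θ₀ j then I * sinhc (x i - t j) else cosh ((x i + Real.pi * I - t j) / 2)

theorem kin_pairArgs (θ₀ x t : Fin N → ℂ) :
    kin (pairArgs x t) = kinUnit θ₀ x t * crossProd θ₀ x t := by
  rw [pairArgs, kin_append, kinUnit, crossProd, mul_assoc _ _ (∏ i, ∏ j, ite _ _ _),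
    ← Finset.prod_mul_distrib]
  congr 1
  refine Finset.prod_congr rfl fun i _ => ?_
  rw [← Finset.prod_mul_distrib, ← Equiv.prod_comp Fin.revPerm]
  refine Finset.prod_congr rfl fun j _ => ?_
  simp only [Fin.revPerm_apply, Fin.rev_rev]
  split_ifs
  · rw [add_sub_right_comm, cosh_half_add_pi, ← mul_sinhc]
    ring
  · rw [mul_one]

theorem analyticAt_kinUnit (θ₀ : Fin N → ℂ) :
    AnalyticAt ℂ (fun p : (Fin N → ℂ) × (Fin N → ℂ) => kinUnit θ₀ p.1 p.2) (θ₀, θ₀) := by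
  refine (AnalyticAt.mul (by fun_prop) (by fun_prop)).mul
    (Finset.analyticAt_fun_prod _ fun i _ => Finset.analyticAt_fun_prod _ fun j _ => ?_)
  split_ifs with hij
  · refine analyticAt_const.mul (AnalyticAt.fun_comp_of_eq (y := 0) analyticAt_sinhc_zero ?_ ?_)
    · fun_prop
    · exact sub_eq_zero.2 hij
  · fun_prop

theorem kinUnit_ne_zero {S : ℂ → ℂ} {θ₀ : Fin N → ℂ} (h : Admissible S θ₀) :
    kinUnit θ₀ θ₀ θ₀ ≠ 0 := by
  refine mul_ne_zero (mul_ne_zero ?_ ?_) ?_ <;>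
    refine Finset.prod_ne_zero_iff.2 fun i _ => Finset.prod_ne_zero_iff.2 fun j _ => ?_
  · simpa using (h.generic i j).2
  · exact (h.generic _ _).2
  · split_ifs with hij
    · rw [hij, sub_self, sinhc_zero]
      exact mul_ne_zero I_ne_zero (by norm_num)
    · rw [add_sub_right_comm, cosh_half_add_pi]
      exact mul_ne_zero I_ne_zero (sinh_half_ne_zero ((h i j).2 hij))

/-- The coordinate `x_i` of `(x, t)`. -/
noncomputable def fstForm (i : Fin N) : (Fin N → ℂ) × (Fin N → ℂ) →L[ℂ] ℂ :=
  (ContinuousLinearMap.proj i : (Fin N → ℂ) →L[ℂ] ℂ) ∘L ContinuousLinearMap.fst ℂ _ _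

/-- The coordinate `t_i` of `(x, t)`. -/
noncomputable def sndForm (i : Fin N) : (Fin N → ℂ) × (Fin N → ℂ) →L[ℂ] ℂ :=
  (ContinuousLinearMap.proj i : (Fin N → ℂ) →L[ℂ] ℂ) ∘L ContinuousLinearMap.snd ℂ _ _

/-- The linear forms `x_i - x_j` (first component `false`) and `t_j - t_i` (first component
`true`). -/
noncomputable def diffForm : Bool × Fin N × Fin N → (Fin N → ℂ) × (Fin N → ℂ) →L[ℂ] ℂ
  | (false, i, j) => fstForm i - fstForm j
  | (true, i, j) => sndForm j - sndForm i

/-- The linear form `x_i - t_j`. -/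
noncomputable def crossForm (a : Fin N × Fin N) : (Fin N → ℂ) × (Fin N → ℂ) →L[ℂ] ℂ :=
  fstForm a.1 - sndForm a.2

theorem diffForm_false (i j : Fin N) (p : (Fin N → ℂ) × (Fin N → ℂ)) :
    diffForm (false, i, j) p = p.1 i - p.1 j := rfl

theorem diffForm_true (i j : Fin N) (p : (Fin N → ℂ) × (Fin N → ℂ)) :
    diffForm (true, i, j) p = p.2 j - p.2 i := rfl

theorem crossForm_apply (i j : Fin N) (p : (Fin N → ℂ) × (Fin N → ℂ)) :
    crossForm (i, j) p = p.1 i - p.2 j := rfl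

/-- A point of the kernel of `diffForm a` at which no other form `diffForm b` (up to sign) and no
form `crossForm b` vanishes: the coordinates are `0, 1, …, 2N - 1`, except that the two which
`diffForm a` compares are equal. -/
noncomputable def diffPoint (a : Bool × Fin N × Fin N) : (Fin N → ℂ) × (Fin N → ℂ) :=
  (fun k => if a.1 = false ∧ k = a.2.2 then ((a.2.1 : ℕ) : ℂ) else ((k : ℕ) : ℂ),
    fun k => if a.1 = true ∧ k = a.2.2 then ((N + a.2.1 : ℕ) : ℂ) else ((N + k : ℕ) : ℂ))

theorem diffForm_diffPoint {a b : Bool × Fin N × Fin N} (ha : a.2.1 < a.2.2) (hb : b.2.1 < b.2.2) :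
    diffForm b (diffPoint a) = 0 ↔ a = b := by
  obtain ⟨s, i, j⟩ := a
  obtain ⟨s', i', j'⟩ := b
  simp only [Fin.lt_def] at ha hb
  cases s <;> cases s' <;>
    simp only [diffForm_false, diffForm_true, diffPoint, Prod.mk.injEq, sub_eq_zero, true_and,
      false_and, if_false, Bool.false_eq_true, reduceCtorEq, iff_false, Fin.ext_iff] <;>
    (try split_ifs) <;> norm_cast <;> omega

theorem crossForm_diffPoint (a : Bool × Fin N × Fin N) (b : Fin N × Fin N) :
    crossForm b (diffPoint a) ≠ 0 := by
  simp only [crossForm_apply b.1 b.2, sub_ne_zero, diffPoint]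
  split_ifs <;> norm_cast <;> omega

theorem diffForm_ne_zero {a : Bool × Fin N × Fin N} (ha : a.2.1 < a.2.2) : diffForm a ≠ 0 := by
  intro h
  have hflip := (diffForm_diffPoint (a := (!a.1, a.2)) (b := a) ha ha).1 (by rw [h]; rfl)
  simpa using congrArg Prod.fst hflip

section

variable {S : ℂ → ℂ} (hS : IsScatteringMatrix S) {F : (n : ℕ) → (Fin n → ℂ) → ℂ}
  (hF : IsFormFactor S F) {θ₀ : Fin N → ℂ} (hθ : Admissible S θ₀)
include hS hθ

theorem regular_pairArgs : Regular S (pairArgs θ₀ θ₀) := by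
  have hcross (i j : Fin N) : S (θ₀ i + Real.pi * I - θ₀ j) ≠ 0 := by
    rw [add_sub_right_comm, hS.add_pi]
    exact inv_ne_zero (hθ i j).1
  intro k l _
  refine Fin.addCases (fun i => ?_) (fun i => ?_) k <;>
    refine Fin.addCases (fun j => ?_) (fun j => ?_) l <;>
    simp only [pairArgs, Fin.append_left, Fin.append_right]
  · simpa using (hθ i j).1
  · exact hcross _ _
  · exact hS.sub_ne_zero_symm (hcross _ _)
  · exact (hθ _ _).1

include hF

theorem exists_analyticAt_diagFF_mul_crossProd :
    ∃ Ψ : (Fin N → ℂ) × (Fin N → ℂ) → ℂ, AnalyticAt ℂ Ψ (θ₀, θ₀) ∧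
      ∀ᶠ p in 𝓝 (θ₀, θ₀), (∀ i j, p.1 i ≠ p.2 j) →
        diagFF F p.1 p.2 * crossProd θ₀ p.1 p.2 = Ψ p := by
  obtain ⟨G, hG, hFG⟩ := hF.analytic _ _ (regular_pairArgs hS hθ)
  have hargs : AnalyticAt ℂ
      (fun p : (Fin N → ℂ) × (Fin N → ℂ) => pairArgs p.1 p.2) (θ₀, θ₀) := by
    refine analyticAt_pi fun k => Fin.addCases (fun i => ?_) (fun i => ?_) k <;>
      simp only [pairArgs, Fin.append_left, Fin.append_right] <;> fun_prop
  have hunit := analyticAt_kinUnit θ₀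
  refine ⟨_, (hG.fun_comp (f := fun p => pairArgs p.1 p.2) hargs).div hunit
    (kinUnit_ne_zero hθ), ?_⟩
  filter_upwards [hargs.continuousAt.tendsto.eventually hFG,
    hunit.continuousAt.eventually_ne (kinUnit_ne_zero hθ)] with p hFGp hunit_p hxt
  have hcross := crossProd_ne_zero θ₀ hxt
  rw [kin_pairArgs θ₀] at hFGp
  rw [diagFF, hFGp (mul_ne_zero hunit_p hcross), Pi.div_apply]
  field_simp

theorem eventually_eq_zero_of_diffForm {Ψ : (Fin N → ℂ) × (Fin N → ℂ) → ℂ}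
    (hΨ : AnalyticAt ℂ Ψ (θ₀, θ₀)) (hdiag : ∀ᶠ p in 𝓝 (θ₀, θ₀), (∀ i j, p.1 i ≠ p.2 j) →
      diagFF F p.1 p.2 * crossProd θ₀ p.1 p.2 = Ψ p)
    {a : Bool × Fin N × Fin N} (ha : a.2.1 < a.2.2) :
    ∀ᶠ p in 𝓝 (θ₀, θ₀), diffForm a p = 0 → Ψ p = 0 := by
  refine eventually_eq_zero_of_generic Finset.univ crossForm (d := diffPoint a)
    ((diffForm_diffPoint ha ha).2 rfl) (fun b _ => crossForm_diffPoint a b)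
    (hΨ.eventually_analyticAt.mono fun p hp => hp.continuousAt) ?_
  filter_upwards [hdiag, hθ.sumElim_self.eventually_sumElim hS] with p hdiag_p hadm hap hcross
  have hxt : ∀ i j, p.1 i ≠ p.2 j := fun i j =>
    sub_ne_zero.1 (hcross (i, j) (Finset.mem_univ _))
  rw [← hdiag_p hxt, diagFF_eq_zero hS hF hadm hxt ha.ne, zero_mul]
  obtain ⟨_ | _, i, j⟩ := a
  · exact .inl (sub_eq_zero.1 hap)
  · exact .inr (sub_eq_zero.1 hap).symm

theorem exists_isRegularPart : ∃ H, IsRegularPart F θ₀ H := by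
  obtain ⟨Ψ, hΨ, hdiag⟩ := exists_analyticAt_diagFF_mul_crossProd hS hF hθ
  set s : Finset (Bool × Fin N × Fin N) :=
    Finset.univ.filter fun a => a.2.1 < a.2.2 ∧ θ₀ a.2.1 = θ₀ a.2.2 with hs
  have hlt {a} (ha : a ∈ s) : a.2.1 < a.2.2 := (Finset.mem_filter.1 ha).2.1
  obtain ⟨H, hH, hΨH⟩ := exists_analyticAt_eq_prod_smul s diffForm (d := diffPoint)
    (fun a ha => (diffForm_diffPoint (hlt ha) (hlt ha)).2 rfl)
    (fun a ha b hb hab h => hab ((diffForm_diffPoint (hlt ha) (hlt hb)).1 h))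
    (fun a ha => diffForm_ne_zero (hlt ha))
    (fun a ha => by
      obtain ⟨_ | _, i, j⟩ := a
      · exact sub_eq_zero.2 (Finset.mem_filter.1 ha).2.2
      · exact sub_eq_zero.2 (Finset.mem_filter.1 ha).2.2.symm) hΨ
    (fun a ha => eventually_eq_zero_of_diffForm hS hF hθ hΨ hdiag (hlt ha))
  have hprod (p : (Fin N → ℂ) × (Fin N → ℂ)) :
      ∏ a ∈ s, diffForm a p = diffProd θ₀ p.1 p.2 := by
    simp only [hs, Finset.prod_filter, Fintype.prod_prod_type, Fintype.prod_bool, diffForm_true,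
      diffForm_false, diffProd, ← Finset.prod_mul_distrib, ite_mul_ite, mul_one, mul_comm]
  refine ⟨H, hH, ?_⟩
  filter_upwards [hdiag, hΨH] with p hdiag_p hΨH_p hxt
  have hfactor := hdiag_p hxt
  rw [hΨH_p, hprod, smul_eq_mul] at hfactor
  apply mul_right_cancel₀ (crossProd_ne_zero θ₀ hxt)
  linear_combination (∏ i, (p.1 i - p.2 i)) * hfactor - H p * crossProd_mul_pairProd θ₀ hxt

end

end

/-! ### The kinematical recursion -/

theorem ofFn_eq_take_append_cons_drop {α : Type*} {N : ℕ} (p : Fin (N + 1)) (f : Fin (N + 1) → α) :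
    List.ofFn f = (List.ofFn (p.removeNth f)).take p ++
      f p :: (List.ofFn (p.removeNth f)).drop p := by
  refine List.ext_getElem (by simp; omega) fun i hi _ => ?_
  have hmin : min (p : ℕ) N = p := by omega
  rw [List.length_ofFn] at hi
  rw [List.getElem_ofFn]
  rcases lt_trichotomy i p with hip | rfl | hip
  · rw [List.getElem_append_left (by simp; omega)]
    simp [Fin.removeNth, Fin.succAbove_of_castSucc_lt, Fin.lt_def, hip]
  · rw [List.getElem_append_right (by simp)]
    simp [hmin]
  · rw [List.getElem_append_right (by simp; omega)]
    obtain ⟨j, rfl⟩ := Nat.exists_eq_add_of_lt hip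
    have hsub : (p : ℕ) + j + 1 - p = j + 1 := by omega
    simp [Fin.removeNth, Fin.succAbove_of_le_castSucc, Fin.le_def, hmin, hsub]

theorem prod_drop_ofFn {M : Type*} [CommMonoid M] {n : ℕ} (f : Fin n → M) (i : ℕ) :
    ((List.ofFn f).drop i).prod = ∏ j : Fin n, if (j : ℕ) < i then 1 else f j := by
  induction n generalizing i with
  | zero => simp
  | succ n ih =>
    rw [List.ofFn_succ, Fin.prod_univ_succ]
    cases i with
    | zero => simp [List.prod_ofFn]
    | succ i => simp [ih]

/-- The scattering phase of the pair `p` with the other pairs. -/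
noncomputable def phaseProd (S : ℂ → ℂ) {N : ℕ} (p : Fin (N + 1)) (x t : Fin (N + 1) → ℂ) : ℂ :=
  ∏ k : Fin N, S (t p - t (p.succAbove k)) / S (t p - x (p.succAbove k))

/-- The scattering phase for moving the pair `p` to the front of `F_{2N}(x + iπ, t)`. -/
noncomputable def moveFactor (S : ℂ → ℂ) {N : ℕ} (p : Fin (N + 1)) (x t : Fin (N + 1) → ℂ) : ℂ :=
  ∏ k : Fin N, (if k.castSucc < p then S (x (p.succAbove k) - x p)
    else S (t (p.succAbove k) - t p)) / S (x (p.succAbove k) - t p)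

/-- The ratio of the regular part at `x_p = t_p` to the regular part without the pair `p`. -/
noncomputable def residueFactor (S : ℂ → ℂ) {N : ℕ} (p : Fin (N + 1))
    (x t : Fin (N + 1) → ℂ) : ℂ :=
  moveFactor S p x t * (I * (1 - phaseProd S p x t))

/-- The points of the hyperplane `x_p = t_p` at which there are no further coincidences. -/
structure MeetOnlyAt {N : ℕ} (p : Fin N) (x t : Fin N → ℂ) : Prop where
  eq : x p = t p
  left_injective : Function.Injective x
  right_injective : Function.Injective t
  ne : ∀ i j, (i, j) ≠ (p, p) → x i ≠ t j

theorem eventually_of_meetOnlyAt {N : ℕ} {θ₀ : Fin N → ℂ} {p : Fin N}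
    {f : (Fin N → ℂ) × (Fin N → ℂ) → ℂ} (hf : AnalyticAt ℂ f (θ₀, θ₀))
    (h : ∀ᶠ q in 𝓝 (θ₀, θ₀), MeetOnlyAt p q.1 q.2 → f q = 0) :
    ∀ᶠ q in 𝓝 (θ₀, θ₀), q.1 p = q.2 p → f q = 0 := by
  have hzero : ∀ᶠ q in 𝓝 (θ₀, θ₀), crossForm (p, p) q = 0 → f q = 0 := by
    refine eventually_eq_zero_of_generic
      (Finset.univ.filter (· ≠ (p, p)) |>.disjSum (Finset.univ.filter fun b => b.2.1 ≠ b.2.2))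
      (Sum.elim crossForm diffForm)
      (d := (fun k => ((k : ℕ) : ℂ), fun k => if k = p then (p : ℂ) else ((N + k : ℕ) : ℂ)))
      (by simp [crossForm_apply]) ?_
      (hf.eventually_analyticAt.mono fun q hq => hq.continuousAt) (h.mono fun q hq hqp hgen => ?_)
    · rintro (⟨i, j⟩ | ⟨_ | _, i, j⟩) ha <;>
        simp only [Finset.inl_mem_disjSum, Finset.inr_mem_disjSum, Finset.mem_filter,
          Finset.mem_univ, true_and, ne_eq, Prod.mk.injEq, Fin.ext_iff] at ha <;>
        simp only [Sum.elim_inl, Sum.elim_inr, crossForm_apply, diffForm_false, diffForm_true,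
          sub_ne_zero, Fin.ext_iff] <;>
        (try split_ifs) <;> norm_cast <;> omega
    · refine hq ⟨sub_eq_zero.1 hqp, fun i j hij => ?_, fun i j hij => ?_, fun i j hij heq => ?_⟩
      · by_contra hne
        exact hgen (.inr (false, i, j)) (by simpa using hne) (sub_eq_zero.2 hij)
      · by_contra hne
        exact hgen (.inr (true, i, j)) (by simpa using hne) (sub_eq_zero.2 hij.symm)
      · exact hgen (.inl (i, j)) (by simpa using hij) (sub_eq_zero.2 heq)
  exact hzero.mono fun q hq hqp => hq (sub_eq_zero.2 hqp)

section

variable {N : ℕ} {θ₀ x t : Fin (N + 1) → ℂ} {p : Fin (N + 1)}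

theorem MeetOnlyAt.removeNth_ne (h : MeetOnlyAt p x t) (i j : Fin N) :
    p.removeNth x i ≠ p.removeNth t j :=
  h.ne _ _ fun he => Fin.succAbove_ne p i (congrArg Prod.fst he)

theorem MeetOnlyAt.pairProd_eq_removeNth (h : MeetOnlyAt p x t) :
    pairProd θ₀ x t = pairProd (p.removeNth θ₀) (p.removeNth x) (p.removeNth t) := by
  have hx (k : Fin N) : x (p.succAbove k) - t p ≠ 0 :=
    sub_ne_zero.2 (h.ne _ _ fun he => Fin.succAbove_ne p k (congrArg Prod.fst he))
  have ht (k : Fin N) : t p - t (p.succAbove k) ≠ 0 :=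
    sub_ne_zero.2 (h.right_injective.ne (Fin.succAbove_ne p k).symm)
  have hleft (k : Fin N) : pairRatio x t p (p.succAbove k) = 1 := by
    rw [pairRatio, h.eq, div_eq_one_iff_eq (mul_ne_zero (ht k) (hx k))]
    ring
  have hright (k : Fin N) : pairRatio x t (p.succAbove k) p = 1 := by
    rw [pairRatio, h.eq, div_eq_one_iff_eq (mul_ne_zero (hx k) (ht k))]
  rw [pairProd, Fin.prod_univ_succAbove _ p, Fin.prod_univ_succAbove _ p]
  simp only [lt_irrefl, false_and, if_false, hleft, ite_self, Finset.prod_const_one, one_mul]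
  refine Finset.prod_congr rfl fun i _ => ?_
  rw [Fin.prod_univ_succAbove _ p]
  simp only [hright, ite_self, one_mul, Fin.succAbove_lt_succAbove_iff]
  rfl

end

section

variable {N : ℕ} {θ₀ : Fin N → ℂ}

theorem pairProd_ne_zero {x t : Fin N → ℂ} (hne : ∀ i j, i ≠ j → x i ≠ t j)
    (hx : Function.Injective x) (ht : Function.Injective t) : pairProd θ₀ x t ≠ 0 := by
  refine Finset.prod_ne_zero_iff.2 fun i _ => Finset.prod_ne_zero_iff.2 fun j _ => ?_
  split_ifs with h
  · have hij : i ≠ j := h.1.ne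
    exact div_ne_zero (mul_ne_zero (sub_ne_zero.2 (hx.ne hij)) (sub_ne_zero.2 (ht.ne hij.symm)))
      (mul_ne_zero (sub_ne_zero.2 (hne i j hij)) (sub_ne_zero.2 (hne j i hij.symm)))
  · exact one_ne_zero

theorem continuousAt_pairProd {q : (Fin N → ℂ) × (Fin N → ℂ)}
    (hne : ∀ i j, i ≠ j → q.1 i ≠ q.2 j) :
    ContinuousAt (fun q : (Fin N → ℂ) × (Fin N → ℂ) => pairProd θ₀ q.1 q.2) q := by
  refine tendsto_finsetProd _ fun i _ => tendsto_finsetProd _ fun j _ => ?_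
  split_ifs with h
  · have hij : i ≠ j := h.1.ne
    exact ContinuousAt.div (by fun_prop) (by fun_prop)
      (mul_ne_zero (sub_ne_zero.2 (hne i j hij)) (sub_ne_zero.2 (hne j i hij.symm)))
  · exact tendsto_const_nhds

end

section

variable {S : ℂ → ℂ} (hS : IsScatteringMatrix S) {N : ℕ}
include hS

theorem IsScatteringMatrix.analyticAt_comp {E : Type*} [NormedAddCommGroup E] [NormedSpace ℂ E]
    {f : E → ℂ} {e : E} (hf : AnalyticAt ℂ f e) (h : S (f e) ≠ 0) :
    AnalyticAt ℂ (fun y => S (f y)) e :=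
  (hS.analyticAt h).fun_comp hf

theorem analyticAt_moveFactor {q : (Fin (N + 1) → ℂ) × (Fin (N + 1) → ℂ)}
    (h : Admissible S (Sum.elim q.1 q.2 : Fin (N + 1) ⊕ Fin (N + 1) → ℂ)) (p : Fin (N + 1)) :
    AnalyticAt ℂ (fun q : (Fin (N + 1) → ℂ) × (Fin (N + 1) → ℂ) => moveFactor S p q.1 q.2) q := by
  refine Finset.analyticAt_fun_prod _ fun k _ => ?_
  have hden : S (q.1 (p.succAbove k) - q.2 p) ≠ 0 := (h (.inl _) (.inr _)).1
  have hfirst : S (q.1 (p.succAbove k) - q.1 p) ≠ 0 := (h (.inl _) (.inl _)).1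
  have hsecond : S (q.2 (p.succAbove k) - q.2 p) ≠ 0 := (h (.inr _) (.inr _)).1
  refine AnalyticAt.fun_div ?_ (hS.analyticAt_comp (by fun_prop) hden) hden
  split_ifs
  exacts [hS.analyticAt_comp (by fun_prop) hfirst, hS.analyticAt_comp (by fun_prop) hsecond]

theorem analyticAt_residueFactor {θ₀ : Fin (N + 1) → ℂ} (hθ : Admissible S θ₀) (p : Fin (N + 1)) :
    AnalyticAt ℂ (fun q : (Fin (N + 1) → ℂ) × (Fin (N + 1) → ℂ) => residueFactor S p q.1 q.2)
      (θ₀, θ₀) := by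
  have hphase : AnalyticAt ℂ
      (fun q : (Fin (N + 1) → ℂ) × (Fin (N + 1) → ℂ) => phaseProd S p q.1 q.2) (θ₀, θ₀) := by
    refine Finset.analyticAt_fun_prod _ fun k _ => ?_
    have hne : S (θ₀ p - θ₀ (p.succAbove k)) ≠ 0 := (hθ _ _).1
    refine .fun_div ?_ ?_ ?_
    exacts [hS.analyticAt_comp (by fun_prop) hne, hS.analyticAt_comp (by fun_prop) hne, hne]
  exact (analyticAt_moveFactor hS hθ.sumElim_self p).mul
    (analyticAt_const.mul (analyticAt_const.sub hphase))

theorem prod_map_eq_phaseProd (p : Fin (N + 1)) (x t : Fin (N + 1) → ℂ) :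
    ((List.ofFn (fun i => p.removeNth x i + Real.pi * I) ++
      (List.ofFn (p.removeNth t)).reverse).map fun y => S (t p - y)).prod = phaseProd S p x t := by
  simp only [List.map_append, List.prod_append, List.map_reverse, List.prod_reverse,
    List.map_ofFn, List.prod_ofFn, phaseProd, Fin.removeNth, Function.comp_def, sub_add_eq_sub_sub,
    hS.sub_pi, ← Finset.prod_mul_distrib]
  exact Finset.prod_congr rfl fun k _ => by ring

omit hS in
theorem admissible_removeNth {x t : Fin (N + 1) → ℂ} (p : Fin (N + 1))
    (h : Admissible S (Sum.elim x t : Fin (N + 1) ⊕ Fin (N + 1) → ℂ)) :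
    Admissible S (Sum.elim (p.removeNth x) (p.removeNth t) : Fin N ⊕ Fin N → ℂ) := by
  rintro (a | a) (b | b)
  exacts [h (.inl _) (.inl _), h (.inl _) (.inr _), h (.inr _) (.inl _), h (.inr _) (.inr _)]

theorem MeetOnlyAt.kinematical_regular {x t : Fin (N + 1) → ℂ} {p : Fin (N + 1)}
    (hp : MeetOnlyAt p x t)
    (h : Admissible S (Sum.elim x t : Fin (N + 1) ⊕ Fin (N + 1) → ℂ)) :
    ∀ y ∈ List.ofFn (fun i => p.removeNth x i + Real.pi * I) ++ (List.ofFn (p.removeNth t)).reverse,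
      S (t p - y) ≠ 0 ∧ sinh (t p - y) ≠ 0 := by
  simp only [List.mem_append, List.mem_ofFn, List.mem_reverse]
  rintro y (⟨k, rfl⟩ | ⟨k, rfl⟩)
  · have hne : x (p.succAbove k) ≠ t p :=
      hp.ne _ _ fun he => Fin.succAbove_ne p k (congrArg Prod.fst he)
    have hadm := h (.inr p) (.inl (p.succAbove k))
    simp only [Sum.elim_inl, Sum.elim_inr] at hadm
    rw [Fin.removeNth, sub_add_eq_sub_sub, hS.sub_pi, sinh_sub, cosh_mul_I, sinh_mul_I,
      Complex.cos_pi, Complex.sin_pi]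
    exact ⟨inv_ne_zero hadm.1, by simpa using hadm.2 hne.symm⟩
  · have hadm := h (.inr p) (.inr (p.succAbove k))
    exact ⟨hadm.1, hadm.2 (hp.right_injective.ne (Fin.succAbove_ne p k).symm)⟩

variable {F : (n : ℕ) → (Fin n → ℂ) → ℂ} (hF : IsFormFactor S F)
include hF

theorem listFF_move_pair (u v w : List ℂ) (a b : ℂ)
    (hl : (u ++ a :: (v ++ b :: w)).Pairwise (Generic S)) :
    listFF F (u ++ a :: (v ++ b :: w)) = (u.map fun y => S (y - a)).prod *
      ((u ++ v).map fun y => S (y - b)).prod * listFF F (a :: b :: (u ++ v ++ w)) := by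
  have hfront : (a :: (u ++ v) ++ b :: w).Pairwise (Generic S) := by
    simpa using pairwise_generic_perm hS hl List.perm_middle
  have hab : S (a - b) ≠ 0 := (List.pairwise_cons.1 hfront).1 b (by simp) |>.1
  have hswap : listFF F (b :: a :: (u ++ v ++ w)) =
      S (b - a) * listFF F (a :: b :: (u ++ v ++ w)) :=
    listFF_exchange hS hF (u := []) (pairwise_generic_perm hS hfront List.perm_middle)
  rw [listFF_move hS hF _ _ _ hl, ← List.append_assoc, ← List.cons_append,
    listFF_move hS hF _ _ _ hfront, List.cons_append, hswap, List.map_cons, List.prod_cons,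
    ← neg_sub a b, hS.unitarity]
  field_simp

theorem diagFF_eq_moveFactor_mul {x t : Fin (N + 1) → ℂ} (p : Fin (N + 1))
    (h : Admissible S (Sum.elim x t : Fin (N + 1) ⊕ Fin (N + 1) → ℂ)) (hxt : ∀ i j, x i ≠ t j) :
    diagFF F x t = moveFactor S p x t * listFF F ((x p + Real.pi * I) :: t p ::
      (List.ofFn (fun i => p.removeNth x i + Real.pi * I) ++
        (List.ofFn (p.removeNth t)).reverse)) := by
  have hpw := pairwise_generic_diag hS h hxt
  rw [diagFF_eq_listFF]
  set X := List.ofFn (fun i => p.removeNth x i + Real.pi * I) with hX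
  set T := List.ofFn (p.removeNth t) with hT
  have hargs : List.ofFn (fun i => x i + Real.pi * I) ++ (List.ofFn t).reverse = X.take p ++
      (x p + Real.pi * I) :: (X.drop p ++ (T.drop p).reverse ++ t p :: (T.take p).reverse) := by
    rw [ofFn_eq_take_append_cons_drop p t, ofFn_eq_take_append_cons_drop p]
    simp only [hX, hT, Fin.removeNth_apply, List.append_assoc, List.cons_append,
      List.reverse_append, List.reverse_cons, List.nil_append]
    rfl
  have hrest : X.take p ++ (X.drop p ++ (T.drop p).reverse) ++ (T.take p).reverse =
      X ++ T.reverse := by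
    rw [← List.append_assoc, List.take_append_drop, List.append_assoc, ← List.reverse_append,
      List.take_append_drop]
  rw [hargs] at hpw ⊢
  rw [listFF_move_pair hS hF _ _ _ _ _ hpw, hrest, ← List.append_assoc, List.take_append_drop]
  congr 1
  simp only [hX, hT, List.map_append, List.prod_append, List.map_reverse, List.prod_reverse,
    List.map_take, List.map_drop, List.map_ofFn, List.prod_take_ofFn, prod_drop_ofFn,
    List.prod_ofFn, Finset.prod_filter, ← Finset.prod_mul_distrib, moveFactor, Function.comp_def,
    add_sub_add_right_eq_sub, Fin.removeNth, Fin.lt_def, Fin.val_castSucc]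
  simp only [add_sub_right_comm, hS.add_pi]
  refine Finset.prod_congr rfl fun k _ => ?_
  split_ifs <;> ring

end

section

variable {S : ℂ → ℂ} (hS : IsScatteringMatrix S) {F : (n : ℕ) → (Fin n → ℂ) → ℂ}
  (hF : IsFormFactor S F) {N : ℕ} {x t : Fin (N + 1) → ℂ} {p : Fin (N + 1)}

theorem tendsto_update_self (p : Fin (N + 1)) (x t : Fin (N + 1) → ℂ) :
    Tendsto (fun w => (Function.update x p w, t)) (𝓝[≠] (x p)) (𝓝 (x, t)) := by
  have hcont : Continuous fun w => (Function.update x p w, t) := by fun_prop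
  simpa using (hcont.tendsto (x p)).mono_left nhdsWithin_le_nhds

theorem MeetOnlyAt.eventually_ne (hp : MeetOnlyAt p x t) :
    ∀ᶠ w in 𝓝[≠] (x p), ∀ i j, Function.update x p w i ≠ t j := by
  have hclosed : ∀ᶠ w in 𝓝[≠] (x p), ∀ j, j ≠ p → w ≠ t j := by
    refine eventually_all.2 fun j => ?_
    by_cases hj : j = p
    · exact .of_forall fun w h => absurd hj h
    · exact eventually_nhdsWithin_of_eventually_nhds ((eventually_ne_nhds
        (hp.ne p j fun he => hj (congrArg Prod.snd he))).mono fun w hw _ => hw)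
  filter_upwards [hclosed, self_mem_nhdsWithin] with w hw hwp i j
  by_cases hi : i = p
  · by_cases hj : j = p
    · simpa [hi, hj, ← hp.eq] using hwp
    · simpa [hi] using hw j hj
  · simpa [hi] using hp.ne i j fun he => hi (congrArg Prod.fst he)

include hS hF

theorem MeetOnlyAt.tendsto_mul_diagFF (hp : MeetOnlyAt p x t)
    (h : Admissible S (Sum.elim x t : Fin (N + 1) ⊕ Fin (N + 1) → ℂ)) :
    Tendsto (fun w => (w - x p) * diagFF F (Function.update x p w) t) (𝓝[≠] (x p))
      (𝓝 (residueFactor S p x t * diagFF F (p.removeNth x) (p.removeNth t))) := by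
  have hpath := tendsto_update_self p x t
  have hres := listFF_kinematical hS hF
    (pairwise_generic_diag hS (admissible_removeNth p h) hp.removeNth_ne)
    (hp.kinematical_regular hS h)
  rw [prod_map_eq_phaseProd hS, ← diagFF_eq_listFF, ← hp.eq] at hres
  have hmove := (analyticAt_moveFactor hS (q := (x, t)) h p).continuousAt.tendsto.comp hpath
  have hadm := hpath.eventually (h.eventually_sumElim hS)
  have hlim := hmove.mul (hres.const_mul I)
  rw [residueFactor, mul_assoc, mul_assoc]
  refine hlim.congr' ?_
  filter_upwards [hp.eventually_ne, hadm] with w hne hadm_w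
  rw [diagFF_eq_moveFactor_mul hS hF p hadm_w hne]
  simp only [Function.comp_apply, Function.update_self, Fin.removeNth_update, hp.eq]
  linear_combination (-(moveFactor S p (Function.update x p w) t) * ((w - t p) *
    listFF F ((w + Real.pi * I) :: t p :: _))) * I_mul_I

theorem MeetOnlyAt.mul_pairProd_eq (hp : MeetOnlyAt p x t)
    (h : Admissible S (Sum.elim x t : Fin (N + 1) ⊕ Fin (N + 1) → ℂ)) {θ₀ : Fin (N + 1) → ℂ}
    {H : (Fin (N + 1) → ℂ) × (Fin (N + 1) → ℂ) → ℂ} (hHx : ContinuousAt H (x, t))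
    (heq : ∀ᶠ q in 𝓝 (x, t), (∀ i j, q.1 i ≠ q.2 j) →
      diagFF F q.1 q.2 * ∏ i, (q.1 i - q.2 i) = H q * pairProd θ₀ q.1 q.2) :
    H (x, t) * pairProd θ₀ x t = residueFactor S p x t *
      (diagFF F (p.removeNth x) (p.removeNth t) * ∏ k, (p.removeNth x k - p.removeNth t k)) := by
  have hpath := tendsto_update_self p x t
  have hpair : ContinuousAt (fun q : _ × _ => pairProd θ₀ q.1 q.2) (x, t) :=
    continuousAt_pairProd fun i j hij => hp.ne i j fun he =>
      hij ((congrArg Prod.fst he).trans (congrArg Prod.snd he).symm)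
  have hleft := (hHx.fun_mul hpair).tendsto.comp hpath
  have hright := (hp.tendsto_mul_diagFF hS hF h).mul_const
    (∏ k, (p.removeNth x k - p.removeNth t k))
  rw [← mul_assoc]
  refine tendsto_nhds_unique (hleft.congr' ?_) hright
  filter_upwards [hp.eventually_ne, hpath.eventually heq] with w hne heq_w
  rw [Function.comp_apply, ← heq_w hne, Fin.prod_univ_succAbove _ p]
  simp only [Function.update_self, Function.update_of_ne (Fin.succAbove_ne p _), Fin.removeNth,
    hp.eq]
  ring

theorem IsRegularPart.eventually_eq_residueFactor_mul {θ₀ : Fin (N + 1) → ℂ}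
    (hθ : Admissible S θ₀) (p : Fin (N + 1))
    {H : (Fin (N + 1) → ℂ) × (Fin (N + 1) → ℂ) → ℂ} (hH : IsRegularPart F θ₀ H)
    {H' : (Fin N → ℂ) × (Fin N → ℂ) → ℂ} (hH' : IsRegularPart F (p.removeNth θ₀) H') :
    ∀ᶠ q in 𝓝 (θ₀, θ₀), q.1 p = q.2 p →
      H q = residueFactor S p q.1 q.2 * H' (p.removeNth q.1, p.removeNth q.2) := by
  let remove : (Fin (N + 1) → ℂ) × (Fin (N + 1) → ℂ) → (Fin N → ℂ) × (Fin N → ℂ) :=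
    fun q => (p.removeNth q.1, p.removeNth q.2)
  have hremove : AnalyticAt ℂ remove (θ₀, θ₀) :=
    .prod (analyticAt_pi fun k => by unfold Fin.removeNth; fun_prop)
      (analyticAt_pi fun k => by unfold Fin.removeNth; fun_prop)
  have hdiff : AnalyticAt ℂ (fun q => H q - residueFactor S p q.1 q.2 * H' (remove q)) (θ₀, θ₀) :=
    hH.analytic.sub ((analyticAt_residueFactor hS hθ p).mul
      (AnalyticAt.fun_comp (f := remove) hH'.analytic hremove))
  refine (eventually_of_meetOnlyAt hdiff ?_).mono fun q hq hqp => sub_eq_zero.1 (hq hqp)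
  filter_upwards [eventually_eventually_nhds.2 hH.eq, hremove.continuousAt.eventually hH'.eq,
    hθ.sumElim_self.eventually_sumElim hS, hH.analytic.eventually_analyticAt]
    with q heq heq' hadm hHq hp
  have hpair : pairProd (p.removeNth θ₀) (p.removeNth q.1) (p.removeNth q.2) ≠ 0 :=
    pairProd_ne_zero (fun i j _ => hp.removeNth_ne i j)
      (hp.left_injective.comp Fin.succAbove_right_injective)
      (hp.right_injective.comp Fin.succAbove_right_injective)
  have hres := hp.mul_pairProd_eq hS hF hadm hHq.continuousAt heq
  rw [heq' hp.removeNth_ne, hp.pairProd_eq_removeNth, ← mul_assoc] at hres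
  exact sub_eq_zero.2 (mul_right_cancel₀ hpair hres)

end

end

/-! ### The leading term -/

theorem Admissible.removeNth {S : ℂ → ℂ} {N : ℕ} {t : Fin (N + 1) → ℂ} (ht : Admissible S t)
    (p : Fin (N + 1)) : Admissible S (p.removeNth t) := fun _ _ => ht _ _

/-- The regular part near the diagonal point `(t, t)` as a function of the displacements
`η = x - t`. -/
def slice {N : ℕ} (H : (Fin N → ℂ) × (Fin N → ℂ) → ℂ) (t η : Fin N → ℂ) : ℂ :=
  H (t + η, t)

/-- The insertion of a zero at position `p`. -/
noncomputable def insertZero {N : ℕ} (p : Fin (N + 1)) : (Fin N → ℂ) →L[ℂ] (Fin (N + 1) → ℂ) :=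
  ContinuousLinearMap.pi (p.insertNth (α := fun _ => (Fin N → ℂ) →L[ℂ] ℂ) 0 .proj)

section

variable {N : ℕ}

@[simp] theorem insertZero_same (p : Fin (N + 1)) (v : Fin N → ℂ) : insertZero p v p = 0 := by
  simp [insertZero]

@[simp] theorem insertZero_succAbove (p : Fin (N + 1)) (v : Fin N → ℂ) (k : Fin N) :
    insertZero p v (p.succAbove k) = v k := by
  simp [insertZero]

theorem insertZero_single (p : Fin (N + 1)) (k : Fin N) :
    insertZero p (Pi.single k 1) = Pi.single (p.succAbove k) 1 := by
  ext i
  cases i using p.succAboveCases with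
  | x => rw [insertZero_same, Pi.single_eq_of_ne (Fin.succAbove_ne p k).symm]
  | p j => simp [Pi.single_apply]

theorem eq_zero_of_apply_insertZero {k : ℕ} (hk : k < N + 1)
    {D : ContinuousMultilinearMap ℂ (fun _ : Fin k => Fin (N + 1) → ℂ) ℂ}
    (hD : ∀ (p : Fin (N + 1)) (v : Fin k → Fin N → ℂ), D (fun i => insertZero p (v i)) = 0) :
    D = 0 := by
  apply ContinuousMultilinearMap.toMultilinearMap_injective
  refine Module.Basis.ext_multilinear (fun _ => Pi.basisFun ℂ (Fin (N + 1))) fun c => ?_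
  obtain ⟨p, hp⟩ : ∃ p, ∀ i, c i ≠ p := by
    by_contra! hsurj
    have hcard := Fintype.card_le_of_surjective c hsurj
    simp only [Fintype.card_fin] at hcard
    omega
  choose j hj using fun i => Fin.exists_succAbove_eq (hp i)
  have hbasis : (fun i => Pi.basisFun ℂ (Fin (N + 1)) (c i)) =
      fun i => insertZero p (Pi.single (j i) 1) :=
    funext fun i => by rw [insertZero_single, hj, Pi.basisFun_apply]
  change D (fun i => Pi.basisFun ℂ (Fin (N + 1)) (c i)) = 0
  rw [hbasis, hD]

theorem tendsto_add_diag (t : Fin N → ℂ) :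
    Tendsto (fun η : Fin N → ℂ => (t + η, t)) (𝓝 0) (𝓝 (t, t)) :=
  Continuous.tendsto' (by fun_prop) _ _ (by simp)

theorem analyticAt_slice {H : (Fin N → ℂ) × (Fin N → ℂ) → ℂ} {t : Fin N → ℂ}
    (hH : AnalyticAt ℂ H (t, t)) : AnalyticAt ℂ (slice H t) 0 := by
  have hH₀ : AnalyticAt ℂ H (t + 0, t) := by rwa [add_zero]
  exact AnalyticAt.fun_comp (f := fun η => (t + η, t)) hH₀
    ((analyticAt_const.add analyticAt_id).prod analyticAt_const)

theorem iteratedFDeriv_slice {H : (Fin N → ℂ) × (Fin N → ℂ) → ℂ} {t : Fin N → ℂ}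
    (hH : AnalyticAt ℂ H (t, t)) (n : ℕ) (v : Fin n → Fin N → ℂ) :
    iteratedFDeriv ℂ n (slice H t) 0 v = iteratedFDeriv ℂ n H (t, t) fun i => (v i, 0) := by
  have hslice : slice H t = fun η => H ((t, t) + ContinuousLinearMap.inl ℂ _ _ η) := by
    ext; simp [slice]
  rw [hslice, iteratedFDeriv_comp_add_clm _ hH.contDiffAt]
  simp

theorem analyticAt_slice_insertZero {H : (Fin (N + 1) → ℂ) × (Fin (N + 1) → ℂ) → ℂ}
    {t : Fin (N + 1) → ℂ} (hH : AnalyticAt ℂ H (t, t)) (p : Fin (N + 1)) :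
    AnalyticAt ℂ (fun η => slice H t (insertZero p η)) 0 := by
  have hslice : AnalyticAt ℂ (slice H t) (insertZero p 0) := by
    rw [map_zero]; exact analyticAt_slice hH
  exact hslice.fun_comp ((insertZero p).analyticAt 0)

theorem iteratedFDeriv_slice_insertZero {H : (Fin (N + 1) → ℂ) × (Fin (N + 1) → ℂ) → ℂ}
    {t : Fin (N + 1) → ℂ} (hH : AnalyticAt ℂ H (t, t)) (p : Fin (N + 1)) (n : ℕ)
    (v : Fin n → Fin N → ℂ) :
    iteratedFDeriv ℂ n (slice H t) 0 (fun i => insertZero p (v i)) =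
      iteratedFDeriv ℂ n (fun η => slice H t (insertZero p η)) 0 v := by
  have hslice : AnalyticAt ℂ (slice H t) (insertZero p 0) := by
    rw [map_zero]; exact analyticAt_slice hH
  rw [iteratedFDeriv_comp_clm _ hslice.contDiffAt, map_zero]
  rfl

/-- The residue factor of the pair `p` as a function of the displacements of the other pairs. -/
noncomputable def residueSlice (S : ℂ → ℂ) (p : Fin (N + 1)) (t : Fin (N + 1) → ℂ)
    (η : Fin N → ℂ) : ℂ :=
  slice (fun q => residueFactor S p q.1 q.2) t (insertZero p η)

variable {S : ℂ → ℂ} {t : Fin (N + 1) → ℂ} (ht : Admissible S t)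
include ht

theorem phaseProd_self (p : Fin (N + 1)) : phaseProd S p t t = 1 :=
  Finset.prod_eq_one fun _ _ => div_self (ht _ _).1

theorem moveFactor_self (p : Fin (N + 1)) : moveFactor S p t t = 1 :=
  Finset.prod_eq_one fun _ _ => by rw [ite_self, div_self (ht _ _).1]

theorem residueSlice_zero (p : Fin (N + 1)) : residueSlice S p t 0 = 0 := by
  simp [residueSlice, slice, residueFactor, phaseProd_self ht]

theorem analyticAt_residueSlice (hS : IsScatteringMatrix S) (p : Fin (N + 1)) :
    AnalyticAt ℂ (residueSlice S p t) 0 :=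
  analyticAt_slice_insertZero (analyticAt_residueFactor hS ht p) p

end

section

variable {S : ℂ → ℂ} (hS : IsScatteringMatrix S) {F : (n : ℕ) → (Fin n → ℂ) → ℂ}
  (hF : IsFormFactor S F)
include hS hF

theorem eventually_slice_insertZero_eq {N : ℕ} {θ₀ : Fin (N + 1) → ℂ} (hθ : Admissible S θ₀)
    (p : Fin (N + 1)) {H : (Fin (N + 1) → ℂ) × (Fin (N + 1) → ℂ) → ℂ} (hH : IsRegularPart F θ₀ H)
    {H' : (Fin N → ℂ) × (Fin N → ℂ) → ℂ} (hH' : IsRegularPart F (p.removeNth θ₀) H') :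
    ∀ᶠ t in 𝓝 θ₀, (fun η => slice H t (insertZero p η)) =ᶠ[𝓝 0] fun η =>
      residueSlice S p t η * slice H' (p.removeNth t) η := by
  filter_upwards [(tendsto_diag θ₀).eventually (eventually_eventually_nhds.2
    (IsRegularPart.eventually_eq_residueFactor_mul hS hF hθ p hH hH'))] with t ht
  have hinsert : Tendsto (fun η => insertZero p η) (𝓝 0) (𝓝 0) :=
    (insertZero p).continuous.tendsto' 0 0 (map_zero _)
  filter_upwards [((tendsto_add_diag t).comp hinsert).eventually ht] with η hη
  have hremove : p.removeNth (t + insertZero p η) = p.removeNth t + η := by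
    ext k; simp [Fin.removeNth]
  simp only [Function.comp_apply, hremove] at hη
  exact hη (by simp)

theorem eventually_iteratedFDeriv_slice_eq_zero {N : ℕ} {θ₀ : Fin N → ℂ} (hθ : Admissible S θ₀)
    {H : (Fin N → ℂ) × (Fin N → ℂ) → ℂ} (hH : IsRegularPart F θ₀ H) :
    ∀ᶠ t in 𝓝 θ₀, ∀ k < N, iteratedFDeriv ℂ k (slice H t) 0 = 0 := by
  induction N with
  | zero => simp
  | succ N ih =>
    choose H' hH' using fun p => exists_isRegularPart hS hF (hθ.removeNth p)
    have hremove (p : Fin (N + 1)) :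
        Tendsto (fun t : Fin (N + 1) → ℂ => p.removeNth t) (𝓝 θ₀) (𝓝 (p.removeNth θ₀)) :=
      Continuous.tendsto (by unfold Fin.removeNth; fun_prop) _
    filter_upwards [eventually_all.2 fun p => eventually_slice_insertZero_eq hS hF hθ p hH (hH' p),
      eventually_all.2 fun p => (hremove p).eventually (ih (hθ.removeNth p) (hH' p)),
      eventually_all.2 fun p => ((tendsto_diag _).comp (hremove p)).eventually
        (hH' p).analytic.eventually_analyticAt,
      (tendsto_diag θ₀).eventually hH.analytic.eventually_analyticAt,
      hθ.eventually hS] with t hfactor hlower hH't hHt ht k hk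
    refine eq_zero_of_apply_insertZero hk fun p v => ?_
    have hzero : ∀ i < 1, iteratedFDeriv ℂ i (residueSlice S p t) 0 = 0 := by
      intro i hi
      obtain rfl : i = 0 := by omega
      ext
      simp [residueSlice_zero ht]
    rw [iteratedFDeriv_slice_insertZero hHt, ((hfactor p).iteratedFDeriv ℂ k).self_of_nhds]
    exact DFunLike.congr_fun (iteratedFDeriv_smul_eq_zero
      (analyticAt_residueSlice ht hS p).contDiffAt (analyticAt_slice (hH't p)).contDiffAt hzero
      (hlower p) (by omega)) v

end

/-- The linear form `η ↦ ∑_k φ(t_p - t_k) η_k`. -/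
noncomputable def phiForm (S : ℂ → ℂ) {N : ℕ} (p : Fin (N + 1)) (t : Fin (N + 1) → ℂ) :
    (Fin N → ℂ) →L[ℂ] ℂ :=
  ∑ k, phi S (t p - p.removeNth t k) • .proj k

theorem phiForm_apply (S : ℂ → ℂ) {N : ℕ} (p : Fin (N + 1)) (t : Fin (N + 1) → ℂ)
    (η : Fin N → ℂ) : phiForm S p t η = ∑ k, phi S (t p - p.removeNth t k) * η k := by
  simp [phiForm]

section

variable {S : ℂ → ℂ} (hS : IsScatteringMatrix S) {N : ℕ}
include hS

theorem IsScatteringMatrix.hasDerivAt_div_sub {a : ℂ} (ha : S a ≠ 0) :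
    HasDerivAt (fun z => S a / S (a - z)) (logDeriv S a) 0 := by
  have hSa : HasDerivAt S (deriv S a) (a - 0) := by
    rw [sub_zero]; exact (hS.analyticAt ha).differentiableAt.hasDerivAt
  refine ((hasDerivAt_const (0 : ℂ) (S a)).fun_div (hSa.comp_const_sub a 0)
    (by rwa [sub_zero])).congr_deriv ?_
  rw [logDeriv_apply, sub_zero]
  field_simp
  ring

variable {t : Fin (N + 1) → ℂ} (ht : Admissible S t) (p : Fin (N + 1))
include ht

theorem hasFDerivAt_phaseProd :
    HasFDerivAt (fun η => phaseProd S p (t + insertZero p η) t)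
      (∑ k, logDeriv S (t p - p.removeNth t k) •
        (ContinuousLinearMap.proj k : (Fin N → ℂ) →L[ℂ] ℂ)) 0 := by
  have hfactor (k : Fin N) : HasFDerivAt
      (fun η : Fin N → ℂ => S (t p - p.removeNth t k) / S (t p - p.removeNth t k - η k))
      (logDeriv S (t p - p.removeNth t k) •
        (ContinuousLinearMap.proj k : (Fin N → ℂ) →L[ℂ] ℂ)) 0 :=
    (hS.hasDerivAt_div_sub (ht _ _).1).comp_hasFDerivAt_of_eq 0
      (ContinuousLinearMap.proj k : (Fin N → ℂ) →L[ℂ] ℂ).hasFDerivAt rfl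
  have hone (k : Fin N) : S (t p - p.removeNth t k) /
      S (t p - p.removeNth t k - (0 : Fin N → ℂ) k) = 1 := by
    rw [Pi.zero_apply, sub_zero]; exact div_self (ht _ _).1
  have hprod := HasFDerivAt.finsetProd (u := Finset.univ) fun k _ => hfactor k
  simp only [hone, Finset.prod_const_one, one_smul] at hprod
  refine hprod.congr_of_eventuallyEq (.of_forall fun η => ?_)
  simp [phaseProd, Fin.removeNth, sub_add_eq_sub_sub]

theorem hasFDerivAt_residueSlice : HasFDerivAt (residueSlice S p t) (phiForm S p t) 0 := by
  have hmove : DifferentiableAt ℂ (fun η => moveFactor S p (t + insertZero p η) t) 0 :=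
    (analyticAt_slice_insertZero (analyticAt_moveFactor hS ht.sumElim_self p) p).differentiableAt
  refine (hmove.hasFDerivAt.mul
    (((hasFDerivAt_phaseProd hS ht p).const_sub 1).const_mul I)).congr_fderiv ?_
  ext η
  simp [phaseProd_self ht, moveFactor_self ht, phiForm, phi, Finset.mul_sum, mul_assoc]

variable {F : (n : ℕ) → (Fin n → ℂ) → ℂ} (hF : IsFormFactor S F)
include hF

omit ht in
theorem iteratedFDeriv_slice_apply_insertZero {θ₀ : Fin (N + 1) → ℂ} (hθ : Admissible S θ₀)
    {H : (Fin (N + 1) → ℂ) × (Fin (N + 1) → ℂ) → ℂ} (hH : IsRegularPart F θ₀ H)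
    {H' : (Fin N → ℂ) × (Fin N → ℂ) → ℂ} (hH' : IsRegularPart F (p.removeNth θ₀) H')
    (v : Fin (N + 1) → Fin N → ℂ) :
    iteratedFDeriv ℂ (N + 1) (slice H θ₀) 0 (fun i => insertZero p (v i)) =
      ∑ k, phiForm S p θ₀ (v k) *
        iteratedFDeriv ℂ N (slice H' (p.removeNth θ₀)) 0 (k.removeNth v) := by
  have hlower := (eventually_iteratedFDeriv_slice_eq_zero hS hF (hθ.removeNth p) hH').self_of_nhds
  rw [iteratedFDeriv_slice_insertZero hH.analytic, ((eventually_slice_insertZero_eq hS hF hθ p hH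
    hH').self_of_nhds.iteratedFDeriv ℂ (N + 1)).self_of_nhds]
  refine (iteratedFDeriv_succ_smul_apply (analyticAt_residueSlice hθ hS p).contDiffAt
    (analyticAt_slice hH'.analytic).contDiffAt (residueSlice_zero hθ p) hlower v).trans ?_
  rw [(hasFDerivAt_residueSlice hS hθ p).fderiv]
  rfl

end

section

variable {N : ℕ} {F : (n : ℕ) → (Fin n → ℂ) → ℂ}

theorem pairProd_self {θ₀ t : Fin N → ℂ} (ht : Function.Injective t) : pairProd θ₀ t t = 1 := by
  refine Finset.prod_eq_one fun i _ => Finset.prod_eq_one fun j _ => ?_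
  split_ifs with hij
  · exact div_self (mul_ne_zero (sub_ne_zero.2 (ht.ne hij.1.ne))
      (sub_ne_zero.2 (ht.ne hij.1.ne')))
  · rfl

theorem analyticAt_slice_pairProd {θ₀ t : Fin N → ℂ} (ht : Function.Injective t) :
    AnalyticAt ℂ (slice (fun q => pairProd θ₀ q.1 q.2) t) 0 := by
  unfold slice pairProd pairRatio
  refine Finset.analyticAt_fun_prod _ fun i _ => Finset.analyticAt_fun_prod _ fun j _ => ?_
  split_ifs with hij
  · refine .fun_div ?_ ?_ ?_
    · fun_prop
    · fun_prop
    · simp only [add_zero]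
      exact mul_ne_zero (sub_ne_zero.2 (ht.ne hij.1.ne)) (sub_ne_zero.2 (ht.ne hij.1.ne'))
  · exact analyticAt_const

theorem IsFinitePiece.unique {θ : Fin N → ℂ} {c c' : ℂ} (h : IsFinitePiece F θ c)
    (h' : IsFinitePiece F θ c') : c = c' := by
  obtain ⟨G, hG, hGF, rfl⟩ := h
  obtain ⟨G', hG', hGF', rfl⟩ := h'
  have hsub : ∀ᶠ η in 𝓝 (0 : Fin N → ℂ), (0 : (Fin N → ℂ) →L[ℂ] ℂ) η = 0 → G η - G' η = 0 := by
    refine eventually_eq_zero_of_generic Finset.univ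
      (fun i => (.proj i : (Fin N → ℂ) →L[ℂ] ℂ)) (d := fun _ => 1)
      (by simp) (by simp) ((hG.sub hG').eventually_analyticAt.mono fun x hx => hx.continuousAt) ?_
    filter_upwards [hGF, hGF'] with η hη hη' _ hne
    have hne (i : Fin N) : η i ≠ 0 := hne i (Finset.mem_univ i)
    have hquot := (hη hne).symm.trans (hη' hne)
    rw [div_left_inj' (Finset.prod_ne_zero_iff.2 fun i _ => hne i)] at hquot
    exact sub_eq_zero.2 hquot
  have hGG' : G =ᶠ[𝓝 0] G' := hsub.mono fun η hη => sub_eq_zero.1 (hη rfl)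
  rw [(hGG'.iteratedFDeriv ℂ N).self_of_nhds]

theorem IsFinitePiece.connected_eq {θ : Fin N → ℂ} {c : ℂ} (h : IsFinitePiece F θ c) :
    connected F θ = c := by
  have hex : ∃ c, IsFinitePiece F θ c := ⟨c, h⟩
  rw [connected, dif_pos hex]
  exact hex.choose_spec.unique h

/-- The leading term of the regular part at the diagonal point `(t, t)`, a form of degree `N` in the
displacements; its value at the unit vectors is the connected form factor. -/
noncomputable def leading (H : (Fin N → ℂ) × (Fin N → ℂ) → ℂ) (t : Fin N → ℂ) :
    ContinuousMultilinearMap ℂ (fun _ : Fin N => Fin N → ℂ) ℂ :=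
  iteratedFDeriv ℂ N (slice H t) 0

theorem diagFF_add (F : (n : ℕ) → (Fin n → ℂ) → ℂ) (θ η : Fin N → ℂ) :
    diagFF F (θ + η) θ = F (N + N) (diagArgs θ η) := by
  simp only [diagFF, pairArgs, diagArgs, Pi.add_apply, add_right_comm]

theorem eventually_add_ne {t : Fin N → ℂ} (ht : Function.Injective t) :
    ∀ᶠ η in 𝓝 (0 : Fin N → ℂ), ∀ i j, i ≠ j → (t + η) i ≠ t j := by
  simp only [Filter.eventually_all]
  intro i j hij
  have hadd : Tendsto (fun η : Fin N → ℂ => (t + η) i) (𝓝 0) (𝓝 (t i)) :=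
    Continuous.tendsto' (by fun_prop) _ _ (by simp)
  exact hadd.eventually_ne (ht.ne hij)

theorem isFinitePiece_iteratedFDeriv {θ₀ t : Fin N → ℂ} (ht : Function.Injective t)
    {H : (Fin N → ℂ) × (Fin N → ℂ) → ℂ} (hH : AnalyticAt ℂ H (t, t))
    (heq : ∀ᶠ p in 𝓝 (t, t), (∀ i j, p.1 i ≠ p.2 j) →
      diagFF F p.1 p.2 * ∏ i, (p.1 i - p.2 i) = H p * pairProd θ₀ p.1 p.2)
    (hlower : ∀ k < N, iteratedFDeriv ℂ k (slice H t) 0 = 0) :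
    IsFinitePiece F t (leading H t fun i => Pi.single i 1) := by
  set m := slice (fun q => pairProd θ₀ q.1 q.2) t with hm
  have hm₀ : m 0 = 1 := by rw [hm, slice, add_zero, pairProd_self ht]
  have hm_an : AnalyticAt ℂ m 0 := analyticAt_slice_pairProd ht
  refine ⟨fun η => m η * slice H t η, hm_an.mul (analyticAt_slice hH), ?_, ?_⟩
  · filter_upwards [(tendsto_add_diag t).eventually heq, eventually_add_ne ht] with η hη hne hη₀
    have hcross : ∀ i j, (t + η) i ≠ t j := by
      intro i j
      obtain rfl | hij := eq_or_ne i j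
      · simpa using hη₀ i
      · exact hne i j hij
    have hfactor := hη hcross
    simp only [Pi.add_apply, add_sub_cancel_left] at hfactor
    rw [eq_div_iff (Finset.prod_ne_zero_iff.2 fun i _ => hη₀ i), ← diagFF_add F, hfactor, mul_comm]
    rfl
  · have hscale := iteratedFDeriv_smul_eq_smul hm_an.contDiffAt (analyticAt_slice hH).contDiffAt
      hlower
    rw [hm₀, one_smul] at hscale
    exact DFunLike.congr_fun hscale.symm _

variable {S : ℂ → ℂ} (hS : IsScatteringMatrix S) (hF : IsFormFactor S F) {θ₀ : Fin N → ℂ}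
  (hθ : Admissible S θ₀) {H : (Fin N → ℂ) × (Fin N → ℂ) → ℂ} (hH : IsRegularPart F θ₀ H)
include hS hF hθ hH

theorem IsRegularPart.eventually_connected_eq : ∀ᶠ t in 𝓝 θ₀, Function.Injective t →
    connected F t = leading H t fun i => Pi.single i 1 := by
  filter_upwards [(tendsto_diag θ₀).eventually (eventually_eventually_nhds.2 hH.eq),
    (tendsto_diag θ₀).eventually hH.analytic.eventually_analyticAt,
    eventually_iteratedFDeriv_slice_eq_zero hS hF hθ hH] with t heq hHt hlower ht
  exact (isFinitePiece_iteratedFDeriv ht hHt heq hlower).connected_eq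

theorem IsRegularPart.hasDegenerateValue :
    HasDegenerateValue F θ₀ (leading H θ₀ fun i => Pi.single i 1) := by
  have hcont : Tendsto (fun t => iteratedFDeriv ℂ N H (t, t) fun i => (Pi.single i 1, 0)) (𝓝 θ₀)
      (𝓝 (iteratedFDeriv ℂ N H (θ₀, θ₀) fun i => (Pi.single i 1, 0))) :=
    ((continuous_eval_const _).tendsto _).comp
      ((hH.analytic.contDiffAt.continuousAt_iteratedFDeriv le_rfl).tendsto.comp (tendsto_diag θ₀))
  rw [HasDegenerateValue, leading, iteratedFDeriv_slice hH.analytic]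
  refine (hcont.mono_left nhdsWithin_le_nhds).congr' (eventually_nhdsWithin_iff.2 ?_)
  filter_upwards [hH.eventually_connected_eq hS hF hθ,
    (tendsto_diag θ₀).eventually hH.analytic.eventually_analyticAt] with t hconn hHt ht
  rw [hconn ht, leading, iteratedFDeriv_slice hHt]

end

/-! ### Exchange symmetry of the leading term -/

theorem exists_ofFn_comp_swap {α : Type*} {n : ℕ} (x : Fin n → α) {i i' : Fin n}
    (hi : (i' : ℕ) = i + 1) : ∃ u v : List α, List.ofFn x = u ++ x i :: x i' :: v ∧
      List.ofFn (x ∘ Equiv.swap i i') = u ++ x i' :: x i :: v := by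
  have hlen : (List.ofFn x).length = n := List.length_ofFn
  refine ⟨(List.ofFn x).take i, (List.ofFn x).drop (i + 2), ?_, ?_⟩ <;>
    refine List.ext_getElem (by simp; omega) fun k hk _ => ?_ <;>
    simp only [List.getElem_ofFn, Function.comp_apply, Equiv.swap_apply_def, List.getElem_append,
      List.getElem_take, List.length_take, hlen, List.getElem_cons, List.getElem_drop,
      Fin.ext_iff, hi] <;>
    grind

theorem comp_swap_eq {α β : Type*} [DecidableEq α] {f : α → β} {i i' : α} (h : f i = f i') :
    f ∘ Equiv.swap i i' = f := by
  ext a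
  rw [Function.comp_apply, Equiv.swap_apply_def]
  grind

section

variable {N : ℕ} {θ₀ : Fin N → ℂ} {i i' : Fin N} (hi : (i' : ℕ) = i + 1)

section

variable (hθ : θ₀ i = θ₀ i')
include hθ

theorem crossProd_swap (x t : Fin N → ℂ) :
    crossProd θ₀ (x ∘ Equiv.swap i i') t = crossProd θ₀ x t := by
  have hθs (a : Fin N) : θ₀ (Equiv.swap i i' a) = θ₀ a := congrFun (comp_swap_eq hθ) a
  rw [crossProd, crossProd, ← Equiv.prod_comp (Equiv.swap i i')
    fun a => ∏ b, if θ₀ a = θ₀ b then x a - t b else 1]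
  simp only [Function.comp_apply, hθs]

include hi

theorem prod_sub_swap (x : Fin N → ℂ) :
    (∏ a, ∏ b, if a < b ∧ θ₀ a = θ₀ b then x (Equiv.swap i i' a) - x (Equiv.swap i i' b) else 1) =
      -∏ a, ∏ b, if a < b ∧ θ₀ a = θ₀ b then x a - x b else 1 := by
  let f : Fin N → Fin N → ℂ := fun a b =>
    if θ₀ a = θ₀ b then x a - x b else if a < b then 1 else -1
  have hanti (a b : Fin N) : f a b = -f b a := by
    simp only [f]; grind
  have hθs (a : Fin N) : θ₀ (Equiv.swap i i' a) = θ₀ a := congrFun (comp_swap_eq hθ) a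
  have hmono (a b : Fin N) (hab : a < b) (hne : θ₀ a ≠ θ₀ b) :
      Equiv.swap i i' a < Equiv.swap i i' b := by
    simp only [Equiv.swap_apply_def]; grind
  have hIoi (g h : Fin N → Fin N → ℂ)
      (hgh : ∀ a b, a < b → h a b = if θ₀ a = θ₀ b then g a b else 1) :
      (∏ a, ∏ b, if a < b ∧ θ₀ a = θ₀ b then g a b else 1) = ∏ a, ∏ b ∈ Finset.Ioi a, h a b := by
    refine Finset.prod_congr rfl fun a _ => ?_
    rw [← Finset.filter_lt_eq_Ioi, Finset.prod_filter]
    refine Finset.prod_congr rfl fun b _ => ?_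
    rw [ite_and]
    split_ifs with hab hθab <;> simp [hgh a b, *]
  have hsign := (Equiv.swap i i').prod_Ioi_comp_eq_sign_mul_prod hanti
  rw [Equiv.Perm.sign_swap (by grind), Units.val_neg, Units.val_one, Int.cast_neg, Int.cast_one,
    neg_one_mul] at hsign
  rwa [hIoi _ (fun a b => f (Equiv.swap i i' a) (Equiv.swap i i' b)) fun a b hab => by
      simp only [f, hθs]; grind,
    hIoi _ f fun a b hab => by simp only [f, hab, if_true]]

theorem diffProd_swap (x t : Fin N → ℂ) :
    diffProd θ₀ (x ∘ Equiv.swap i i') t = -diffProd θ₀ x t := by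
  have hsplit (y : Fin N → ℂ) : diffProd θ₀ y t =
      (∏ a, ∏ b, if a < b ∧ θ₀ a = θ₀ b then y a - y b else 1) *
        ∏ a, ∏ b, if a < b ∧ θ₀ a = θ₀ b then t b - t a else 1 := by
    simp only [diffProd, ← Finset.prod_mul_distrib, ite_mul_ite, mul_one]
  rw [hsplit, hsplit, ← neg_mul, ← prod_sub_swap hi hθ]
  rfl

theorem pairProd_swap {x t : Fin N → ℂ} (hxt : ∀ a b, x a ≠ t b) :
    pairProd θ₀ (x ∘ Equiv.swap i i') t * ∏ a, (x a - t a) =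
      -(pairProd θ₀ x t * ∏ a, ((x ∘ Equiv.swap i i') a - t a)) := by
  have hx := crossProd_mul_pairProd θ₀ hxt
  have hswap := crossProd_mul_pairProd θ₀ (x := x ∘ Equiv.swap i i') fun a b => hxt _ b
  rw [crossProd_swap hθ, diffProd_swap hi hθ] at hswap
  apply mul_left_cancel₀ (crossProd_ne_zero θ₀ hxt)
  linear_combination (∏ a, (x a - t a)) * hswap + (∏ a, ((x ∘ Equiv.swap i i') a - t a)) * hx

end

variable {S : ℂ → ℂ} (hS : IsScatteringMatrix S)
  {F : (n : ℕ) → (Fin n → ℂ) → ℂ} (hF : IsFormFactor S F)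
include hi hS hF

theorem diagFF_swap {x t : Fin N → ℂ} (h : Admissible S (Sum.elim x t : Fin N ⊕ Fin N → ℂ))
    (hxt : ∀ i j, x i ≠ t j) :
    diagFF F x t = S (x i - x i') * diagFF F (x ∘ Equiv.swap i i') t := by
  obtain ⟨u, v, hu, hv⟩ := exists_ofFn_comp_swap (fun k => x k + Real.pi * I) hi
  have hgen := pairwise_generic_diag hS h hxt
  rw [hu, List.append_assoc, List.cons_append, List.cons_append] at hgen
  rw [diagFF_eq_listFF, diagFF_eq_listFF, hu, List.append_assoc, List.cons_append,
    List.cons_append, listFF_exchange hS hF hgen, add_sub_add_right_eq_sub]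
  simp only [Function.comp_def] at hv ⊢
  rw [hv, List.append_assoc, List.cons_append, List.cons_append]

end

/-- All coordinates of `x` and `t` are different. -/
structure InGeneralPosition {N : ℕ} (x t : Fin N → ℂ) : Prop where
  left_injective : Function.Injective x
  right_injective : Function.Injective t
  ne : ∀ i j, x i ≠ t j

theorem eventually_of_inGeneralPosition {N : ℕ} {θ₀ : Fin N → ℂ}
    {f : (Fin N → ℂ) × (Fin N → ℂ) → ℂ} (hf : AnalyticAt ℂ f (θ₀, θ₀))
    (h : ∀ᶠ q in 𝓝 (θ₀, θ₀), InGeneralPosition q.1 q.2 → f q = 0) :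
    ∀ᶠ q in 𝓝 (θ₀, θ₀), f q = 0 := by
  have hzero : ∀ᶠ q in 𝓝 (θ₀, θ₀), (0 : (Fin N → ℂ) × (Fin N → ℂ) →L[ℂ] ℂ) q = 0 → f q = 0 := by
    refine eventually_eq_zero_of_generic
      (Finset.univ.disjSum (Finset.univ.filter fun b : Bool × Fin N × Fin N => b.2.1 ≠ b.2.2))
      (Sum.elim crossForm diffForm)
      (d := (fun k => ((k : ℕ) : ℂ), fun k => ((N + k : ℕ) : ℂ))) (by simp) ?_
      (hf.eventually_analyticAt.mono fun q hq => hq.continuousAt) (h.mono fun q hq _ hgen => ?_)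
    · rintro (⟨i, j⟩ | ⟨_ | _, i, j⟩) ha <;>
        simp only [Finset.inr_mem_disjSum, Finset.mem_filter, Finset.mem_univ, true_and, ne_eq,
          Fin.ext_iff] at ha <;>
        simp only [Sum.elim_inl, Sum.elim_inr, crossForm_apply, diffForm_false, diffForm_true,
          sub_ne_zero] <;>
        norm_cast <;> omega
    · refine hq ⟨fun i j hij => ?_, fun i j hij => ?_, fun i j heq => ?_⟩
      · by_contra hne
        exact hgen (.inr (false, i, j)) (by simpa using hne) (sub_eq_zero.2 hij)
      · by_contra hne
        exact hgen (.inr (true, i, j)) (by simpa using hne) (sub_eq_zero.2 hij.symm)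
      · exact hgen (.inl (i, j)) (by simp) (sub_eq_zero.2 heq)
  exact hzero.mono fun q hq => hq rfl

/-- The permutation `(x, t) ↦ (x ∘ σ, t)` of the first set of coordinates. -/
noncomputable def permuteFst {N : ℕ} (σ : Equiv.Perm (Fin N)) :
    (Fin N → ℂ) × (Fin N → ℂ) →L[ℂ] (Fin N → ℂ) × (Fin N → ℂ) :=
  (ContinuousLinearMap.pi fun k => .proj (σ k)).prodMap (.id ℂ _)

theorem permuteFst_apply {N : ℕ} (σ : Equiv.Perm (Fin N)) (q : (Fin N → ℂ) × (Fin N → ℂ)) :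
    permuteFst σ q = (q.1 ∘ σ, q.2) := rfl

theorem IsRegularPart.eventually_eq_permuteFst_swap {N : ℕ} {θ₀ : Fin N → ℂ} {i i' : Fin N}
    (hi : (i' : ℕ) = i + 1) (hii : θ₀ i = θ₀ i') {S : ℂ → ℂ} (hS : IsScatteringMatrix S)
    {F : (n : ℕ) → (Fin n → ℂ) → ℂ} (hF : IsFormFactor S F) (hθ : Admissible S θ₀)
    {H : (Fin N → ℂ) × (Fin N → ℂ) → ℂ} (hH : IsRegularPart F θ₀ H) :
    ∀ᶠ q in 𝓝 (θ₀, θ₀), H q = -S (q.1 i - q.1 i') * H (permuteFst (Equiv.swap i i') q) := by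
  set P := permuteFst (Equiv.swap i i') with hP
  have hP₀ : P (θ₀, θ₀) = (θ₀, θ₀) := by rw [hP, permuteFst_apply, comp_swap_eq hii]
  have hP_tendsto : Tendsto P (𝓝 (θ₀, θ₀)) (𝓝 (θ₀, θ₀)) := P.continuous.tendsto' _ _ hP₀
  have hHP : AnalyticAt ℂ (fun q => H (P q)) (θ₀, θ₀) :=
    AnalyticAt.fun_comp (g := H) (f := P) (by rw [hP₀]; exact hH.analytic) (P.analyticAt _)
  have hS_an : AnalyticAt ℂ (fun q : (Fin N → ℂ) × (Fin N → ℂ) => S (q.1 i - q.1 i')) (θ₀, θ₀) :=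
    hS.analyticAt_comp ((fstForm i - fstForm i').analyticAt _) (hθ i i').1
  suffices hsub : ∀ᶠ q in 𝓝 (θ₀, θ₀), H q - -S (q.1 i - q.1 i') * H (P q) = 0 from
    hsub.mono fun q => sub_eq_zero.1
  refine eventually_of_inGeneralPosition (hH.analytic.sub (hS_an.neg.mul hHP)) ?_
  filter_upwards [hH.eq, hP_tendsto.eventually hH.eq, hθ.sumElim_self.eventually_sumElim hS]
    with q hq hqP hadm hgen
  have hprod : ∏ a, ((q.1 ∘ Equiv.swap i i') a - q.2 a) ≠ 0 :=
    Finset.prod_ne_zero_iff.2 fun a _ => sub_ne_zero.2 (hgen.ne _ _)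
  have hpair : pairProd θ₀ q.1 q.2 ≠ 0 :=
    pairProd_ne_zero (fun a b _ => hgen.ne a b) hgen.left_injective hgen.right_injective
  have hcauchy := pairProd_swap hi hii hgen.ne
  have hfactor := hq hgen.ne
  have hfactor_swap := hqP fun a b => hgen.ne _ b
  rw [diagFF_swap hi hS hF hadm hgen.ne] at hfactor
  simp only [hP, permuteFst_apply] at hfactor_swap ⊢
  apply mul_right_cancel₀ (mul_ne_zero hpair hprod)
  linear_combination (-(∏ a, ((q.1 ∘ Equiv.swap i i') a - q.2 a))) * hfactor
    + S (q.1 i - q.1 i') * (∏ a, (q.1 a - q.2 a)) * hfactor_swap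
    + S (q.1 i - q.1 i') * H (q.1 ∘ Equiv.swap i i', q.2) * hcauchy

theorem leading_comp_perm {N : ℕ} {H : (Fin N → ℂ) × (Fin N → ℂ) → ℂ} {t : Fin N → ℂ}
    (hH : AnalyticAt ℂ H (t, t)) (v : Fin N → Fin N → ℂ) (σ : Equiv.Perm (Fin N)) :
    leading H t (v ∘ σ) = leading H t v :=
  (analyticAt_slice hH).contDiffAt.iteratedFDeriv_comp_perm v σ

section

variable {S : ℂ → ℂ} (hS : IsScatteringMatrix S) {N : ℕ}
  {F : (n : ℕ) → (Fin n → ℂ) → ℂ} (hF : IsFormFactor S F)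
include hS hF

section

variable {θ₀ : Fin N → ℂ} (hθ : Admissible S θ₀) {H : (Fin N → ℂ) × (Fin N → ℂ) → ℂ}
  (hH : IsRegularPart F θ₀ H)
include hθ hH

theorem IsRegularPart.eventually_iteratedFDeriv_eq_zero :
    ∀ᶠ t in 𝓝 θ₀, ∀ k < N, iteratedFDeriv ℂ k H (t, t) = 0 := by
  refine eventually_iteratedFDeriv_diag_eq_zero hH.analytic.contDiffAt ?_
  filter_upwards [eventually_iteratedFDeriv_slice_eq_zero hS hF hθ hH,
    (tendsto_diag θ₀).eventually hH.analytic.eventually_analyticAt] with t hlower hHt k hk v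
  rw [← iteratedFDeriv_slice hHt, hlower k hk, zero_apply]

theorem IsRegularPart.iteratedFDeriv_apply_eq_zero (v : Fin N → (Fin N → ℂ) × (Fin N → ℂ))
    (j : Fin N) (hj : (v j).1 = (v j).2) : iteratedFDeriv ℂ N H (θ₀, θ₀) v = 0 := by
  obtain _ | N := N
  · exact j.elim0
  · exact iteratedFDeriv_succ_diag_eq_zero hH.analytic.contDiffAt
      ((hH.eventually_iteratedFDeriv_eq_zero hS hF hθ).mono fun t ht => ht N N.lt_succ_self) v j hj

variable {i i' : Fin N} (hi : (i' : ℕ) = i + 1) (hii : θ₀ i = θ₀ i')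
include hi hii

theorem IsRegularPart.iteratedFDeriv_permuteFst_swap (v : Fin N → (Fin N → ℂ) × (Fin N → ℂ)) :
    iteratedFDeriv ℂ N H (θ₀, θ₀) v =
      iteratedFDeriv ℂ N H (θ₀, θ₀) fun k => permuteFst (Equiv.swap i i') (v k) := by
  set P := permuteFst (Equiv.swap i i') with hP
  have hP₀ : P (θ₀, θ₀) = (θ₀, θ₀) := by rw [hP, permuteFst_apply, comp_swap_eq hii]
  have hHP : AnalyticAt ℂ H (P (θ₀, θ₀)) := by rw [hP₀]; exact hH.analytic
  have hlower := (hH.eventually_iteratedFDeriv_eq_zero hS hF hθ).self_of_nhds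
  have hcomp (k : ℕ) : iteratedFDeriv ℂ k (fun q => H (P q)) (θ₀, θ₀) =
      (iteratedFDeriv ℂ k H (θ₀, θ₀)).compContinuousLinearMap fun _ => P := by
    rw [iteratedFDeriv_comp_clm P hHP.contDiffAt, hP₀]
  have hS_an : AnalyticAt ℂ (fun q : (Fin N → ℂ) × (Fin N → ℂ) => -S (q.1 i - q.1 i')) (θ₀, θ₀) :=
    (hS.analyticAt_comp ((fstForm i - fstForm i').analyticAt _) (hθ i i').1).neg
  have hHP_an : AnalyticAt ℂ (fun q => H (P q)) (θ₀, θ₀) := hHP.fun_comp (P.analyticAt _)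
  have hscale := iteratedFDeriv_smul_eq_smul (n := N) hS_an.contDiffAt hHP_an.contDiffAt
    fun k hk => by rw [hcomp k, hlower k hk]; rfl
  simp only [hii, sub_self, hS.at_zero, neg_neg, one_smul, hcomp, smul_eq_mul] at hscale
  have hswap : H =ᶠ[𝓝 (θ₀, θ₀)] fun q => -S (q.1 i - q.1 i') * H (P q) :=
    hH.eventually_eq_permuteFst_swap hi hii hS hF hθ
  exact DFunLike.congr_fun ((hswap.iteratedFDeriv ℂ N).self_of_nhds.trans hscale) v

theorem IsRegularPart.leading_single_adjacent (v : Fin N → Fin N → ℂ) (k : Fin N) :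
    leading H θ₀ (Function.update v k (Pi.single i 1)) =
      leading H θ₀ (Function.update v k (Pi.single i' 1)) := by
  have hswap : LinearMap.funLeft ℂ ℂ (Equiv.swap i i') (Pi.single i 1) = Pi.single i' 1 := by
    ext a
    simp [LinearMap.funLeft_apply, Pi.single_apply, Equiv.swap_apply_eq_iff]
  have hfst := map_update_fst_eq (D := (iteratedFDeriv ℂ N H (θ₀, θ₀)).toMultilinearMap)
    (hH.iteratedFDeriv_apply_eq_zero hS hF hθ) (A := LinearMap.funLeft ℂ ℂ (Equiv.swap i i'))
    (hH.iteratedFDeriv_permuteFst_swap hS hF hθ hi hii) (fun j => (v j, 0)) k (Pi.single i 1)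
  rw [hswap] at hfst
  rw [leading, iteratedFDeriv_slice hH.analytic, iteratedFDeriv_slice hH.analytic]
  convert hfst using 1 <;> refine congrArg (iteratedFDeriv ℂ N H (θ₀, θ₀)) (funext fun j => ?_) <;>
    rcases eq_or_ne j k with rfl | hj <;> simp [*]

end

section

variable {l : Fin N → ℕ} (hl : Monotone l) {θ : ℕ → ℂ} (hθ : Admissible S (θ ∘ l))
  {H : (Fin N → ℂ) × (Fin N → ℂ) → ℂ} (hH : IsRegularPart F (θ ∘ l) H)
include hl hθ hH

theorem leading_single_eq_of_le {i i' : Fin N} (hle : i ≤ i') (hii : l i = l i')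
    (v : Fin N → Fin N → ℂ) (k : Fin N) :
    leading H (θ ∘ l) (Function.update v k (Pi.single i 1)) =
      leading H (θ ∘ l) (Function.update v k (Pi.single i' 1)) := by
  obtain ⟨d, hd⟩ := Nat.exists_eq_add_of_le (Fin.le_def.1 hle)
  induction d generalizing i' with
  | zero => rw [Fin.ext hd.symm]
  | succ d ih =>
    have hlt : (i : ℕ) + d < N := by omega
    have hmid : l i = l ⟨i + d, hlt⟩ :=
      (hl (Fin.le_def.2 (by simp))).antisymm ((hl (Fin.le_def.2 (by simp [hd]))).trans hii.ge)
    rw [ih (i' := ⟨i + d, hlt⟩) (Fin.le_def.2 (by simp)) hmid rfl]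
    exact hH.leading_single_adjacent hS hF hθ (by simp [hd, add_assoc])
      (congrArg θ (hmid.symm.trans hii)) v k

theorem leading_single_congr {c c' : Fin N → Fin N} (hc : ∀ k, l (c k) = l (c' k)) :
    leading H (θ ∘ l) (fun k => Pi.single (c k) 1) =
      leading H (θ ∘ l) (fun k => Pi.single (c' k) 1) := by
  refine apply_eq_of_update_eq (D := leading H (θ ∘ l)) fun v k => ?_
  obtain hle | hle := le_total (c k) (c' k)
  · exact leading_single_eq_of_le hS hF hl hθ hH hle (hc k) v k
  · exact (leading_single_eq_of_le hS hF hl hθ hH hle (hc k).symm v k).symm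

end

end

/-! ### Coefficients of the leading term -/

theorem exists_perm_of_map_eq {ι α : Type*} [Fintype ι] {f g : ι → α}
    (h : Finset.univ.val.map f = Finset.univ.val.map g) : ∃ σ : Equiv.Perm ι, f = g ∘ σ := by
  classical
  have hcard (f : ι → α) (c : α) :
      Fintype.card {a // f a = c} = (Finset.univ.val.map f).count c := by
    rw [Fintype.card_subtype, Multiset.count_map]
    simp only [Finset.card_def, Finset.filter_val, eq_comm]
  have hfiber (c : α) : Nonempty ({a // f a = c} ≃ {b // g b = c}) :=
    ⟨Fintype.equivOfCardEq (by rw [hcard, hcard, h])⟩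
  exact ⟨Equiv.ofFiberEquiv fun c => (hfiber c).some,
    funext fun a => (Equiv.ofFiberEquiv_map _ a).symm⟩

theorem map_removeNth {α : Type*} [DecidableEq α] {N : ℕ} (b : Fin (N + 1) → α)
    (k : Fin (N + 1)) :
    Finset.univ.val.map (k.removeNth b) = (Finset.univ.val.map b).erase (b k) := by
  change Finset.univ.val.map (b ∘ k.succAbove) = _
  rw [Fin.univ_succAbove N k]
  simp [Function.comp_def]

theorem exists_monotone_map {N : ℕ} {A : Multiset ℕ} (hN : A.card = N) :
    ∃ l : Fin N → ℕ, Monotone l ∧ Finset.univ.val.map l = A := by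
  have hlen : A.sort.length = N := by simp [hN]
  subst hlen
  refine ⟨A.sort.get, (Multiset.pairwise_sort A (· ≤ ·)).sortedLE.monotone_get, ?_⟩
  rw [Fin.univ_val_map, List.ofFn_get, Multiset.sort_eq]

/-- The order of the group permuting equal members of a multiset. -/
noncomputable def symFactor (M : Multiset ℕ) : ℂ := ∏ x ∈ M.toFinset, ((M.count x).factorial : ℂ)

theorem symFactor_ne_zero (M : Multiset ℕ) : symFactor M ≠ 0 :=
  Finset.prod_ne_zero_iff.2 fun _ _ => Nat.cast_ne_zero.2 (Nat.factorial_ne_zero _)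

theorem symFactor_eq_prod {M : Multiset ℕ} {s : Finset ℕ} (hs : M.toFinset ⊆ s) :
    symFactor M = ∏ x ∈ s, ((M.count x).factorial : ℂ) := by
  refine Finset.prod_subset hs fun x _ hx => ?_
  rw [Multiset.mem_toFinset] at hx
  rw [Multiset.count_eq_zero_of_notMem hx, Nat.factorial_zero, Nat.cast_one]

theorem symFactor_eq_count_mul_symFactor_erase {M : Multiset ℕ} {x : ℕ} (hx : x ∈ M) :
    symFactor M = M.count x * symFactor (M.erase x) := by
  have hx' := Multiset.mem_toFinset.2 hx
  rw [symFactor_eq_prod (Multiset.toFinset_subset.2 (Multiset.erase_subset x M)), symFactor,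
    ← Finset.mul_prod_erase _ _ hx', ← Finset.mul_prod_erase _ _ hx', ← mul_assoc]
  congr 1
  · rw [Multiset.count_erase_self, ← Nat.cast_mul,
      Nat.mul_factorial_pred (Multiset.count_pos.2 hx).ne']
  · exact Finset.prod_congr rfl fun y hy => by
      rw [Multiset.count_erase_of_ne (Finset.ne_of_mem_erase hy)]

theorem symFactor_eq_one {M : Multiset ℕ} (hM : M.Nodup) : symFactor M = 1 :=
  Finset.prod_eq_one fun x hx => by
    rw [Multiset.count_eq_one_of_mem hM (Multiset.mem_toFinset.1 hx), Nat.factorial_one,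
      Nat.cast_one]

open Classical in
/-- A choice of the regular part of the form factor at `θ₀`. -/
noncomputable def regularPart (F : (n : ℕ) → (Fin n → ℂ) → ℂ) {N : ℕ} (θ₀ : Fin N → ℂ) :
    (Fin N → ℂ) × (Fin N → ℂ) → ℂ :=
  if h : ∃ H, IsRegularPart F θ₀ H then h.choose else 0

open Classical in
/-- The coefficient of the leading term at the rapidities `θ ∘ l`, in directions whose labels form
the multiset `M`. It does not depend on the choice of the directions if `l` is monotone, and is
normalised so as to be the coefficient of a monomial rather than a value of a multilinear form. -/
noncomputable def tupleCoeff (F : (n : ℕ) → (Fin n → ℂ) → ℂ) (θ : ℕ → ℂ) {N : ℕ} (l : Fin N → ℕ)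
    (M : Multiset ℕ) : ℂ :=
  if h : ∃ c : Fin N → Fin N, Finset.univ.val.map (l ∘ c) = M then
    leading (regularPart F (θ ∘ l)) (θ ∘ l) (fun k => Pi.single (h.choose k) 1) / symFactor M
  else 0

/-- The coefficient `tupleCoeff` at the increasing enumeration of the multiset of labels `A`. -/
noncomputable def leadingCoeff (F : (n : ℕ) → (Fin n → ℂ) → ℂ) (θ : ℕ → ℂ) (A M : Multiset ℕ) : ℂ :=
  tupleCoeff F θ A.sort.get M

theorem leadingCoeff_map (F : (n : ℕ) → (Fin n → ℂ) → ℂ) (θ : ℕ → ℂ) {N : ℕ} {l : Fin N → ℕ}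
    (hl : Monotone l) (M : Multiset ℕ) :
    leadingCoeff F θ (Finset.univ.val.map l) M = tupleCoeff F θ l M := by
  have hsort : (Finset.univ.val.map l).sort = List.ofFn l := by
    rw [Fin.univ_val_map]
    exact List.mergeSort_eq_self _ hl.sortedLE_ofFn.pairwise
  have hsigma : (⟨(List.ofFn l).length, (List.ofFn l).get⟩ : Σ n, Fin n → ℕ) = ⟨N, l⟩ :=
    List.equivSigmaTuple.right_inv ⟨N, l⟩
  rw [leadingCoeff, hsort]
  exact congrArg (fun s : Σ n, Fin n → ℕ => tupleCoeff F θ s.2 M) hsigma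

/-- Rapidities labelled by members of `A` are admissible. -/
def AdmissibleLabels (S : ℂ → ℂ) (θ : ℕ → ℂ) (A : Multiset ℕ) : Prop :=
  Admissible S fun a : {a // a ∈ A} => θ a

section

variable {S : ℂ → ℂ} {N : ℕ} {θ : ℕ → ℂ}

theorem AdmissibleLabels.mono {A A' : Multiset ℕ} (h : AdmissibleLabels S θ A) (hA : A' ⊆ A) :
    AdmissibleLabels S θ A' := fun a b => h ⟨a, hA a.2⟩ ⟨b, hA b.2⟩

theorem AdmissibleLabels.admissible {l : Fin N → ℕ}
    (h : AdmissibleLabels S θ (Finset.univ.val.map l)) : Admissible S (θ ∘ l) := fun i j =>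
  h ⟨l i, Multiset.mem_map_of_mem l (Finset.mem_univ i)⟩
    ⟨l j, Multiset.mem_map_of_mem l (Finset.mem_univ j)⟩

variable (hS : IsScatteringMatrix S) {F : (n : ℕ) → (Fin n → ℂ) → ℂ} (hF : IsFormFactor S F)
include hS hF

theorem isRegularPart_regularPart {θ₀ : Fin N → ℂ} (hθ : Admissible S θ₀) :
    IsRegularPart F θ₀ (regularPart F θ₀) := by
  have h := exists_isRegularPart hS hF hθ
  rw [regularPart, dif_pos h]
  exact h.choose_spec

theorem leading_regularPart_single_succAbove {θ₀ : Fin (N + 1) → ℂ} (hθ : Admissible S θ₀)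
    (p : Fin (N + 1)) (d : Fin (N + 1) → Fin N) :
    leading (regularPart F θ₀) θ₀ (fun k => Pi.single (p.succAbove (d k)) 1) =
      ∑ k, phi S (θ₀ p - p.removeNth θ₀ (d k)) *
        leading (regularPart F (p.removeNth θ₀)) (p.removeNth θ₀)
          fun j => Pi.single (k.removeNth d j) 1 := by
  have hform (j : Fin N) :
      phiForm S p θ₀ (Pi.single j 1) = phi S (θ₀ p - p.removeNth θ₀ j) := by
    simp [phiForm_apply, Pi.single_apply]
  have hrec := iteratedFDeriv_slice_apply_insertZero hS p hF hθ (isRegularPart_regularPart hS hF hθ)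
    (isRegularPart_regularPart hS hF (hθ.removeNth p)) fun k => Pi.single (d k) 1
  simp only [insertZero_single, hform] at hrec
  exact hrec

theorem leadingCoeff_mul_symFactor {l : Fin N → ℕ} (hl : Monotone l) (hθ : Admissible S (θ ∘ l))
    {c : Fin N → Fin N} {M : Multiset ℕ} (hM : Finset.univ.val.map (l ∘ c) = M) :
    leadingCoeff F θ (Finset.univ.val.map l) M * symFactor M =
      leading (regularPart F (θ ∘ l)) (θ ∘ l) fun k => Pi.single (c k) 1 := by
  have h : ∃ c : Fin N → Fin N, Finset.univ.val.map (l ∘ c) = M := ⟨c, hM⟩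
  have hH := isRegularPart_regularPart hS hF hθ
  obtain ⟨σ, hσ⟩ := exists_perm_of_map_eq (h.choose_spec.trans hM.symm)
  rw [leadingCoeff_map F θ hl, tupleCoeff, dif_pos h, div_mul_cancel₀ _ (symFactor_ne_zero M),
    leading_single_congr hS hF hl hθ hH (c' := c ∘ σ) fun k => congrFun hσ k]
  exact leading_comp_perm hH.analytic (fun k => Pi.single (c k) 1) σ

theorem leadingCoeff_eq_sum_erase {A M : Multiset ℕ} (hA : AdmissibleLabels S θ A)
    (hcard : M.card = A.card) {a : ℕ} (ha : a ∈ A) (hM : M ⊆ A.erase a) :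
    leadingCoeff F θ A M = ∑ x ∈ M.toFinset, phi S (θ a - θ x) *
      leadingCoeff F θ (A.erase a) (M.erase x) := by
  obtain ⟨N, hN⟩ : ∃ N, A.card = N + 1 :=
    Nat.exists_eq_succ_of_ne_zero (Multiset.card_pos_iff_exists_mem.2 ⟨a, ha⟩).ne'
  obtain ⟨l, hl, rfl⟩ := exists_monotone_map hN
  obtain ⟨b, -, rfl⟩ := exists_monotone_map (hcard.trans hN)
  obtain ⟨p, -, rfl⟩ := Multiset.mem_map.1 ha
  have hθ := hA.admissible
  have hl' : Monotone (p.removeNth l) := hl.comp (Fin.strictMono_succAbove p).monotone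
  rw [← map_removeNth] at hM ⊢
  have hlabel (k : Fin (N + 1)) : ∃ j, p.removeNth l j = b k := by
    simpa using hM (Multiset.mem_map_of_mem b (Finset.mem_univ k))
  choose d hd using hlabel
  set M := Finset.univ.val.map b with hMb
  have hterm (k : Fin (N + 1)) :
      leadingCoeff F θ (Finset.univ.val.map (p.removeNth l)) (M.erase (b k)) *
        symFactor (M.erase (b k)) = leading (regularPart F (p.removeNth (θ ∘ l)))
          (p.removeNth (θ ∘ l)) fun j => Pi.single (k.removeNth d j) 1 :=
    leadingCoeff_mul_symFactor hS hF hl' (hθ.removeNth p) (by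
      rw [hMb, ← map_removeNth]
      exact congrArg (fun f => Finset.univ.val.map f) (funext fun j => hd (k.succAbove j)))
  apply mul_right_cancel₀ (symFactor_ne_zero M)
  calc leadingCoeff F θ (Finset.univ.val.map l) M * symFactor M
      = ∑ k, phi S (θ (l p) - θ (b k)) *
          (leadingCoeff F θ (Finset.univ.val.map (p.removeNth l)) (M.erase (b k)) *
            symFactor (M.erase (b k))) := by
        rw [leadingCoeff_mul_symFactor hS hF hl hθ (c := p.succAbove ∘ d)
          (congrArg (Finset.univ.val.map) (funext hd))]
        refine (leading_regularPart_single_succAbove hS hF hθ p d).trans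
          (Finset.sum_congr rfl fun k _ => ?_)
        rw [hterm, ← hd]
        rfl
    _ = ∑ x ∈ M.toFinset, M.count x • (phi S (θ (l p) - θ x) *
          (leadingCoeff F θ (Finset.univ.val.map (p.removeNth l)) (M.erase x) *
            symFactor (M.erase x))) := by
        rw [← Finset.sum_multiset_map_count, hMb, Multiset.map_map]
        rfl
    _ = _ := by
        rw [Finset.sum_mul]
        refine Finset.sum_congr rfl fun x hx => ?_
        rw [symFactor_eq_count_mul_symFactor_erase (Multiset.mem_toFinset.1 hx), nsmul_eq_mul]
        ring

theorem leading_regularPart_rapidities {L : List ℕ} (hL : L.SortedLE)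
    (hθ : Admissible S (rapidities θ L)) :
    leading (regularPart F (rapidities θ L)) (rapidities θ L) (fun i => Pi.single i 1) =
      symFactor L * leadingCoeff F θ L L := by
  have hmap : Finset.univ.val.map L.get = L := by rw [Fin.univ_val_map, List.ofFn_get]
  have hcoeff := leadingCoeff_mul_symFactor hS hF hL.monotone_get hθ (c := id) hmap
  rw [hmap, mul_comm] at hcoeff
  exact hcoeff.symm

omit hS hF in
theorem AdmissibleLabels.admissible_rapidities {L : List ℕ} (hL : AdmissibleLabels S θ L) :
    Admissible S (rapidities θ L) := fun i j =>
  hL ⟨L.get i, L.get_mem i⟩ ⟨L.get j, L.get_mem j⟩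

theorem hasDegenerateValue_rapidities {L : List ℕ} (hL : L.SortedLE)
    (hθ : AdmissibleLabels S θ L) :
    HasDegenerateValue F (rapidities θ L) (symFactor L * leadingCoeff F θ L L) := by
  rw [← leading_regularPart_rapidities hS hF hL hθ.admissible_rapidities]
  exact (isRegularPart_regularPart hS hF hθ.admissible_rapidities).hasDegenerateValue hS hF
    hθ.admissible_rapidities

theorem connected_rapidities {L : List ℕ} (hL : L.SortedLT) (hθ : AdmissibleLabels S θ L)
    (hinj : Set.InjOn θ {a | a ∈ L}) :
    connected F (rapidities θ L) = leadingCoeff F θ L L := by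
  have hinj' : Function.Injective (rapidities θ L) := fun i j h =>
    hL.strictMono_get.injective (hinj (L.get_mem i) (L.get_mem j) h)
  have hH := isRegularPart_regularPart hS hF hθ.admissible_rapidities
  rw [(hH.eventually_connected_eq hS hF hθ.admissible_rapidities).self_of_nhds hinj',
    leading_regularPart_rapidities hS hF hL.sortedLE hθ.admissible_rapidities,
    symFactor_eq_one (Multiset.coe_nodup.2 hL.nodup), one_mul]

end

/-! ### Sums over sequences -/

section

variable (S : ℂ → ℂ) (θ : ℕ → ℂ)

open Classical in
/-- The sum of `[s]_φ` over the sequences made of the members of `C` that start with `b` and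
satisfy `P`. -/
noncomputable def bracketSum (P : List ℕ → Prop) (b : ℕ) (C : Multiset ℕ) : ℂ :=
  ∑ s ∈ C.lists.toFinset with s.head? = some b ∧ P s, bracket S θ s

/-- The sum of `[s]_φ` over `S_{b,r}(C)`. -/
noncomputable def pathSum (b r : ℕ) (C : Multiset ℕ) : ℂ := ∑ s ∈ paths b r C, bracket S θ s

/-- In the sequence `s`, the first member after the rightmost `a` is `c`. -/
def NextAfterLast (a c : ℕ) (s : List ℕ) : Prop := ∃ u v : List ℕ, s = u ++ a :: c :: v ∧ a ∉ c :: v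

theorem bracketSum_getLast (b r : ℕ) (C : Multiset ℕ) :
    bracketSum S θ (fun s => s.getLast? = some r) b C = pathSum S θ b r C := by
  rw [bracketSum, pathSum, paths]
  congr

theorem sum_paths'_eq_bracketSum (C : Multiset ℕ) :
    ∑ s ∈ paths' C, bracket S θ s =
      bracketSum S θ (fun s => s.getLast? = some 2 ∧ NextAfterLast 1 2 s) 1 C := by
  classical
  rw [bracketSum, paths', paths, Finset.filter_filter]
  congr! 2 with s
  simp [NextAfterLast, and_assoc]

variable {S θ}

theorem bracketSum_of_forall_not {P : List ℕ → Prop} {b : ℕ} {C : Multiset ℕ}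
    (h : ∀ s : List ℕ, (s : Multiset ℕ) = C → s.head? = some b → ¬ P s) :
    bracketSum S θ P b C = 0 := by
  classical
  rw [bracketSum, Finset.filter_false_of_mem, Finset.sum_empty]
  intro s hs hbP
  rw [Multiset.mem_toFinset, Multiset.mem_lists_iff] at hs
  exact h s hs.symm hbP.1 hbP.2

theorem bracketSum_of_notMem {P : List ℕ → Prop} {b : ℕ} {C : Multiset ℕ} (h : b ∉ C) :
    bracketSum S θ P b C = 0 :=
  bracketSum_of_forall_not fun _ hs hb =>
    absurd (hs ▸ Multiset.mem_coe.2 (List.mem_of_mem_head? hb)) h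

open Classical in
theorem bracketSum_cons_eq_sum_bracket_cons (P : List ℕ → Prop) (b : ℕ) (C : Multiset ℕ) :
    bracketSum S θ P b (b ::ₘ C) =
      ∑ t ∈ C.lists.toFinset with P (b :: t), bracket S θ (b :: t) := by
  refine Finset.sum_nbij' List.tail (b :: ·) ?_ ?_ ?_ ?_ ?_ <;>
    simp only [Finset.mem_filter, Multiset.mem_toFinset, Multiset.mem_lists_iff]
  · rintro s ⟨hs, hb, hP⟩
    obtain ⟨t, rfl⟩ := List.head?_eq_some_iff.1 hb
    exact ⟨(Multiset.cons_inj_right b).1 hs, hP⟩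
  · rintro t ⟨rfl, hP⟩
    exact ⟨rfl, rfl, hP⟩
  · rintro s ⟨-, hb, -⟩
    exact List.cons_head?_tail hb
  · exact fun _ _ => rfl
  · rintro s ⟨-, hb, -⟩
    exact congrArg _ (List.cons_head?_tail hb).symm

theorem bracketSum_cons {P : List ℕ → Prop} {Q : ℕ → List ℕ → Prop} {b : ℕ} {C : Multiset ℕ}
    {s : Finset ℕ} (hC : C ≠ 0) (hs : C.toFinset ⊆ s)
    (hPQ : ∀ x t, ((x :: t : List ℕ) : Multiset ℕ) = C → (P (b :: x :: t) ↔ Q x (x :: t))) :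
    bracketSum S θ P b (b ::ₘ C) =
      ∑ x ∈ s, phi S (θ b - θ x) * bracketSum S θ (Q x) x C := by
  classical
  have hhead (t : List ℕ) (ht : C = t) : ∃ x u, t = x :: u := by
    refine List.exists_cons_of_ne_nil fun h => hC ?_
    rw [ht, h, Multiset.coe_nil]
  rw [bracketSum_cons_eq_sum_bracket_cons,
    ← Finset.sum_fiberwise_of_maps_to (g := fun t => t.headD 0) (t := s)]
  · refine Finset.sum_congr rfl fun x _ => ?_
    rw [bracketSum, Finset.mul_sum, Finset.filter_filter]
    refine Finset.sum_congr (Finset.filter_congr fun t ht => ?_) fun t ht => ?_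
    · rw [Multiset.mem_toFinset, Multiset.mem_lists_iff] at ht
      obtain ⟨y, u, rfl⟩ := hhead t ht
      simp only [hPQ y u ht.symm, List.headD_cons, List.head?_cons, Option.some_inj]
      exact ⟨by rintro ⟨hQ, rfl⟩; exact ⟨rfl, hQ⟩, by rintro ⟨rfl, hQ⟩; exact ⟨hQ, rfl⟩⟩
    · obtain ⟨u, rfl⟩ := List.head?_eq_some_iff.1 (Finset.mem_filter.1 ht).2.1
      rfl
  · intro t ht
    rw [Finset.mem_filter, Multiset.mem_toFinset, Multiset.mem_lists_iff] at ht
    obtain ⟨x, u, rfl⟩ := hhead t ht.1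
    exact hs (by simp [ht.1])

theorem pathSum_of_start_notMem {b r : ℕ} {C : Multiset ℕ} (h : b ∉ C) :
    pathSum S θ b r C = 0 := by
  rw [← bracketSum_getLast, bracketSum_of_notMem h]

theorem pathSum_of_end_notMem {b r : ℕ} {C : Multiset ℕ} (h : r ∉ C) :
    pathSum S θ b r C = 0 := by
  rw [← bracketSum_getLast]
  exact bracketSum_of_forall_not fun s hs _ hr =>
    absurd (hs ▸ Multiset.mem_coe.2 (List.mem_of_mem_getLast? hr)) h

theorem pathSum_cons {b r : ℕ} {C : Multiset ℕ} {s : Finset ℕ} (hC : C ≠ 0)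
    (hs : C.toFinset ⊆ s) :
    pathSum S θ b r (b ::ₘ C) = ∑ x ∈ s, phi S (θ b - θ x) * pathSum S θ x r C := by
  simp only [← bracketSum_getLast]
  exact bracketSum_cons (Q := fun _ s => s.getLast? = some r) hC hs fun x t _ =>
    by rw [List.getLast?_cons_cons]

theorem pathSum_singleton (r : ℕ) : pathSum S θ r r {r} = 1 := by
  have hpaths : paths r r {r} = {[r]} := by
    ext s
    simp only [paths, Finset.mem_filter, Multiset.mem_toFinset, Multiset.mem_lists_iff,
      Finset.mem_singleton]
    exact ⟨fun h => Multiset.coe_eq_singleton.1 h.1.symm, by rintro rfl; simp⟩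
  rw [pathSum, hpaths, Finset.sum_singleton, bracket]

theorem nextAfterLast_cons_of_mem {a c b : ℕ} {s : List ℕ} (h : a ∈ s) :
    NextAfterLast a c (b :: s) ↔ NextAfterLast a c s := by
  constructor
  · rintro ⟨_ | ⟨x, u⟩, v, huv, hv⟩
    · obtain ⟨-, rfl⟩ := List.cons.inj huv
      exact absurd h hv
    · exact ⟨u, v, (List.cons.inj huv).2, hv⟩
  · rintro ⟨u, v, rfl, hv⟩
    exact ⟨b :: u, v, rfl, hv⟩

theorem nextAfterLast_cons_of_notMem {a c : ℕ} {s : List ℕ} (h : a ∉ s) :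
    NextAfterLast a c (a :: s) ↔ s.head? = some c := by
  rw [List.head?_eq_some_iff]
  constructor
  · rintro ⟨_ | ⟨x, u⟩, v, huv, -⟩
    · exact ⟨v, (List.cons.inj huv).2⟩
    · exact absurd (by simp [(List.cons.inj huv).2]) h
  · rintro ⟨v, rfl⟩
    exact ⟨[], v, rfl, h⟩

end

/-- The submultisets of `A` that contain `r` exactly once. -/
def subOne (r : ℕ) (A : Multiset ℕ) : Finset (Multiset ℕ) :=
  A.powerset.toFinset.filter fun V => V.count r = 1

theorem mem_subOne {r : ℕ} {A V : Multiset ℕ} : V ∈ subOne r A ↔ V ≤ A ∧ V.count r = 1 := by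
  simp [subOne]

theorem exists_cons_of_mem_subOne {r : ℕ} {A V : Multiset ℕ} (hV : V ∈ subOne r A) :
    ∃ W, V = r ::ₘ W ∧ r ∉ W := by
  have hcount := (mem_subOne.1 hV).2
  obtain ⟨W, rfl⟩ := Multiset.exists_cons_of_mem (Multiset.count_pos.1 (hcount ▸ one_pos))
  rw [Multiset.count_cons_self, Nat.add_eq_right] at hcount
  exact ⟨W, rfl, Multiset.count_eq_zero.1 hcount⟩

theorem subOne_mono (r : ℕ) {A A' : Multiset ℕ} (h : A ≤ A') : subOne r A ⊆ subOne r A' :=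
  fun _ hV => mem_subOne.2 ⟨(mem_subOne.1 hV).1.trans h, (mem_subOne.1 hV).2⟩

section

variable {S : ℂ → ℂ} {θ : ℕ → ℂ}

theorem sum_subOne_cons_self {r : ℕ} {A : Multiset ℕ} (hr : r ∉ A) (f : Multiset ℕ → ℂ) :
    ∑ V ∈ subOne r (r ::ₘ A), pathSum S θ r r (r ::ₘ A - V + {r}) * f V = f (r ::ₘ A) := by
  rw [Finset.sum_eq_single (r ::ₘ A)]
  · rw [tsub_self, zero_add, pathSum_singleton, one_mul]
  · intro V hV hne
    obtain ⟨V, rfl, -⟩ := exists_cons_of_mem_subOne hV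
    have hVA : V ≤ A := (Multiset.cons_le_cons_iff r).1 (mem_subOne.1 hV).1
    have hrest : A - V ≠ 0 := fun h => hne (by rw [hVA.antisymm (tsub_eq_zero_iff_le.1 h)])
    have hr' : r ∉ A - V := fun h => hr (Multiset.mem_of_le (Multiset.sub_le_self _ _) h)
    rw [Multiset.sub_cons, Multiset.erase_cons_head, add_comm, Multiset.singleton_add,
      pathSum_cons hrest subset_rfl]
    simp only [pathSum_of_end_notMem hr', mul_zero, Finset.sum_const_zero, zero_mul]
  · intro h
    refine absurd (mem_subOne.2 ⟨le_rfl, ?_⟩) h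
    rw [Multiset.count_cons_self, Multiset.count_eq_zero_of_notMem hr]

theorem pathSum_cons_sub_of_not_le {b r : ℕ} {A V : Multiset ℕ} (hr : r ∈ A)
    (hV : V ∈ subOne r (b ::ₘ A)) (hVA : ¬ V ≤ A) : pathSum S θ b r (b ::ₘ A - V + {r}) = 0 := by
  have hle := Multiset.le_iff_count.1 (mem_subOne.1 hV).1
  refine pathSum_of_start_notMem fun hb => hVA (Multiset.le_iff_count.2 fun x => ?_)
  rcases eq_or_ne x b with rfl | hx
  · rcases Multiset.mem_add.1 hb with hb | hb
    · have := Multiset.count_pos.2 hb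
      rw [Multiset.count_sub, Multiset.count_cons_self] at this
      omega
    · rw [Multiset.mem_singleton.1 hb, (mem_subOne.1 hV).2]
      exact Multiset.count_pos.2 hr
  · exact (hle x).trans_eq (Multiset.count_cons_of_ne hx A)

theorem sum_subOne_cons_of_mem {b r : ℕ} {A : Multiset ℕ} (hr : r ∈ A) (f : Multiset ℕ → ℂ) :
    ∑ V ∈ subOne r (b ::ₘ A), pathSum S θ b r (b ::ₘ A - V + {r}) * f V =
      ∑ x ∈ A.toFinset, phi S (θ b - θ x) *
        ∑ V ∈ subOne r A, pathSum S θ x r (A - V + {r}) * f V := by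
  simp only [Finset.mul_sum]
  rw [Finset.sum_comm, ← Finset.sum_subset (subOne_mono r (Multiset.le_cons_self A b))]
  · refine Finset.sum_congr rfl fun V hV => ?_
    have hsub : (A - V + {r}).toFinset ⊆ A.toFinset := by
      rw [Multiset.toFinset_subset]
      refine fun x hx => (Multiset.mem_add.1 hx).elim
        (Multiset.mem_of_le (Multiset.sub_le_self _ _)) fun hx => ?_
      rwa [Multiset.mem_singleton.1 hx]
    rw [Multiset.cons_sub_of_le _ (mem_subOne.1 hV).1, Multiset.cons_add,
      pathSum_cons (by simp) hsub, Finset.sum_mul]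
    simp only [mul_assoc]
  · intro V hV hVA
    rw [pathSum_cons_sub_of_not_le hr hV, zero_mul]
    exact fun h => hVA (mem_subOne.2 ⟨h, (mem_subOne.1 hV).2⟩)

/-- The summation index `V` collects what remains of a sequence after its last `r`, and this `r`. -/
theorem eq_sum_subOne_of_recursion {K : ℕ → Multiset ℕ → ℂ} {r : ℕ} {A : Multiset ℕ}
    (hK : ∀ b A', b ::ₘ A' ≤ A → r ∈ A' →
      K b (b ::ₘ A') = ∑ x ∈ A'.toFinset, phi S (θ b - θ x) * K x A')
    {b : ℕ} (hb : b ∈ A) (hr : r ∈ A) :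
    K b A = ∑ V ∈ subOne r A, pathSum S θ b r (A - V + {r}) * K r V := by
  induction A using Multiset.strongInductionOn generalizing b with
  | ih A ih =>
    obtain ⟨A, rfl⟩ := Multiset.exists_cons_of_mem hb
    by_cases hrA : r ∈ A
    · rw [hK b A le_rfl hrA, sum_subOne_cons_of_mem hrA]
      refine Finset.sum_congr rfl fun x hx => ?_
      rw [ih A (Multiset.lt_cons_self A b)
        (fun b' A' hA' => hK b' A' (hA'.trans (Multiset.le_cons_self A b)))
        (Multiset.mem_toFinset.1 hx) hrA]
    · obtain rfl : r = b := (Multiset.mem_cons.1 hr).resolve_right hrA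
      exact (sum_subOne_cons_self hrA (K r)).symm

theorem sum_subOne_cons_of_ne {b r : ℕ} (hbr : b ≠ r) (q : ℕ) (C : Multiset ℕ)
    (g : Multiset ℕ → ℂ) :
    ∑ V ∈ subOne r (b ::ₘ C), g (b ::ₘ C - V) * pathSum S θ b q V =
      ∑ x ∈ C.toFinset, phi S (θ b - θ x) *
        ∑ V ∈ subOne r C, g (C - V) * pathSum S θ x q V := by
  have hmem (V : Multiset ℕ) : b ::ₘ V ∈ subOne r (b ::ₘ C) ↔ V ∈ subOne r C := by
    rw [mem_subOne, mem_subOne, Multiset.cons_le_cons_iff, Multiset.count_cons_of_ne hbr.symm]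
  have himage : (subOne r C).image (b ::ₘ ·) ⊆ subOne r (b ::ₘ C) :=
    Finset.image_subset_iff.2 fun V hV => (hmem V).2 hV
  rw [← Finset.sum_subset himage,
    Finset.sum_image fun _ _ _ _ h => (Multiset.cons_inj_right b).1 h]
  · simp only [Finset.mul_sum]
    rw [Finset.sum_comm]
    refine Finset.sum_congr rfl fun V hV => ?_
    obtain ⟨W, hW, -⟩ := exists_cons_of_mem_subOne hV
    rw [Multiset.sub_cons, Multiset.erase_cons_head, pathSum_cons (by simp [hW])
      (Multiset.toFinset_subset.2 (Multiset.subset_of_le (mem_subOne.1 hV).1)), Finset.mul_sum]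
    exact Finset.sum_congr rfl fun x _ => mul_left_comm _ _ _
  · intro V hV hV'
    rw [pathSum_of_start_notMem (b := b), mul_zero]
    intro hb
    obtain ⟨W, rfl⟩ := Multiset.exists_cons_of_mem hb
    exact hV' (Finset.mem_image_of_mem _ ((hmem W).1 hV))

theorem pathSum_eq_sum_subOne (b q : ℕ) {r : ℕ} {C : Multiset ℕ} (hr : r ∈ C) :
    pathSum S θ b q C =
      ∑ V ∈ subOne r C, pathSum S θ r r (C - V + {r}) * pathSum S θ b q V := by
  have hne {A : Multiset ℕ} (h : r ∈ A) : A ≠ 0 := fun hA => Multiset.notMem_zero r (hA ▸ h)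
  induction C using Multiset.strongInductionOn generalizing b with
  | ih C ih =>
    rcases eq_or_ne b r with rfl | hbr
    · exact eq_sum_subOne_of_recursion (K := fun b => pathSum S θ b q)
        (fun _ _ _ hA => pathSum_cons (hne hA) subset_rfl) hr hr
    by_cases hb : b ∈ C
    · obtain ⟨C, rfl⟩ := Multiset.exists_cons_of_mem hb
      have hrC : r ∈ C := (Multiset.mem_cons.1 hr).resolve_left hbr.symm
      rw [sum_subOne_cons_of_ne hbr q C fun W => pathSum S θ r r (W + {r}),
        pathSum_cons (hne hrC) subset_rfl]
      exact Finset.sum_congr rfl fun x _ => by rw [ih C (Multiset.lt_cons_self C b) x hrC]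
    · rw [pathSum_of_start_notMem hb, Finset.sum_eq_zero]
      intro V hV
      rw [pathSum_of_start_notMem (b := b) fun h => hb (Multiset.mem_of_le (mem_subOne.1 hV).1 h),
        mul_zero]

theorem bracketSum_nextAfterLast_cons {a : ℕ} {V : Multiset ℕ} (ha : a ∉ V) (c q : ℕ) :
    bracketSum S θ (fun s => s.getLast? = some q ∧ NextAfterLast a c s) a (a ::ₘ V) =
      phi S (θ a - θ c) * pathSum S θ c q V := by
  rcases eq_or_ne V 0 with rfl | hV
  · rw [pathSum_of_start_notMem (Multiset.notMem_zero c), mul_zero]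
    refine bracketSum_of_forall_not fun s hs _ h => ?_
    rw [Multiset.coe_eq_singleton.1 hs, nextAfterLast_cons_of_notMem List.not_mem_nil] at h
    exact absurd h.2 (by simp)
  have hstep (x : ℕ) (t : List ℕ) (ht : ((x :: t : List ℕ) : Multiset ℕ) = V) :
      ((a :: x :: t).getLast? = some q ∧ NextAfterLast a c (a :: x :: t)) ↔
        ((x :: t).getLast? = some q ∧ x = c) := by
    rw [List.getLast?_cons_cons, nextAfterLast_cons_of_notMem (by rwa [← Multiset.mem_coe, ht]),
      List.head?_cons, Option.some_inj]
  rw [bracketSum_cons (Q := fun x s => s.getLast? = some q ∧ x = c) hV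
    (Finset.subset_insert c V.toFinset) hstep, Finset.sum_eq_single_of_mem c
    (Finset.mem_insert_self c _)]
  · simp only [and_true, bracketSum_getLast]
  · intro x _ hx
    rw [bracketSum_of_forall_not fun _ _ _ h => hx h.2, mul_zero]

theorem bracketSum_nextAfterLast {a : ℕ} {C : Multiset ℕ} (ha : a ∈ C) (c q : ℕ) :
    bracketSum S θ (fun s => s.getLast? = some q ∧ NextAfterLast a c s) a C =
      phi S (θ a - θ c) *
        ∑ V ∈ subOne a C, pathSum S θ a a (C - V + {a}) * pathSum S θ c q (V.erase a) := by
  rw [eq_sum_subOne_of_recursion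
    (K := bracketSum S θ fun s => s.getLast? = some q ∧ NextAfterLast a c s) ?_ ha ha,
    Finset.mul_sum]
  · refine Finset.sum_congr rfl fun V hV => ?_
    obtain ⟨V, rfl, haV⟩ := exists_cons_of_mem_subOne hV
    rw [bracketSum_nextAfterLast_cons haV, Multiset.erase_cons_head, mul_left_comm]
  · intro b A _ hA
    refine bracketSum_cons (Q := fun _ s => s.getLast? = some q ∧ NextAfterLast a c s)
      (fun h => Multiset.notMem_zero a (h ▸ hA)) subset_rfl fun x t ht => ?_
    rw [List.getLast?_cons_cons, nextAfterLast_cons_of_mem (by rwa [← Multiset.mem_coe, ht])]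

end

/-! ### Resolution at the last occurrences of two labels -/

/-- The submultisets of `A` that contain `a` exactly `i` times and `b` exactly `j` times. -/
def subCount (a b i j : ℕ) (A : Multiset ℕ) : Finset (Multiset ℕ) :=
  A.powerset.toFinset.filter fun R => R.count a = i ∧ R.count b = j

theorem mem_subCount {a b i j : ℕ} {A R : Multiset ℕ} :
    R ∈ subCount a b i j A ↔ R ≤ A ∧ R.count a = i ∧ R.count b = j := by
  simp [subCount]

theorem filter_notMem_subOne (a b : ℕ) (A : Multiset ℕ) :
    (subOne a A).filter (b ∉ ·) = subCount a b 1 0 A := by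
  ext R
  rw [Finset.mem_filter, mem_subOne, mem_subCount, Multiset.count_eq_zero, and_assoc]

section

variable {a b n m : ℕ} {B : Finset ℕ}

theorem eq_replicate_add_of_le (ha : a ∉ B) (hb : b ∉ B) (hab : a ≠ b) {R : Multiset ℕ}
    (hR : R ≤ Multiset.replicate n a + Multiset.replicate m b + B.val) :
    R = Multiset.replicate (R.count a) a + Multiset.replicate (R.count b) b +
      (B.filter (· ∈ R)).val := by
  ext x
  have hx := Multiset.le_iff_count.1 hR x
  have hxR := Multiset.count_eq_zero (s := R) (a := x)
  simp only [Multiset.count_add, Multiset.count_replicate,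
    Multiset.count_eq_of_nodup (Finset.nodup _), Finset.mem_val, Finset.mem_filter] at hx ⊢
  grind

theorem sum_subCount {A : Multiset ℕ}
    (hA : A = Multiset.replicate n a + Multiset.replicate m b + B.val) (ha : a ∉ B) (hb : b ∉ B)
    (hab : a ≠ b) {i j : ℕ} (hi : i ≤ n) (hj : j ≤ m) (f : Multiset ℕ → ℂ) :
    ∑ R ∈ subCount a b i j A, f R =
      ∑ D ∈ B.powerset, f (Multiset.replicate i a + Multiset.replicate j b + D.val) := by
  subst hA
  have hcount {D : Finset ℕ} (hD : D ⊆ B) :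
      (Multiset.replicate i a + Multiset.replicate j b + D.val).count a = i ∧
        (Multiset.replicate i a + Multiset.replicate j b + D.val).count b = j := by
    have haD := Multiset.count_eq_zero_of_notMem (s := D.val) fun h => ha (hD h)
    have hbD := Multiset.count_eq_zero_of_notMem (s := D.val) fun h => hb (hD h)
    simp [Multiset.count_replicate, haD, hbD, hab, hab.symm]
  have himage : subCount a b i j (Multiset.replicate n a + Multiset.replicate m b + B.val) =
      B.powerset.image fun D => Multiset.replicate i a + Multiset.replicate j b + D.val := by
    ext R
    rw [mem_subCount, Finset.mem_image]
    constructor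
    · rintro ⟨hR, rfl, rfl⟩
      exact ⟨B.filter (· ∈ R), Finset.mem_powerset.2 (Finset.filter_subset _ _),
        (eq_replicate_add_of_le ha hb hab hR).symm⟩
    · rintro ⟨D, hD, rfl⟩
      rw [Finset.mem_powerset] at hD
      exact ⟨add_le_add (add_le_add ((Multiset.replicate_le_replicate a).2 hi)
        ((Multiset.replicate_le_replicate b).2 hj)) (Finset.val_le_iff.2 hD), hcount hD⟩
  rw [himage, Finset.sum_image fun _ _ _ _ h => Finset.val_injective (add_left_cancel h)]

end

section

variable {A D : Multiset ℕ} {a : ℕ}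

theorem sum_subOne_shift (hD : D ≤ A) (ha : a ∉ D) (P : Multiset ℕ) (f : Multiset ℕ → ℂ) :
    ∑ R ∈ (subOne a A).filter (P + D ≤ ·), f R =
      ∑ V ∈ (subOne a (A - D)).filter (P ≤ ·), f (V + D) := by
  have hcount := Multiset.count_eq_zero_of_notMem ha
  have hcancel {R : Multiset ℕ} (hR : R ∈ (subOne a A).filter (P + D ≤ ·)) : R - D + D = R :=
    tsub_add_cancel_of_le ((Multiset.le_add_left D P).trans (Finset.mem_filter.1 hR).2)
  refine Finset.sum_nbij' (· - D) (· + D) ?_ ?_ (fun R hR => hcancel hR)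
    (fun V _ => add_tsub_cancel_right V D) (fun R hR => congrArg f (hcancel hR).symm)
  · intro R hR
    rw [Finset.mem_filter, mem_subOne] at hR ⊢
    exact ⟨⟨tsub_le_tsub_right hR.1.1 D, by rw [Multiset.count_sub, hcount, hR.1.2]⟩,
      le_tsub_of_add_le_right hR.2⟩
  · intro V hV
    rw [Finset.mem_filter, mem_subOne] at hV ⊢
    exact ⟨⟨(le_tsub_iff_right hD).1 hV.1.1, by rw [Multiset.count_add, hcount, hV.1.2]⟩,
      add_le_add_left hV.2 D⟩

theorem mem_sub_of_notMem (ha : a ∈ A) (haD : a ∉ D) : a ∈ A - D := by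
  rwa [← Multiset.count_pos, Multiset.count_sub, Multiset.count_eq_zero_of_notMem haD,
    tsub_zero, Multiset.count_pos]

variable (S : ℂ → ℂ) (θ : ℕ → ℂ)

/-- The sum of `[s]_φ [t]_φ` over the pairs made of a sequence `s` from `a` to `a` and a sequence
`t` from `b` to `b` without `a`, which together contain every member of `C` exactly once. -/
noncomputable def splitPathSum (a b : ℕ) (C : Multiset ℕ) : ℂ :=
  ∑ V ∈ subOne a C, pathSum S θ a a (C - V + {a}) * pathSum S θ b b (V.erase a)

theorem sum_paths'_eq_mul_splitPathSum {C : Multiset ℕ} (h1 : 1 ∈ C) :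
    ∑ s ∈ paths' C, bracket S θ s = phi S (θ 1 - θ 2) * splitPathSum S θ 1 2 C := by
  rw [sum_paths'_eq_bracketSum, bracketSum_nextAfterLast h1, splitPathSum]

/-- The weight of `c R` when `c A` is resolved first at the last `a` and then at the last `b` (see
`IsResolvable`); the summation index `V` is what remains after the first step. -/
noncomputable def resolventSum (a b : ℕ) (A R : Multiset ℕ) : ℂ :=
  ∑ V ∈ (subOne a A).filter (R ≤ ·), pathSum S θ a a (A - V + {a}) * pathSum S θ b b (V - R + {b})

variable {S θ}

theorem resolventSum_singleton_add (b : ℕ) (hD : D ≤ A) (ha : a ∈ A) (haD : a ∉ D) :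
    resolventSum S θ a b A ({b} + D) = pathSum S θ b b (A - D) := by
  rw [resolventSum, sum_subOne_shift hD haD, pathSum_eq_sum_subOne b b (mem_sub_of_notMem ha haD),
    Finset.sum_filter]
  refine Finset.sum_congr rfl fun V _ => ?_
  split_ifs with hV
  · rw [add_tsub_add_eq_tsub_right, tsub_add_cancel_of_le hV, tsub_add_eq_tsub_tsub_swap]
  · rw [pathSum_of_start_notMem (b := b) (fun h => hV (Multiset.singleton_le.2 h)), mul_zero]

theorem resolventSum_pair_add (b : ℕ) (hD : D ≤ A) (haD : a ∉ D) :
    resolventSum S θ a b A ({a} + {b} + D) = splitPathSum S θ a b (A - D) := by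
  rw [resolventSum, sum_subOne_shift hD haD, splitPathSum, Finset.sum_filter]
  refine Finset.sum_congr rfl fun V hV => ?_
  obtain ⟨W, rfl, -⟩ := exists_cons_of_mem_subOne hV
  rw [Multiset.erase_cons_head]
  simp only [← Multiset.singleton_add, add_le_add_iff_left]
  split_ifs with hW
  · rw [add_tsub_add_eq_tsub_right, add_tsub_add_eq_tsub_left, tsub_add_cancel_of_le hW,
      tsub_add_eq_tsub_tsub_swap]
  · rw [pathSum_of_start_notMem (b := b) (fun h => hW (Multiset.singleton_le.2 h)), mul_zero]

/-- `c` satisfies, for every label `r`, the resolution of a first-step recursion at the last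
occurrence of `r` in a sequence that starts with `r`. -/
def IsResolvable (S : ℂ → ℂ) (θ : ℕ → ℂ) (A : Multiset ℕ) (c : Multiset ℕ → ℂ) : Prop :=
  ∀ r, ∀ A' ≤ A, r ∈ A' → c A' = ∑ V ∈ subOne r A', pathSum S θ r r (A' - V + {r}) * c V

theorem IsResolvable.sum_filter_mem_eq {c : Multiset ℕ → ℂ} (hc : IsResolvable S θ A c)
    (a b : ℕ) :
    ∑ V ∈ (subOne a A).filter (b ∈ ·), pathSum S θ a a (A - V + {a}) * c V =
      ∑ R ∈ subCount a b 0 1 A ∪ subCount a b 1 1 A, c R * resolventSum S θ a b A R := by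
  have hresolve (V : Multiset ℕ) (hV : V ∈ (subOne a A).filter (b ∈ ·)) :
      pathSum S θ a a (A - V + {a}) * c V = ∑ R ∈ subOne b V, c R *
        (pathSum S θ a a (A - V + {a}) * pathSum S θ b b (V - R + {b})) := by
    rw [Finset.mem_filter, mem_subOne] at hV
    rw [hc b V hV.1.1 hV.2, Finset.mul_sum]
    exact Finset.sum_congr rfl fun _ _ => by ring
  simp only [resolventSum, Finset.mul_sum]
  rw [Finset.sum_congr rfl hresolve]
  refine Finset.sum_comm' fun V R => ?_
  simp only [Finset.mem_filter, mem_subOne, Finset.mem_union, mem_subCount]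
  constructor
  · rintro ⟨⟨⟨hV, haV⟩, -⟩, hR, hbR⟩
    have haR := Multiset.le_iff_count.1 hR a
    have hRA := hR.trans hV
    exact ⟨⟨⟨hV, haV⟩, hR⟩, by grind⟩
  · rintro ⟨⟨⟨hV, haV⟩, hR⟩, hcount⟩
    have hbR : R.count b = 1 := hcount.elim (·.2.2) (·.2.2)
    exact ⟨⟨⟨hV, haV⟩, Multiset.mem_of_le hR (Multiset.count_pos.1 (by omega))⟩, hR, hbR⟩

theorem IsResolvable.eq_sum_powerset {n m b : ℕ} {B : Finset ℕ} {c : Multiset ℕ → ℂ}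
    (hA : A = Multiset.replicate n a + Multiset.replicate m b + B.val) (hc : IsResolvable S θ A c)
    (ha : a ∉ B) (hb : b ∉ B) (hab : a ≠ b) (hn : 1 ≤ n) (hm : 1 ≤ m) :
    c A = ∑ D ∈ B.powerset,
      (c (a ::ₘ b ::ₘ D.val) * splitPathSum S θ a b (A - D.val) +
        c (a ::ₘ D.val) * pathSum S θ a a (A - D.val) +
        c (b ::ₘ D.val) * pathSum S θ b b (A - D.val)) := by
  have haA : a ∈ A := by
    simpa [hA, Multiset.mem_replicate] using Or.inl (Or.inl (Nat.one_le_iff_ne_zero.1 hn))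
  have hsub (D : Finset ℕ) (hD : D ∈ B.powerset) : D.val ≤ A ∧ a ∉ D.val := by
    rw [Finset.mem_powerset] at hD
    exact ⟨hA ▸ (Finset.val_le_iff.2 hD).trans (Multiset.le_add_left _ _), fun h => ha (hD h)⟩
  have hdisj : Disjoint (subCount a b 0 1 A) (subCount a b 1 1 A) := by
    simp +contextual [Finset.disjoint_left, mem_subCount]
  rw [hc a A le_rfl haA, ← Finset.sum_filter_add_sum_filter_not _ (b ∈ ·),
    hc.sum_filter_mem_eq, filter_notMem_subOne, Finset.sum_union hdisj]
  rw [sum_subCount hA ha hb hab n.zero_le hm, sum_subCount hA ha hb hab hn hm,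
    sum_subCount hA ha hb hab hn m.zero_le, ← Finset.sum_add_distrib, ← Finset.sum_add_distrib]
  refine Finset.sum_congr rfl fun D hD => ?_
  obtain ⟨hDA, haD⟩ := hsub D hD
  have haAD : {a} ≤ A - D.val := Multiset.singleton_le.2 (mem_sub_of_notMem haA haD)
  simp only [Multiset.replicate_one, Multiset.replicate_zero, zero_add, add_zero]
  rw [resolventSum_singleton_add b hDA haA haD, resolventSum_pair_add b hDA haD,
    tsub_add_eq_tsub_tsub_swap, tsub_add_cancel_of_le haAD]
  simp only [add_assoc, Multiset.singleton_add, Multiset.cons_add]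
  ring

end

section

variable {S : ℂ → ℂ} {θ : ℕ → ℂ} {A : Multiset ℕ}
variable (hS : IsScatteringMatrix S) {F : (n : ℕ) → (Fin n → ℂ) → ℂ} (hF : IsFormFactor S F)
include hS hF

theorem leadingCoeff_self_eq (hA : AdmissibleLabels S θ A) {r : ℕ} (hr : r ∈ A) :
    leadingCoeff F θ A A =
      ∑ V ∈ subOne r A, pathSum S θ r r (A - V + {r}) * leadingCoeff F θ V V := by
  have hrec (b : ℕ) (A' : Multiset ℕ) (hA' : b ::ₘ A' ≤ A) (hr' : r ∈ A') :
      leadingCoeff F θ (b ::ₘ A') ((r ::ₘ b ::ₘ A').erase b) = ∑ x ∈ A'.toFinset,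
        phi S (θ b - θ x) * leadingCoeff F θ A' ((r ::ₘ A').erase x) := by
    have hsub : r ::ₘ A' ⊆ A' := Multiset.cons_subset.2 ⟨hr', Multiset.Subset.refl _⟩
    have htoFinset : (r ::ₘ A').toFinset = A'.toFinset := by
      rw [Multiset.toFinset_cons, Finset.insert_eq_of_mem (Multiset.mem_toFinset.2 hr')]
    rw [Multiset.cons_swap, Multiset.erase_cons_head, leadingCoeff_eq_sum_erase hS hF
      (hA.mono (Multiset.subset_of_le hA')) (by simp) (Multiset.mem_cons_self b A')
      (by rwa [Multiset.erase_cons_head]), Multiset.erase_cons_head, htoFinset]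
  simpa only [Multiset.erase_cons_head] using eq_sum_subOne_of_recursion
    (K := fun b A' => leadingCoeff F θ A' ((r ::ₘ A').erase b)) hrec hr hr

theorem isResolvable_leadingCoeff (hA : AdmissibleLabels S θ A) :
    IsResolvable S θ A fun A' => leadingCoeff F θ A' A' := fun _ _ hA' hr =>
  leadingCoeff_self_eq hS hF (hA.mono (Multiset.subset_of_le hA')) hr

end

/-! ### The degenerate connected form factor -/

theorem IsScatteringMatrix.admissibleLabels {S : ℂ → ℂ} (hS : IsScatteringMatrix S) {θ : ℕ → ℂ}
    {s : Finset ℕ} (hdistinct : ∀ i ∈ s, ∀ j ∈ s, i ≠ j → Complex.sinh (θ i - θ j) ≠ 0)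
    (hregular : ∀ i ∈ s, ∀ j ∈ s, i ≠ j → S (θ i - θ j) ≠ 0) {A : Multiset ℕ}
    (hA : ∀ a ∈ A, a ∈ s) : AdmissibleLabels S θ A := by
  rintro ⟨a, ha⟩ ⟨b, hb⟩
  rcases eq_or_ne a b with rfl | hab
  · exact ⟨by simp [hS.at_zero], fun h => absurd rfl h⟩
  · exact ⟨hregular a (hA a ha) b (hA b hb) hab, fun _ => hdistinct a (hA a ha) b (hA b hb) hab⟩

theorem injOn_of_sinh_sub_ne_zero {ι : Type*} {θ : ι → ℂ} {s : Set ι}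
    (h : ∀ i ∈ s, ∀ j ∈ s, i ≠ j → Complex.sinh (θ i - θ j) ≠ 0) : Set.InjOn θ s := by
  intro i hi j hj hij
  by_contra hne
  exact h i hi j hj hne (by rw [hij, sub_self, Complex.sinh_zero])

section

variable {a b : ℕ} {B : Finset ℕ}

theorem sortedLE_replicate_append_sort (n m : ℕ) (hab : a ≤ b) (hB : ∀ x ∈ B, b ≤ x) :
    (List.replicate n a ++ List.replicate m b ++ B.sort).SortedLE := by
  refine List.Pairwise.sortedLE ?_
  simp only [List.pairwise_append, List.pairwise_replicate, List.mem_append, List.mem_replicate,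
    Finset.mem_sort]
  refine ⟨⟨by simp, by simp, ?_⟩, B.pairwise_sort _, ?_⟩
  · rintro _ ⟨-, rfl⟩ _ ⟨-, rfl⟩
    exact hab
  · rintro _ (⟨-, rfl⟩ | ⟨-, rfl⟩) x hx
    exacts [hab.trans (hB x hx), hB x hx]

theorem symFactor_replicate_add (n m : ℕ) (ha : a ∉ B) (hb : b ∉ B) (hab : a ≠ b) :
    symFactor (Multiset.replicate n a + Multiset.replicate m b + B.val) =
      n.factorial * m.factorial := by
  have hsub : (Multiset.replicate n a + Multiset.replicate m b + B.val).toFinset ⊆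
      insert a (insert b B) := by
    intro x
    simp only [Multiset.mem_toFinset, Multiset.mem_add, Multiset.mem_replicate, Finset.mem_val,
      Finset.mem_insert]
    tauto
  rw [symFactor_eq_prod hsub, Finset.prod_insert (by simp [ha, hab]), Finset.prod_insert hb,
    Finset.prod_eq_one, mul_one]
  · simp [Multiset.count_replicate, ha, hb, hab, hab.symm]
  · intro x hx
    have hxa : a ≠ x := fun h => ha (h ▸ hx)
    have hxb : b ≠ x := fun h => hb (h ▸ hx)
    simp [Multiset.count_replicate, Multiset.count_eq_of_nodup B.nodup, hx, hxa, hxb]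

end

section

variable {S : ℂ → ℂ} (hS : IsScatteringMatrix S) {F : (n : ℕ) → (Fin n → ℂ) → ℂ}
  (hF : IsFormFactor S F) {θ : ℕ → ℂ} {A : Multiset ℕ} (hθ : AdmissibleLabels S θ A)
include hS hF hθ

theorem connected_rapidities_sort (hinj : Set.InjOn θ {a | a ∈ A}) (D : Finset ℕ)
    (hDA : D.val ⊆ A) :
    connected F (rapidities θ D.sort) = leadingCoeff F θ D.val D.val := by
  have hcoe : (D.sort : Multiset ℕ) = D.val := D.sort_eq _
  rw [connected_rapidities hS hF D.sortedLT_sort (hθ.mono (hcoe ▸ hDA))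
    (hinj.mono fun x hx => hDA (hcoe ▸ hx)), hcoe]

theorem connected_rapidities_cons_sort (hinj : Set.InjOn θ {a | a ∈ A}) {a : ℕ} {D : Finset ℕ}
    (ha : a ∈ A) (hDA : D.val ⊆ A) (hD : ∀ x ∈ D, a < x) :
    connected F (rapidities θ (a :: D.sort)) = leadingCoeff F θ (a ::ₘ D.val) (a ::ₘ D.val) := by
  have haD : a ∉ D := fun h => lt_irrefl a (hD a h)
  rw [← Finset.sort_cons _ (fun x hx => (hD x hx).le) haD]
  exact connected_rapidities_sort hS hF hθ hinj (D.cons a haD) (Multiset.cons_subset.2 ⟨ha, hDA⟩)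

theorem hasDegenerateValue_replicate {a b n m : ℕ} {B : Finset ℕ}
    (hA : A = Multiset.replicate n a + Multiset.replicate m b + B.val)
    (hinj : Set.InjOn θ {x | x ∈ A}) (hab : a < b) (hB : ∀ x ∈ B, b < x) (hn : 1 ≤ n)
    (hm : 1 ≤ m) :
    HasDegenerateValue F (rapidities θ (List.replicate n a ++ List.replicate m b ++ B.sort))
      (n.factorial * m.factorial * ∑ D ∈ B.powerset,
        (connected F (rapidities θ (a :: b :: D.sort)) * splitPathSum S θ a b (A - D.val) +
          connected F (rapidities θ (a :: D.sort)) * pathSum S θ a a (A - D.val) +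
          connected F (rapidities θ (b :: D.sort)) * pathSum S θ b b (A - D.val))) := by
  have ha' : a ∉ B := fun h => lt_asymm hab (hB a h)
  have hb' : b ∉ B := fun h => lt_irrefl b (hB b h)
  have hcoe : ((List.replicate n a ++ List.replicate m b ++ B.sort : List ℕ) : Multiset ℕ) = A := by
    rw [hA, ← Multiset.coe_add, ← Multiset.coe_add, Multiset.coe_replicate,
      Multiset.coe_replicate, Finset.sort_eq]
  have hvalue := hasDegenerateValue_rapidities hS hF (sortedLE_replicate_append_sort n m hab.le
    fun x hx => (hB x hx).le) (hcoe ▸ hθ)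
  rw [hcoe, (isResolvable_leadingCoeff hS hF hθ).eq_sum_powerset hA ha' hb' hab.ne hn hm] at hvalue
  convert hvalue using 2
  · rw [hA, symFactor_replicate_add n m ha' hb' hab.ne]
  refine Finset.sum_congr rfl fun D hD => ?_
  rw [Finset.mem_powerset] at hD
  have haA : a ∈ A := by simp [hA, Multiset.mem_replicate, Nat.one_le_iff_ne_zero.1 hn]
  have hbA : b ∈ A := by simp [hA, Multiset.mem_replicate, Nat.one_le_iff_ne_zero.1 hm]
  have hDA : D.val ⊆ A := fun x hx => hA ▸ Multiset.mem_add.2 (Or.inr (hD hx))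
  have hbD : ∀ x ∈ D, b < x := fun x hx => hB x (hD hx)
  have haD : ∀ x ∈ D, a < x := fun x hx => hab.trans (hbD x hx)
  have hbD' : b ∉ D := fun h => hb' (hD h)
  have habD : ∀ x ∈ D.cons b hbD', a < x := by
    simpa [hab] using haD
  have hpair := connected_rapidities_cons_sort hS hF hθ hinj haA
    (Multiset.cons_subset.2 ⟨hbA, hDA⟩) habD
  rw [Finset.sort_cons _ (fun x hx => (hbD x hx).le) hbD'] at hpair
  rw [hpair, connected_rapidities_cons_sort hS hF hθ hinj haA hDA haD,
    connected_rapidities_cons_sort hS hF hθ hinj hbA hDA hbD]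
  rfl

end

end DiagFF

theorem mainTheorem5
    (S : ℂ → ℂ) (hS : DiagFF.IsScatteringMatrix S)
    (F : (n : ℕ) → (Fin n → ℂ) → ℂ) (hF : DiagFF.IsFormFactor S F)
    (n m k : ℕ) (hn : 1 ≤ n) (hm : 1 ≤ m)
    (θ : ℕ → ℂ)
    (hdistinct : ∀ i ∈ Finset.Icc 1 (k + 2), ∀ j ∈ Finset.Icc 1 (k + 2), i ≠ j →
      Complex.sinh (θ i - θ j) ≠ 0)
    (hregular : ∀ i ∈ Finset.Icc 1 (k + 2), ∀ j ∈ Finset.Icc 1 (k + 2), i ≠ j →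
      S (θ i - θ j) ≠ 0)
    (hphi : DiagFF.phi S (θ 1 - θ 2) ≠ 0)
    (B : Finset ℕ) (hB : B = Finset.Icc 3 (k + 2))
    (A : Multiset ℕ) (hA : A = Multiset.replicate n 1 + Multiset.replicate m 2 + B.val) :
    DiagFF.HasDegenerateValue F
      (DiagFF.rapidities θ (List.replicate n 1 ++ List.replicate m 2 ++ B.sort))
      ((n.factorial : ℂ) * (m.factorial : ℂ) *
        ∑ Bp ∈ B.powerset,
          (DiagFF.connected F (DiagFF.rapidities θ (1 :: 2 :: Bp.sort)) /
                DiagFF.phi S (θ 1 - θ 2) *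
              ∑ s ∈ DiagFF.paths' (A - Bp.val), DiagFF.bracket S θ s
            + DiagFF.connected F (DiagFF.rapidities θ (1 :: Bp.sort)) *
              ∑ s ∈ DiagFF.paths 1 1 (A - Bp.val), DiagFF.bracket S θ s
            + DiagFF.connected F (DiagFF.rapidities θ (2 :: Bp.sort)) *
              ∑ s ∈ DiagFF.paths 2 2 (A - Bp.val), DiagFF.bracket S θ s)) := by
  have hlt : ∀ x ∈ B, 2 < x := fun x hx => (Finset.mem_Icc.1 (hB ▸ hx)).1
  have hAmem : ∀ x ∈ A, x ∈ Finset.Icc 1 (k + 2) := by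
    intro x hx
    simp only [hA, hB, Multiset.mem_add, Multiset.mem_replicate, Finset.mem_val,
      Finset.mem_Icc] at hx ⊢
    omega
  have hmem : 1 ∈ A := by simp [hA, Multiset.mem_replicate, Nat.one_le_iff_ne_zero.1 hn]
  have hinj := DiagFF.injOn_of_sinh_sub_ne_zero hdistinct
  convert DiagFF.hasDegenerateValue_replicate hS hF (hS.admissibleLabels hdistinct hregular hAmem)
    hA (hinj.mono hAmem) one_lt_two hlt hn hm using 2
  refine Finset.sum_congr rfl fun D hD => ?_
  have h1D : 1 ∉ D.val := fun h => absurd (hlt 1 (Finset.mem_powerset.1 hD h)) (by simp)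
  rw [DiagFF.sum_paths'_eq_mul_splitPathSum S θ (DiagFF.mem_sub_of_notMem hmem h1D), ← mul_assoc,
    div_mul_cancel₀ _ hphi]
  rfl
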